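/- Let $k$ be a field, let $r\ge 1$ be an integer, and let $B=k\langle x,y\rangle/(y^{r+1})$, graded by $\deg x=\deg y=1$. Let $Q$ be the quiver with vertices $1,\dots,r+1$, an arrow $x_i:i\to 1$ for each $1\le i\le r+1$, and an arrow $y_i:i\to i+1$ for each $1\le i\le r$. Let $kQ$ be its path algebra, graded by path length, where $pq$ denotes the path "traverse $p$, then $q$". For $A=B$ or $A=kQ$, let $\mathsf{gr}\,A$ be the category of finitely presented $\mathbb Z$-graded left $A$-modules (with degree-preserving homomorphisms), let $\mathsf{fdim}\,A$ be its Serre subcategory of finite-dimensional modules, and let $\mathsf{qgr}\,A=\mathsf{gr}\,A/\mathsf{fdim}\,A$ be the quotient category. Let $\mathcal O$ be the image of $A$ in $\mathsf{qgr}\,A$, and let $\mathcal F\mapsto\mathcal F(n)$ be the automorphism of $\mathsf{qgr}\,A$ induced by the degree shift $M\mapsto M(n)$, $M(n)_i=M_{n+i}$. The Grothendieck group $K_0(\mathsf{qgr}\,A)$ is a $\mathbb Z[t^{\pm1}]$-module with $t$ acting as the twist $(-1)$. Then there are isomorphisms of $\mathbb Z[t^{\pm1}]$-modules $$K_0(\mathsf{qgr}\,B)\;\cong\;K_0(\mathsf{qgr}\,kQ)\;\cong\;\frac{\mathbb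 Z[t^{\pm1}]}{(1-t-\cdots-t^{r+1})}$$ under which $[\mathcal O]\mapsto[\mathcal O]\mapsto 1$, and $[\mathcal F(-1)]=t[\mathcal F]$ for all $\mathcal F$ in $\mathsf{qgr}\,B$ and in $\mathsf{qgr}\,kQ$. -/

import Mathlib

open CategoryTheory CategoryTheory.Limits
open scoped LaurentPolynomial DirectSum

universe v u v' u'

noncomputable section

/-! ## The Grothendieck group -/

/-- `X₁ ⟶ X₂ ⟶ X₃` is a short exact sequence: the square with corners `X₁`, `X₂`, a zero object
and `X₃` is both cartesian and cocartesian, i.e. `f` is a kernel of `g` and `g` is a cokernel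
of `f`.  In an abelian category this is the usual notion. -/
def IsShortExactPair {C : Type u} [Category.{v} C] {X₁ X₂ X₃ : C}
    (f : X₁ ⟶ X₂) (g : X₂ ⟶ X₃) : Prop :=
  ∃ (Z : C) (a : X₁ ⟶ Z) (b : Z ⟶ X₃), IsZero Z ∧ IsPullback f a g b ∧ IsPushout f a g b

theorem IsShortExactPair.map {C : Type u} [Category.{v} C] {D : Type u'} [Category.{v'} D]
    (F : C ⥤ D) [F.IsEquivalence] {X₁ X₂ X₃ : C} {f : X₁ ⟶ X₂} {g : X₂ ⟶ X₃}
    (h : IsShortExactPair f g) : IsShortExactPair (F.map f) (F.map g) := by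
  obtain ⟨Z, a, b, hZ, h1, h2⟩ := h
  refine ⟨F.obj Z, F.map a, F.map b, ⟨fun Y => ?_, fun Y => ?_⟩, h1.map F, h2.map F⟩
  · exact ⟨⟨⟨(hZ.isInitial.isInitialObj F).to Y⟩, fun _ => (hZ.isInitial.isInitialObj F).hom_ext _ _⟩⟩
  · exact ⟨⟨⟨(hZ.isTerminal.isTerminalObj F).from Y⟩, fun _ => (hZ.isTerminal.isTerminalObj F).hom_ext _ _⟩⟩

/-- In an abelian category the notion above is the usual one. -/
theorem isShortExactPair_iff {C : Type u} [Category.{v} C] [Abelian C] {X₁ X₂ X₃ : C}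
    (f : X₁ ⟶ X₂) (g : X₂ ⟶ X₃) :
    IsShortExactPair f g ↔ ∃ w : f ≫ g = 0, (ShortComplex.mk f g w).ShortExact := by
  constructor
  · rintro ⟨Z, a, b, hZ, h1, h2⟩
    have w : f ≫ g = 0 := by rw [h1.w, hZ.eq_of_tgt a 0]; simp
    refine ⟨w, ?_⟩
    have hk : IsLimit (KernelFork.ofι f w) := Fork.IsLimit.ofExistsUnique fun s => by
      have hs : s.ι ≫ g = (0 : _ ⟶ Z) ≫ b := by simp
      refine ⟨h1.lift s.ι 0 hs, by simp, ?_⟩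
      intro m hm
      apply h1.hom_ext
      · simpa using hm
      · exact hZ.eq_of_tgt _ _
    have hc : IsColimit (CokernelCofork.ofπ g w) := Cofork.IsColimit.ofExistsUnique fun s => by
      have hs : f ≫ s.π = a ≫ (0 : Z ⟶ _) := by simp
      refine ⟨h2.desc s.π 0 hs, by simp, ?_⟩
      intro m hm
      apply h2.hom_ext
      · simpa using hm
      · exact hZ.eq_of_src _ _
    have : Mono f := ⟨fun u v h => h1.hom_ext h (hZ.eq_of_tgt _ _)⟩
    have : Epi g := ⟨fun u v h => h2.hom_ext h (hZ.eq_of_src _ _)⟩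
    exact { exact := ShortComplex.exact_of_f_is_kernel _ hk }
  · rintro ⟨w, h⟩
    have := h.mono_f
    have := h.epi_g
    refine ⟨_, 0, 0, isZero_zero C, ?_, ?_⟩
    · refine IsPullback.of_isLimit (PullbackCone.IsLimit.mk (by simp [w])
        (fun s => h.fIsKernel.lift (KernelFork.ofι s.fst
          (by simp [s.condition, (isZero_zero C).eq_of_tgt s.snd 0]))) ?_ ?_ ?_)
      · intro s; exact h.fIsKernel.fac _ WalkingParallelPair.zero
      · intro s; exact (isZero_zero C).eq_of_tgt _ _
      · intro s m h1 h2
        refine (cancel_mono f).1 (h1.trans ?_)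
        exact (h.fIsKernel.fac (KernelFork.ofι s.fst
          (by simp [s.condition, (isZero_zero C).eq_of_tgt s.snd 0])) WalkingParallelPair.zero).symm
    · refine IsPushout.of_isColimit (PushoutCocone.IsColimit.mk (by simp [w])
        (fun s => h.gIsCokernel.desc (CokernelCofork.ofπ s.inl
          (by simp [s.condition, (isZero_zero C).eq_of_src s.inr 0]))) ?_ ?_ ?_)
      · intro s; exact h.gIsCokernel.fac _ WalkingParallelPair.one
      · intro s; exact (isZero_zero C).eq_of_src _ _
      · intro s m h1 h2
        refine (cancel_epi g).1 (h1.trans ?_)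
        exact (h.gIsCokernel.fac (CokernelCofork.ofπ s.inl
          (by simp [s.condition, (isZero_zero C).eq_of_src s.inr 0])) WalkingParallelPair.one).symm

/-- The relations defining the Grothendieck group: isomorphic objects have the same class, and
`[X₂] = [X₁] + [X₃]` for every short exact sequence `0 ⟶ X₁ ⟶ X₂ ⟶ X₃ ⟶ 0`. -/
def K0Relations (C : Type u) [Category.{v} C] : AddSubgroup (FreeAbelianGroup C) :=
  AddSubgroup.closure
    ({z | ∃ X Y : C, Nonempty (X ≅ Y) ∧ z = FreeAbelianGroup.of X - FreeAbelianGroup.of Y} ∪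
     {z | ∃ (X₁ X₂ X₃ : C) (f : X₁ ⟶ X₂) (g : X₂ ⟶ X₃), IsShortExactPair f g ∧
      z = FreeAbelianGroup.of X₂ - (FreeAbelianGroup.of X₁ + FreeAbelianGroup.of X₃)})

/-- The Grothendieck group of an (abelian) category. -/
def K0 (C : Type u) [Category.{v} C] : Type u :=
  FreeAbelianGroup C ⧸ K0Relations C

namespace K0

instance (C : Type u) [Category.{v} C] : AddCommGroup (K0 C) :=
  inferInstanceAs (AddCommGroup (FreeAbelianGroup C ⧸ K0Relations C))

/-- The class `[X]` of an object. -/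
def of {C : Type u} [Category.{v} C] (X : C) : K0 C :=
  QuotientAddGroup.mk' (K0Relations C) (FreeAbelianGroup.of X)

theorem of_iso {C : Type u} [Category.{v} C] {X Y : C} (e : X ≅ Y) : of X = of Y := by
  refine (QuotientAddGroup.eq_iff_sub_mem (N := K0Relations C)).mpr ?_
  exact AddSubgroup.subset_closure (Or.inl ⟨X, Y, ⟨e⟩, rfl⟩)

theorem of_shortExact {C : Type u} [Category.{v} C] {X₁ X₂ X₃ : C}
    {f : X₁ ⟶ X₂} {g : X₂ ⟶ X₃} (h : IsShortExactPair f g) : of X₂ = of X₁ + of X₃ := by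
  refine (QuotientAddGroup.eq_iff_sub_mem (N := K0Relations C)).mpr ?_
  exact AddSubgroup.subset_closure (Or.inr ⟨_, _, _, f, g, h, rfl⟩)

theorem hom_ext {C : Type u} [Category.{v} C] {G : Type*} [AddCommGroup G] {a b : K0 C →+ G}
    (h : ∀ X : C, a (of X) = b (of X)) : a = b :=
  QuotientAddGroup.addMonoidHom_ext _ (FreeAbelianGroup.lift_ext _ _ h)

/-- The homomorphism `[X] ↦ [F X]` induced by an equivalence of categories. -/
def map {C : Type u} [Category.{v} C] {D : Type u'} [Category.{v'} D]
    (F : C ⥤ D) [F.IsEquivalence] : K0 C →+ K0 D :=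
  QuotientAddGroup.lift (K0Relations C) (FreeAbelianGroup.lift fun X => of (F.obj X)) (by
    rw [K0Relations, AddSubgroup.closure_le]
    rintro _ (⟨X, Y, ⟨e⟩, rfl⟩ | ⟨X₁, X₂, X₃, f, g, h, rfl⟩)
    · simp [of_iso (F.mapIso e)]
    · simp [of_shortExact (h.map F)])

theorem map_of {C : Type u} [Category.{v} C] {D : Type u'} [Category.{v'} D]
    (F : C ⥤ D) [F.IsEquivalence] (X : C) : map F (of X) = of (F.obj X) := by
  change FreeAbelianGroup.lift _ (FreeAbelianGroup.of X) = _
  simp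

/-- The automorphism of the Grothendieck group induced by an autoequivalence, as a unit of the
endomorphism ring. -/
def autUnit {C : Type u} [Category.{v} C] (F : C ⥤ C) [F.IsEquivalence] :
    (AddMonoid.End (K0 C))ˣ where
  val := map F
  inv := map F.inv
  val_inv := hom_ext fun X => by
    change map F (map F.inv (of X)) = of X
    rw [map_of, map_of]
    exact of_iso (F.asEquivalence.counitIso.app X)
  inv_val := hom_ext fun X => by
    change map F.inv (map F (of X)) = of X
    rw [map_of, map_of]
    exact of_iso (F.asEquivalence.unitIso.symm.app X)

/-- The ring homomorphism `ℤ[t, t⁻¹] → End (K0 C)` under which `t` acts as the autoequivalence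
`F`, i.e. `t • [X] = [F X]`. -/
def laurentHom {C : Type u} [Category.{v} C] (F : C ⥤ C) [F.IsEquivalence] :
    ℤ[T;T⁻¹] →+* AddMonoid.End (K0 C) :=
  (AddMonoidAlgebra.lift ℤ (AddMonoid.End (K0 C)) ℤ
    ((Units.coeHom (AddMonoid.End (K0 C))).comp (zpowersHom _ (autUnit F)))).toRingHom

end K0

/-! ## Graded modules and the quotient category -/

section GradedModules

variable {k A : Type u} [Field k] [Ring A] [Algebra k A]

/-- A `ℤ`-graded left module over a `ℤ`-graded `k`-algebra. -/
structure GrMod (𝒜 : ℤ → Submodule k A) [GradedAlgebra 𝒜] where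
  carrier : Type u
  [addCommGroup : AddCommGroup carrier]
  [module : Module A carrier]
  [vectorSpace : Module k carrier]
  [isScalarTower : IsScalarTower k A carrier]
  /-- the homogeneous components -/
  deg : ℤ → Submodule k carrier
  isInternal : DirectSum.IsInternal deg
  gradedSMul : SetLike.GradedSMul 𝒜 deg

attribute [instance] GrMod.addCommGroup GrMod.module GrMod.vectorSpace GrMod.isScalarTower

variable (𝒜 : ℤ → Submodule k A) [GradedAlgebra 𝒜]

namespace GrMod

variable {𝒜}

/-- Morphisms of graded modules: module homomorphisms that preserve degree. -/
@[ext]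
structure Hom (M N : GrMod 𝒜) where
  toLin : M.carrier →ₗ[A] N.carrier
  map_deg : ∀ (i : ℤ) (m : M.carrier), m ∈ M.deg i → toLin m ∈ N.deg i

/-- The category `Gr A` of graded left modules. -/
instance : Category (GrMod 𝒜) where
  Hom M N := Hom M N
  id M := ⟨LinearMap.id, fun _ _ h => h⟩
  comp f g := ⟨g.toLin ∘ₗ f.toLin, fun i m h => g.map_deg i _ (f.map_deg i m h)⟩

/-- The shifted module `M(n)`, with `M(n)_i = M_{n+i}`. -/
def shiftObj (n : ℤ) (M : GrMod 𝒜) : GrMod 𝒜 where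
  carrier := M.carrier
  deg i := M.deg (n + i)
  isInternal := by
    have h := M.isInternal
    rw [DirectSum.isInternal_submodule_iff_iSupIndep_and_iSup_eq_top] at h ⊢
    refine ⟨h.1.comp (add_right_injective n), ?_⟩
    rw [← h.2]
    exact (Equiv.addLeft n).iSup_comp (g := M.deg)
  gradedSMul := ⟨fun {i j a m} ha hm => by
    have := M.gradedSMul.smul_mem ha hm
    rw [vadd_eq_add] at this ⊢
    rwa [show n + (i + j) = i + (n + j) by ring]⟩

/-- The degree shift functor `M ↦ M(n)`. -/
def shift (n : ℤ) : GrMod 𝒜 ⥤ GrMod 𝒜 where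
  obj := shiftObj n
  map f := ⟨f.toLin, fun i m h => f.map_deg (n + i) m h⟩

/-- `M(m)(n) ≅ M` when `m + n = 0`. -/
def shiftShiftIso (m n : ℤ) (h : m + n = 0) : shift (𝒜 := 𝒜) m ⋙ shift n ≅ 𝟭 (GrMod 𝒜) :=
  NatIso.ofComponents
    (fun M =>
      { hom := ⟨LinearMap.id, fun i x hx => by
          have hx : x ∈ M.deg (m + (n + i)) := hx
          rwa [← add_assoc, h, zero_add] at hx⟩
        inv := ⟨LinearMap.id, fun i x hx => by
          change x ∈ M.deg (m + (n + i))
          rwa [← add_assoc, h, zero_add]⟩ })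

variable (𝒜) in
/-- The algebra as a graded left module over itself. -/
def self : GrMod 𝒜 where
  carrier := A
  deg := 𝒜
  isInternal := DirectSum.Decomposition.isInternal 𝒜
  gradedSMul := ⟨fun {_ _ _ _} ha hb => SetLike.mul_mem_graded ha hb⟩

end GrMod

/-- The property of being a finitely presented module. -/
def isFinitelyPresented : ObjectProperty (GrMod 𝒜) :=
  fun M => Module.FinitePresentation A M.carrier

/-- The category `gr A`: the full subcategory of `Gr A` of finitely presented modules. -/
abbrev FpGrMod := (isFinitelyPresented 𝒜).FullSubcategory

namespace FpGrMod

/-- The degree shift functor on `gr A`. -/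
def shift (n : ℤ) : FpGrMod 𝒜 ⥤ FpGrMod 𝒜 :=
  (isFinitelyPresented 𝒜).lift ((isFinitelyPresented 𝒜).ι ⋙ GrMod.shift n) ObjectProperty.FullSubcategory.property

/-- `M(m)(n) ≅ M` when `m + n = 0`. -/
def shiftShiftIso (m n : ℤ) (h : m + n = 0) : shift 𝒜 m ⋙ shift 𝒜 n ≅ 𝟭 (FpGrMod 𝒜) :=
  NatIso.ofComponents
    (fun M => (isFinitelyPresented 𝒜).isoMk ((GrMod.shiftShiftIso m n h).app M.obj))
    (fun f => by
      ext : 1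
      exact (GrMod.shiftShiftIso (𝒜 := 𝒜) m n h).hom.naturality f.hom)

/-- The algebra as an object of `gr A`. -/
def self : FpGrMod 𝒜 :=
  ⟨GrMod.self 𝒜, inferInstanceAs (Module.FinitePresentation A A)⟩

/-- The morphisms of `gr A` whose kernel and cokernel are finite dimensional over `k`, that is,
lie in the Serre subcategory `fdim A`. -/
def isoModFdim : MorphismProperty (FpGrMod 𝒜) := fun _ N f =>
  FiniteDimensional k (LinearMap.ker (f.hom.toLin.restrictScalars k)) ∧
    FiniteDimensional k (N.obj.carrier ⧸ LinearMap.range (f.hom.toLin.restrictScalars k))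

end FpGrMod

/-- The quotient category `qgr A = gr A / fdim A`: the localization of `gr A` at the morphisms
whose kernel and cokernel are finite dimensional. -/
def Qgr : Type (u + 1) := (FpGrMod.isoModFdim 𝒜).Localization

namespace Qgr

instance : Category (Qgr 𝒜) :=
  inferInstanceAs (Category (FpGrMod.isoModFdim 𝒜).Localization)

/-- The quotient functor `gr A ⥤ qgr A`. -/
def quotientFunctor : FpGrMod 𝒜 ⥤ Qgr 𝒜 := (FpGrMod.isoModFdim 𝒜).Q

instance : (quotientFunctor 𝒜).IsLocalization (FpGrMod.isoModFdim 𝒜) :=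
  inferInstanceAs ((FpGrMod.isoModFdim 𝒜).Q.IsLocalization _)

/-- The structure sheaf `𝒪`: the image of `A` in `qgr A`. -/
def structureSheaf : Qgr 𝒜 := (quotientFunctor 𝒜).obj (FpGrMod.self 𝒜)

/-- The Serre twist `ℱ ↦ ℱ(n)`: the functor induced by the degree shift on `gr A`. -/
def twist (n : ℤ) : Qgr 𝒜 ⥤ Qgr 𝒜 :=
  Localization.Construction.lift (FpGrMod.shift 𝒜 n ⋙ quotientFunctor 𝒜) (fun _ _ f hf =>
    Localization.inverts (quotientFunctor 𝒜) (FpGrMod.isoModFdim 𝒜)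
      ((FpGrMod.shift 𝒜 n).map f) hf)

/-- The twist is compatible with the degree shift. -/
theorem quotientFunctor_comp_twist (n : ℤ) :
    quotientFunctor 𝒜 ⋙ twist 𝒜 n = FpGrMod.shift 𝒜 n ⋙ quotientFunctor 𝒜 :=
  Localization.Construction.fac _ _

/-- `ℱ(m)(n) ≅ ℱ` when `m + n = 0`. -/
def twistTwistIso (m n : ℤ) (h : m + n = 0) : twist 𝒜 m ⋙ twist 𝒜 n ≅ 𝟭 (Qgr 𝒜) :=
  Localization.liftNatIso (quotientFunctor 𝒜) (FpGrMod.isoModFdim 𝒜)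
    (quotientFunctor 𝒜 ⋙ twist 𝒜 m ⋙ twist 𝒜 n) (quotientFunctor 𝒜 ⋙ 𝟭 (Qgr 𝒜)) _ _
    (eqToIso (by
        rw [← Functor.assoc, quotientFunctor_comp_twist, Functor.assoc,
          quotientFunctor_comp_twist, ← Functor.assoc]) ≪≫
      Functor.isoWhiskerRight (FpGrMod.shiftShiftIso 𝒜 m n h) (quotientFunctor 𝒜) ≪≫
      (Functor.leftUnitor _) ≪≫ (Functor.rightUnitor _).symm)

instance (n : ℤ) : (twist 𝒜 n).IsEquivalence :=
  (CategoryTheory.Equivalence.mk (twist 𝒜 n) (twist 𝒜 (-n)) (twistTwistIso 𝒜 n (-n) (by simp)).symm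
    (twistTwistIso 𝒜 (-n) n (by simp))).isEquivalence_functor

/-- The `ℤ[t, t⁻¹]`-module structure on `K₀(qgr A)`, with `t` acting as the twist `(-1)`. -/
instance : Module ℤ[T;T⁻¹] (K0 (Qgr 𝒜)) :=
  Module.compHom (K0 (Qgr 𝒜)) (K0.laurentHom (twist 𝒜 (-1)))

end Qgr

end GradedModules

/-! ## Path algebras -/

/-- The paths of a quiver, with arbitrary source and target. -/
abbrev QuiverPath (V : Type) [Quiver.{0} V] : Type := Σ a b : V, Quiver.Path a b

/-- The path algebra `kQ` of a finite quiver: the vector space with basis the paths, where the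
product `p q` is the path "traverse `p`, then `q`", or `0` if `p` does not end where `q` starts. -/
def PathAlgebra (k : Type u) [Field k] (V : Type) [Quiver.{0} V] : Type u := QuiverPath V →₀ k

namespace PathAlgebra

variable (k : Type u) [Field k] {V : Type} [Quiver.{0} V]

instance : AddCommGroup (PathAlgebra k V) := inferInstanceAs (AddCommGroup (QuiverPath V →₀ k))

instance : Module k (PathAlgebra k V) := inferInstanceAs (Module k (QuiverPath V →₀ k))

/-- The basis element of a path. -/
def path (p : QuiverPath V) : PathAlgebra k V := Finsupp.single p 1

variable {k} in
/-- Linear maps out of the path algebra are given by their values on paths. -/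
def extend {N : Type*} [AddCommGroup N] [Module k N] (φ : QuiverPath V → N) :
    PathAlgebra k V →ₗ[k] N :=
  Finsupp.linearCombination k φ

variable {k} in
@[simp]
theorem extend_path {N : Type*} [AddCommGroup N] [Module k N] (φ : QuiverPath V → N)
    (p : QuiverPath V) : extend φ (path k p) = φ p := by
  refine (Finsupp.linearCombination_single k 1 p).trans (one_smul k (φ p))

variable {k} in
theorem lhom_ext {N : Type*} [AddCommGroup N] [Module k N] {f g : PathAlgebra k V →ₗ[k] N}
    (h : ∀ p, f (path k p) = g (path k p)) : f = g :=
  Finsupp.lhom_ext' fun p => LinearMap.ext_ring (h p)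

variable [DecidableEq V]

/-- The product of two paths in the path algebra. -/
def mulPath (p q : QuiverPath V) : PathAlgebra k V :=
  if h : p.2.1 = q.1 then path k ⟨p.1, q.2.1, p.2.2.comp (q.2.2.cast h.symm rfl)⟩ else 0

/-- The multiplication of the path algebra, as a bilinear map. -/
def mulHom : PathAlgebra k V →ₗ[k] PathAlgebra k V →ₗ[k] PathAlgebra k V :=
  extend fun p => extend fun q => mulPath k p q

instance : Mul (PathAlgebra k V) := ⟨fun a b => mulHom k a b⟩

theorem path_mul_path (p q : QuiverPath V) : path k p * path k q = mulPath k p q := by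
  change mulHom k (path k p) (path k q) = _
  simp [mulHom]

theorem path_mul_path_comp {a b c : V} (p : Quiver.Path a b) (q : Quiver.Path b c) :
    path k ⟨a, b, p⟩ * path k ⟨b, c, q⟩ = path k ⟨a, c, p.comp q⟩ := by
  rw [path_mul_path, mulPath, dif_pos rfl]
  rfl

theorem path_mul_path_of_ne {a b c d : V} (p : Quiver.Path a b) (q : Quiver.Path c d)
    (h : b ≠ c) : path k ⟨a, b, p⟩ * path k ⟨c, d, q⟩ = 0 := by
  rw [path_mul_path, mulPath, dif_neg h]

instance : NonUnitalNonAssocRing (PathAlgebra k V) where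
  left_distrib a b c := (mulHom k a).map_add b c
  right_distrib a b c := by
    change mulHom k (a + b) c = mulHom k a c + mulHom k b c
    rw [map_add, LinearMap.add_apply]
  zero_mul a := by
    change mulHom k 0 a = 0
    rw [map_zero, LinearMap.zero_apply]
  mul_zero a := (mulHom k a).map_zero

theorem assoc_path (p q s : QuiverPath V) :
    path k p * path k q * path k s = path k p * (path k q * path k s) := by
  obtain ⟨a, b, p⟩ := p
  obtain ⟨c, d, q⟩ := q
  obtain ⟨e, f, s⟩ := s
  by_cases h : b = c
  · subst h
    by_cases h' : d = e
    · subst h'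
      simp only [path_mul_path_comp, Quiver.Path.comp_assoc]
    · rw [path_mul_path_comp, path_mul_path_of_ne k _ _ h', path_mul_path_of_ne k _ _ h', mul_zero]
  · rw [path_mul_path_of_ne k _ _ h, zero_mul]
    by_cases h' : d = e
    · subst h'
      rw [path_mul_path_comp, path_mul_path_of_ne k _ _ h]
    · rw [path_mul_path_of_ne k _ _ h', mul_zero]

theorem mul_assoc' (a b c : PathAlgebra k V) : a * b * c = a * (b * c) := by
  have h1 (p q : QuiverPath V) : mulHom k (path k p * path k q) =
      mulHom k (path k p) ∘ₗ mulHom k (path k q) :=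
    lhom_ext fun s => assoc_path k p q s
  have h2 (p : QuiverPath V) (c : PathAlgebra k V) : (mulHom k).flip c ∘ₗ mulHom k (path k p) =
      mulHom k (path k p) ∘ₗ (mulHom k).flip c :=
    lhom_ext fun q => LinearMap.congr_fun (h1 p q) c
  have h3 (b c : PathAlgebra k V) : (mulHom k).flip c ∘ₗ (mulHom k).flip b =
      (mulHom k).flip (b * c) :=
    lhom_ext fun p => LinearMap.congr_fun (h2 p c) b
  exact LinearMap.congr_fun (h3 b c) a

variable [Fintype V]

instance : One (PathAlgebra k V) := ⟨∑ v : V, path k ⟨v, v, Quiver.Path.nil⟩⟩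

theorem one_def : (1 : PathAlgebra k V) = ∑ v : V, path k ⟨v, v, Quiver.Path.nil⟩ := rfl

theorem one_mul_path (p : QuiverPath V) : 1 * path k p = path k p := by
  obtain ⟨a, b, p⟩ := p
  rw [one_def, Finset.sum_mul, Finset.sum_eq_single a]
  · rw [path_mul_path_comp, Quiver.Path.nil_comp]
  · intro v _ hv
    exact path_mul_path_of_ne k _ _ hv
  · simp

theorem path_mul_one (p : QuiverPath V) : path k p * 1 = path k p := by
  obtain ⟨a, b, p⟩ := p
  rw [one_def, Finset.mul_sum, Finset.sum_eq_single b]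
  · rw [path_mul_path_comp, Quiver.Path.comp_nil]
  · intro v _ hv
    exact path_mul_path_of_ne k _ _ hv.symm
  · simp

instance : Ring (PathAlgebra k V) where
  __ := (inferInstance : NonUnitalNonAssocRing (PathAlgebra k V))
  mul_assoc := mul_assoc' k
  one_mul a := by
    have : mulHom k (V := V) 1 = LinearMap.id := lhom_ext fun p => one_mul_path k p
    exact LinearMap.congr_fun this a
  mul_one a := by
    have : (mulHom k (V := V)).flip 1 = LinearMap.id := lhom_ext fun p => path_mul_one k p
    exact LinearMap.congr_fun this a

instance : Algebra k (PathAlgebra k V) :=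
  Algebra.ofModule
    (fun c a b => by
      change mulHom k (c • a) b = c • mulHom k a b
      rw [map_smul, LinearMap.smul_apply])
    (fun c a b => (mulHom k a).map_smul c b)

variable (V) in
/-- The grading of the path algebra by path length. -/
def grading (n : ℤ) : Submodule k (PathAlgebra k V) :=
  Submodule.span k {a | ∃ p : QuiverPath V, (p.2.2.length : ℤ) = n ∧ a = path k p}

theorem path_mem_grading (p : QuiverPath V) : path k p ∈ grading k V (p.2.2.length : ℤ) :=
  Submodule.subset_span ⟨p, rfl, rfl⟩

instance : SetLike.GradedMonoid (grading k V) where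
  one_mem := Submodule.sum_mem _ fun v _ => path_mem_grading k ⟨v, v, Quiver.Path.nil⟩
  mul_mem i j a b ha hb := by
    have h : grading k V i * grading k V j ≤ grading k V (i + j) := by
      rw [grading, grading, Submodule.span_mul_span, Submodule.span_le]
      rintro _ ⟨_, ⟨⟨a, b, p⟩, rfl, rfl⟩, _, ⟨⟨c, d, q⟩, rfl, rfl⟩, rfl⟩
      by_cases h : b = c
      · subst h
        have := path_mem_grading k (⟨a, d, p.comp q⟩ : QuiverPath V)
        simp only [Quiver.Path.length_comp, Nat.cast_add] at this
        simpa only [path_mul_path_comp, SetLike.mem_coe] using this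
      · simp only [path_mul_path_of_ne k _ _ h]
        exact Submodule.zero_mem _
    exact h (Submodule.mul_mem_mul ha hb)

/-- The map sending each path to its component. -/
def decomposeHom : PathAlgebra k V →ₗ[k] ⨁ n, grading k V n :=
  extend fun p => DirectSum.lof k ℤ (fun n => grading k V n) p.2.2.length
    ⟨path k p, path_mem_grading k p⟩

instance : GradedAlgebra (grading k V) where
  toDecomposition := DirectSum.Decomposition.ofLinearMap _ (decomposeHom k)
    (lhom_ext fun p => by simp [decomposeHom])
    (by
      refine DirectSum.linearMap_ext _ fun n => ?_
      ext ⟨a, ha⟩ : 1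
      simp only [LinearMap.comp_apply, DirectSum.coeLinearMap_lof, LinearMap.id_apply]
      induction ha using Submodule.span_induction with
      | mem x h =>
        obtain ⟨p, rfl, rfl⟩ := h
        simp [decomposeHom]
      | zero =>
        rw [map_zero]
        exact (map_zero (DirectSum.lof k ℤ (fun n => grading k V n) n)).symm
      | add x y hx hy ihx ihy =>
        rw [map_add, ihx, ihy]
        exact (map_add (DirectSum.lof k ℤ (fun n => grading k V n) n) ⟨x, hx⟩ ⟨y, hy⟩).symm
      | smul c x hx ih =>
        rw [map_smul, ih]
        exact (map_smul (DirectSum.lof k ℤ (fun n => grading k V n) n) c ⟨x, hx⟩).symm)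

end PathAlgebra

/-! ## The algebra `B = k⟨x, y⟩ / (y ^ (r + 1))` -/

/-- The defining relation `y ^ (r + 1) = 0`, where `x`, `y` are the generators with index `0`
and `1` of the free algebra on two generators. -/
inductive BAlgebraRel (k : Type u) [Field k] (r : ℕ) :
    FreeAlgebra k (Fin 2) → FreeAlgebra k (Fin 2) → Prop
  | y_pow : BAlgebraRel k r (FreeAlgebra.ι k 1 ^ (r + 1)) 0

/-- The algebra `B = k⟨x, y⟩ / (y ^ (r + 1))`. -/
abbrev BAlgebra (k : Type u) [Field k] (r : ℕ) : Type u := RingQuot (BAlgebraRel k r)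

namespace BAlgebra

variable (k : Type u) [Field k] (r : ℕ)

/-- The generators `x = gen 0` and `y = gen 1`. -/
def gen (i : Fin 2) : BAlgebra k r := RingQuot.mkAlgHom k (BAlgebraRel k r) (FreeAlgebra.ι k i)

theorem gen_pow : gen k r 1 ^ (r + 1) = 0 := by
  rw [gen, ← map_pow, RingQuot.mkAlgHom_rel k BAlgebraRel.y_pow, map_zero]

/-- The grading of `B` with `deg x = deg y = 1`: the component of degree `n` is spanned by the
words of length `n` in `x` and `y`. -/
def grading (n : ℤ) : Submodule k (BAlgebra k r) :=
  Submodule.span k {b | ∃ w : List (Fin 2), (w.length : ℤ) = n ∧ b = (w.map (gen k r)).prod}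

theorem gen_mem_grading (i : Fin 2) : gen k r i ∈ grading k r 1 :=
  Submodule.subset_span ⟨[i], by simp, by simp⟩

instance : SetLike.GradedMonoid (grading k r) where
  one_mem := Submodule.subset_span ⟨[], by simp, by simp⟩
  mul_mem i j a b ha hb := by
    have h : grading k r i * grading k r j ≤ grading k r (i + j) := by
      rw [grading, grading, Submodule.span_mul_span, Submodule.span_le]
      rintro _ ⟨_, ⟨w, rfl, rfl⟩, _, ⟨w', rfl, rfl⟩, rfl⟩
      exact Submodule.subset_span ⟨w ++ w', by simp, by simp⟩
    exact h (Submodule.mul_mem_mul ha hb)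

/-- A generator as an element of degree one of the direct sum of the components. -/
def genSum (i : Fin 2) : ⨁ n, grading k r n :=
  DirectSum.of (fun n => grading k r n) 1 ⟨gen k r i, gen_mem_grading k r i⟩

theorem genSum_word (w : List (Fin 2)) (b : grading k r w.length)
    (h : (b : BAlgebra k r) = (w.map (gen k r)).prod) :
    (w.map (genSum k r)).prod = DirectSum.of (fun n => grading k r n) w.length b := by
  induction w with
  | nil =>
    refine DirectSum.of_eq_of_gradedMonoid_eq (A := fun n => grading k r n) ?_
    exact Sigma.subtype_ext rfl h.symm
  | cons i w ih =>
    rw [List.map_cons, List.prod_cons, ih ⟨_, Submodule.subset_span ⟨w, rfl, rfl⟩⟩ rfl, genSum,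
      DirectSum.of_mul_of]
    refine DirectSum.of_eq_of_gradedMonoid_eq (A := fun n => grading k r n) ?_
    refine Sigma.subtype_ext ?_ ?_
    · change (1 : ℤ) + w.length = ((w.length + 1 : ℕ) : ℤ)
      push_cast
      ring
    · change gen k r i * (w.map (gen k r)).prod = b
      rw [h, List.map_cons, List.prod_cons]

theorem genSum_pow : genSum k r 1 ^ (r + 1) = 0 := by
  have h := genSum_word k r (List.replicate (r + 1) 1) 0
    (by rw [List.map_replicate, List.prod_replicate, gen_pow]; rfl)
  rwa [List.map_replicate, List.prod_replicate, map_zero] at h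

/-- The homomorphism sending each generator to its component. -/
def decomposeHom : BAlgebra k r →ₐ[k] ⨁ n, grading k r n :=
  RingQuot.liftAlgHom k ⟨FreeAlgebra.lift k (genSum k r), by
    rintro _ _ ⟨⟩
    simp [genSum_pow]⟩

theorem decomposeHom_gen (i : Fin 2) : decomposeHom k r (gen k r i) = genSum k r i := by
  simp [decomposeHom, gen]

theorem decomposeHom_word (w : List (Fin 2)) (b : grading k r w.length)
    (h : (b : BAlgebra k r) = (w.map (gen k r)).prod) :
    decomposeHom k r b = DirectSum.of (fun n => grading k r n) w.length b := by
  rw [h, map_list_prod, List.map_map, ← genSum_word k r w b h]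
  congr 2
  ext i : 1
  exact decomposeHom_gen k r i

instance : GradedAlgebra (grading k r) :=
  GradedAlgebra.ofAlgHom _ (decomposeHom k r)
    (by
      ext i
      have := decomposeHom_gen k r i
      rw [gen] at this
      simp [this, genSum, gen])
    (by
      rintro n ⟨a, ha⟩
      induction ha using Submodule.span_induction with
      | mem x h =>
        obtain ⟨w, rfl, rfl⟩ := h
        exact decomposeHom_word k r w _ rfl
      | zero =>
        rw [map_zero]
        exact (map_zero (DirectSum.of (fun n => grading k r n) n)).symm
      | add x y hx hy ihx ihy =>
        rw [map_add, ihx, ihy]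
        exact (map_add (DirectSum.of (fun n => grading k r n) n) ⟨x, hx⟩ ⟨y, hy⟩).symm
      | smul c x hx ih =>
        rw [map_smul, ih]
        exact (map_smul (DirectSum.lof k ℤ (fun n => grading k r n) n) c ⟨x, hx⟩).symm)

end BAlgebra

/-! ## The quiver `Q` -/

/-- The vertices of `Q`; the vertex `i : Fin (r + 1)` is the vertex labelled `i + 1`. -/
def QVertex (r : ℕ) : Type := Fin (r + 1)

namespace QVertex

instance (r : ℕ) : Fintype (QVertex r) := inferInstanceAs (Fintype (Fin (r + 1)))

instance (r : ℕ) : DecidableEq (QVertex r) := inferInstanceAs (DecidableEq (Fin (r + 1)))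

/-- The arrows of `Q`: an arrow `x i` from every vertex `i` to the first vertex, and an arrow
`y i` from every vertex `i` but the last one to the next vertex. -/
inductive Arrow (r : ℕ) : Fin (r + 1) → Fin (r + 1) → Type
  | x (i : Fin (r + 1)) : Arrow r i 0
  | y (i : Fin r) : Arrow r i.castSucc i.succ

instance (r : ℕ) : Quiver.{0} (QVertex r) := ⟨Arrow r⟩

end QVertex

end

/-! Splitting every word at its first letter `x` writes each element of either algebra uniquely as
`∑ l, (c l • v l + v l * x * b l)`. For `B` the `v l` are the powers `y ^ j` with `j ≤ r`, and `e =
1`. For `kQ` they are the paths consisting of arrows `y`, `x` is the sum of all the arrows to the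
first vertex, and `b l` lies in `e * A` for the idempotent `e` of that vertex, since every `x`-arrow
ends there. In both cases the `v l` fixed by `e` are one in each degree `0, …, r`. This common
structure, `PrefixSystem`, is all that the computation of `K₀` uses.

Coherence. A finitely presented `M` is, in each large degree, the direct sum of the images of `eM`
under the elements `v l * x`. This regularity holds for `A` and passes to shifts, finite products,
kernels and cokernels, so together with finite dimensional components and a lower degree bound it
characterizes finite presentation (`isTame_iff`). Hence `gr A` is abelian and `qgr A` is its
quotient by a Serre class.

Lower bound. Multiplication by `e` turns regularity into `(eM)_n = ⨁ j, z j • (eM)_{n-j-1}` for `0 ≤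
j ≤ r`, with `z j = v (σ j) * x`. So the Hilbert series of `eM` times `p = 1 - t - ⋯ - t^(r+1)` is a
Laurent polynomial. It is additive in `M`, and a multiple of `p` when `M` is finite dimensional; it
therefore induces a map from `K₀(qgr A)` to `ℤ[t, t⁻¹]/(p)` (`exists_lift`, `exists_k0_hom`).

Upper bound. Truncate `eM` in large degree and choose generators `u s` of degrees `d s` modulo the
images of the `z j`. The map from `⨁ s, A(-d s - 1)` to `M` with generators going to `x • u s` has
finite dimensional kernel and cokernel (`isoModFdim_freeHom`). Thus `[𝒪]` generates `K₀` over `ℤ[t,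
t⁻¹]`. For `M = A` with generators `v (σ j)`, no truncation is needed and `𝒪 ≅ ⨁ j, 𝒪(-j-1)`, that
is, `p • [𝒪] = 0`.

The Euler characteristic of `A` is `1 + t + ⋯ + t^r`, an inverse of `t` modulo `p`. Multiplying the
map of the lower bound by `t` therefore sends `[𝒪]` to `1`, and the two bounds meet
(`exists_k0_equiv`). -/

noncomputable section

/-! ## Graded modules: homogeneous components -/

/-- A family of submodules that spans and admits orthogonal projections is an internal direct
sum decomposition. -/
theorem DirectSum.isInternal_of_projections {k M ι : Type*} [DecidableEq ι] [Ring k]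
    [AddCommGroup M] [Module k M] (d : ι → Submodule k M) (π : ι → M →ₗ[k] M)
    (h1 : ∀ n, ∀ m ∈ d n, π n m = m) (h2 : ∀ n n', n ≠ n' → ∀ m ∈ d n, π n' m = 0)
    (h3 : ⨆ n, d n = ⊤) : DirectSum.IsInternal d := by
  refine DirectSum.isInternal_submodule_of_iSupIndep_of_iSup_eq_top ?_ h3
  rw [iSupIndep_iff_finsetSum_eq_zero_imp_eq_zero]
  intro s v hv h0 i hi
  have := congrArg (π i) h0
  rw [map_sum, map_zero, Finset.sum_eq_single i] at this
  · rwa [h1 i _ (hv i hi)] at this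
  · intro j hj hji
    exact h2 j i hji _ (hv j hj)
  · exact fun h => absurd hi h

namespace GrMod

variable {k A : Type u} [Field k] [Ring A] [Algebra k A]
variable {𝒜 : ℤ → Submodule k A} [GradedAlgebra 𝒜]

theorem bijective_coeLinearMap (M : GrMod 𝒜) :
    Function.Bijective (DirectSum.coeLinearMap M.deg) := M.isInternal

/-- The projection of a graded module onto its component of degree `n`. -/
def component (M : GrMod 𝒜) (n : ℤ) : M.carrier →ₗ[k] M.carrier :=
  (M.deg n).subtype ∘ₗ DirectSum.component k ℤ (fun i => M.deg i) n ∘ₗ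
    (LinearEquiv.ofBijective (DirectSum.coeLinearMap M.deg) M.bijective_coeLinearMap).symm.toLinearMap

variable (M : GrMod 𝒜)

theorem component_mem (n : ℤ) (m : M.carrier) : M.component n m ∈ M.deg n :=
  Subtype.property _

theorem ofBijective_symm_apply {n : ℤ} {m : M.carrier} (h : m ∈ M.deg n) :
    (LinearEquiv.ofBijective (DirectSum.coeLinearMap M.deg) M.bijective_coeLinearMap).symm m =
      DirectSum.lof k ℤ (fun i => M.deg i) n ⟨m, h⟩ := by
  rw [LinearEquiv.symm_apply_eq]
  simp

theorem component_of_mem {n : ℤ} {m : M.carrier} (h : m ∈ M.deg n) : M.component n m = m := by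
  simp only [component, LinearMap.comp_apply, LinearEquiv.coe_coe, M.ofBijective_symm_apply h]
  rw [DirectSum.component.lof_self]
  rfl

theorem component_of_mem_ne {n n' : ℤ} (hn : n ≠ n') {m : M.carrier} (h : m ∈ M.deg n) :
    M.component n' m = 0 := by
  simp only [component, LinearMap.comp_apply, LinearEquiv.coe_coe, M.ofBijective_symm_apply h]
  rw [DirectSum.component.of, dif_neg hn]
  rfl

theorem iSup_deg : ⨆ n, M.deg n = ⊤ := M.isInternal.submodule_iSup_eq_top

theorem induction_on {p : M.carrier → Prop} (m : M.carrier)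
    (mem : ∀ n, ∀ m ∈ M.deg n, p m) (add : ∀ a b, p a → p b → p (a + b)) : p m := by
  have : m ∈ ⨆ n, M.deg n := by rw [iSup_deg]; trivial
  induction this using Submodule.iSup_induction' with
  | mem i x hx => exact mem i x hx
  | zero => exact mem 0 0 (Submodule.zero_mem _)
  | add x y _ _ hx hy => exact add x y hx hy

/-- Asking for the identity on every larger index set lets the supports of two summands be merged in
the additive step. -/
theorem exists_sum_component (m : M.carrier) :
    ∃ s : Finset ℤ, ∀ t : Finset ℤ, s ⊆ t → ∑ n ∈ t, M.component n m = m := by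
  induction m using M.induction_on with
  | mem n m h =>
    refine ⟨{n}, fun t ht => ?_⟩
    rw [Finset.sum_eq_single n, M.component_of_mem h]
    · exact fun j _ hj => M.component_of_mem_ne hj.symm h
    · exact fun h => absurd (ht (by simp)) h
  | add a b ha hb =>
    obtain ⟨s, hs⟩ := ha
    obtain ⟨s', hs'⟩ := hb
    refine ⟨s ∪ s', fun t ht => ?_⟩
    simp only [map_add, Finset.sum_add_distrib]
    rw [hs t (Finset.union_subset_left ht), hs' t (Finset.union_subset_right ht)]

theorem map_component {M N : GrMod 𝒜} (f : M ⟶ N) (n : ℤ) (m : M.carrier) :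
    f.toLin (M.component n m) = N.component n (f.toLin m) := by
  induction m using M.induction_on with
  | mem i m h =>
    by_cases hi : i = n
    · subst hi
      rw [M.component_of_mem h, N.component_of_mem (f.map_deg _ _ h)]
    · rw [M.component_of_mem_ne hi h, N.component_of_mem_ne hi (f.map_deg _ _ h), map_zero]
  | add a b ha hb => simp only [map_add, ha, hb]

theorem smul_mem_deg {i j : ℤ} {a : A} {m : M.carrier} (ha : a ∈ 𝒜 i) (hm : m ∈ M.deg j) :
    a • m ∈ M.deg (i + j) :=
  M.gradedSMul.smul_mem ha hm

theorem component_smul {i : ℤ} {a : A} (ha : a ∈ 𝒜 i) (n : ℤ) (m : M.carrier) :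
    M.component (i + n) (a • m) = a • M.component n m := by
  induction m using M.induction_on with
  | mem j m h =>
    have h' := M.smul_mem_deg ha h
    by_cases hi : j = n
    · subst hi
      rw [M.component_of_mem h, M.component_of_mem h']
    · rw [M.component_of_mem_ne hi h, M.component_of_mem_ne (by simpa using hi) h', smul_zero]
  | add a b ha hb => simp only [map_add, ha, hb, smul_add]

/-! ### Homogeneous submodules and quotients -/

/-- A submodule is homogeneous if it contains the components of its elements. -/
def IsHomog (M : GrMod 𝒜) (p : Submodule A M.carrier) : Prop :=
  ∀ n, ∀ m ∈ p, M.component n m ∈ p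

/-- A homogeneous submodule as a graded module. -/
def sub (p : Submodule A M.carrier) (hp : M.IsHomog p) : GrMod 𝒜 where
  carrier := p
  deg n := (M.deg n).comap (p.subtype.restrictScalars k)
  isInternal := by
    refine DirectSum.isInternal_of_projections _
      (fun n => (M.component n).restrict (p := p.restrictScalars k) (q := p.restrictScalars k)
        (fun m hm => hp n m hm)) ?_ ?_ ?_
    · intro n m hm
      exact Subtype.ext (M.component_of_mem hm)
    · intro n n' hn m hm
      exact Subtype.ext (M.component_of_mem_ne hn hm)
    · rw [eq_top_iff]
      intro m _
      obtain ⟨s, hs⟩ := M.exists_sum_component m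
      have : m = ∑ n ∈ s, (⟨M.component n m, hp n m m.2⟩ : p) := by
        refine Subtype.ext ?_
        rw [AddSubmonoidClass.coe_finsetSum]
        exact (hs s subset_rfl).symm
      rw [this]
      refine Submodule.sum_mem _ fun n _ => Submodule.mem_iSup_of_mem n ?_
      exact M.component_mem n m
  gradedSMul := ⟨fun {_ _ _ _} ha hm => M.smul_mem_deg ha hm⟩

/-- The inclusion of a homogeneous submodule. -/
def subι (p : Submodule A M.carrier) (hp : M.IsHomog p) : M.sub p hp ⟶ M :=
  ⟨p.subtype, fun _ _ h => h⟩

/-- The quotient by a homogeneous submodule as a graded module. -/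
def quot (p : Submodule A M.carrier) (hp : M.IsHomog p) : GrMod 𝒜 where
  carrier := M.carrier ⧸ p
  deg n := (M.deg n).map (p.mkQ.restrictScalars k)
  isInternal := by
    refine DirectSum.isInternal_of_projections _
      (fun n => (p.restrictScalars k).mapQ (p.restrictScalars k) (M.component n)
        (fun m hm => hp n m hm)) ?_ ?_ ?_
    · rintro n _ ⟨m, hm, rfl⟩
      exact congrArg p.mkQ (M.component_of_mem hm)
    · rintro n n' hn _ ⟨m, hm, rfl⟩
      exact (congrArg p.mkQ (M.component_of_mem_ne hn hm)).trans (map_zero _)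
    · rw [← Submodule.map_iSup, iSup_deg, Submodule.map_top, LinearMap.range_eq_top]
      exact p.mkQ_surjective
  gradedSMul := ⟨by
    rintro i j a _ ha ⟨m, hm, rfl⟩
    exact ⟨a • m, M.smul_mem_deg ha hm, map_smul p.mkQ a m⟩⟩

/-- The projection to the quotient by a homogeneous submodule. -/
def quotπ (p : Submodule A M.carrier) (hp : M.IsHomog p) : M ⟶ M.quot p hp :=
  ⟨p.mkQ, fun _ m h => ⟨m, h, rfl⟩⟩

variable {M} {N : GrMod 𝒜}

theorem isHomog_ker (f : M ⟶ N) : M.IsHomog (LinearMap.ker f.toLin) := by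
  intro n m hm
  rw [LinearMap.mem_ker] at hm ⊢
  rw [map_component, hm, map_zero]

theorem isHomog_range (f : M ⟶ N) : N.IsHomog (LinearMap.range f.toLin) := by
  rintro n _ ⟨m, rfl⟩
  exact ⟨M.component n m, map_component f n m⟩

/-- Morphisms commute with the projections to components, so any preimage can be replaced by its
component of degree `n`. -/
theorem exists_preimage_mem_deg (f : M ⟶ N) {n : ℤ} {y : N.carrier} (hy : y ∈ N.deg n)
    (h : y ∈ LinearMap.range f.toLin) : ∃ m ∈ M.deg n, f.toLin m = y := by
  obtain ⟨m, rfl⟩ := h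
  exact ⟨M.component n m, M.component_mem n m, by rw [map_component, N.component_of_mem hy]⟩

/-! ### The abelian category of graded modules -/

@[ext]
theorem hom_ext {f g : M ⟶ N} (h : f.toLin = g.toLin) : f = g := Hom.ext h

@[simp] theorem toLin_comp {P : GrMod 𝒜} (f : M ⟶ N) (g : N ⟶ P) :
    Hom.toLin (f ≫ g) = g.toLin ∘ₗ f.toLin := rfl

instance : Zero (M ⟶ N) := ⟨⟨0, fun _ _ _ => Submodule.zero_mem _⟩⟩

instance : Add (M ⟶ N) :=
  ⟨fun f g => ⟨f.toLin + g.toLin, fun i m h =>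
    Submodule.add_mem _ (f.map_deg i m h) (g.map_deg i m h)⟩⟩

@[simp] theorem toLin_add (f g : M ⟶ N) : Hom.toLin (f + g) = f.toLin + g.toLin := rfl

instance : Neg (M ⟶ N) :=
  ⟨fun f => ⟨-f.toLin, fun i m h => Submodule.neg_mem _ (f.map_deg i m h)⟩⟩

instance : Sub (M ⟶ N) :=
  ⟨fun f g => ⟨f.toLin - g.toLin, fun i m h =>
    Submodule.sub_mem _ (f.map_deg i m h) (g.map_deg i m h)⟩⟩

instance : SMul ℕ (M ⟶ N) :=
  ⟨fun c f => ⟨c • f.toLin, fun i m h => (N.deg i).toAddSubmonoid.nsmul_mem (f.map_deg i m h) c⟩⟩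

instance : SMul ℤ (M ⟶ N) :=
  ⟨fun c f => ⟨c • f.toLin, fun i m h => (N.deg i).toAddSubgroup.zsmul_mem (f.map_deg i m h) c⟩⟩

instance : AddCommGroup (M ⟶ N) :=
  Function.Injective.addCommGroup (fun f : M ⟶ N => f.toLin) (fun _ _ h => hom_ext h) rfl
    (fun _ _ => rfl) (fun _ => rfl) (fun _ _ => rfl) (fun _ _ => rfl) (fun _ _ => rfl)

instance : Preadditive (GrMod 𝒜) where
  add_comp _ _ _ f f' g := hom_ext (by simp [LinearMap.comp_add])
  comp_add _ _ _ f g g' := hom_ext (by simp [LinearMap.add_comp])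

/-- The kernel of a morphism, as a graded module. -/
abbrev ker (f : M ⟶ N) : GrMod 𝒜 := M.sub _ (isHomog_ker f)

/-- The inclusion of the kernel. -/
abbrev kerι (f : M ⟶ N) : ker f ⟶ M := M.subι _ (isHomog_ker f)

/-- The cokernel of a morphism, as a graded module. -/
abbrev coker (f : M ⟶ N) : GrMod 𝒜 := N.quot _ (isHomog_range f)

/-- The projection to the cokernel. -/
abbrev cokerπ (f : M ⟶ N) : N ⟶ coker f := N.quotπ _ (isHomog_range f)

theorem kerι_comp (f : M ⟶ N) : kerι f ≫ f = 0 :=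
  hom_ext (LinearMap.ext fun m => m.2)

theorem comp_cokerπ (f : M ⟶ N) : f ≫ cokerπ f = 0 :=
  hom_ext (LinearMap.ext fun m =>
    (Submodule.Quotient.mk_eq_zero _).2 (LinearMap.mem_range_self f.toLin m))

theorem toLin_apply_eq_zero {P : GrMod 𝒜} {f : M ⟶ N} {g : N ⟶ P} (w : f ≫ g = 0)
    (m : M.carrier) : g.toLin (f.toLin m) = 0 :=
  LinearMap.congr_fun (congrArg Hom.toLin w) m

/-- A morphism killed by `g` factors through any injective morphism onto the kernel of `g`. -/
def liftOfInjective {K P W : GrMod 𝒜} (i : K ⟶ M) (hi : Function.Injective i.toLin)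
    (g : M ⟶ P) (hg : LinearMap.ker g.toLin ≤ LinearMap.range i.toLin)
    (f : W ⟶ M) (w : f ≫ g = 0) : W ⟶ K where
  toLin := (LinearEquiv.ofInjective i.toLin hi).symm.toLinearMap ∘ₗ
    f.toLin.codRestrict _ (fun m => hg (toLin_apply_eq_zero w m))
  map_deg n m hm := by
    obtain ⟨y, hy, hy'⟩ := exists_preimage_mem_deg i (f.map_deg n m hm)
      (hg (toLin_apply_eq_zero w m))
    convert hy
    rw [LinearMap.comp_apply, LinearEquiv.coe_coe, LinearEquiv.symm_apply_eq]
    exact Subtype.ext hy'.symm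

theorem liftOfInjective_comp {K P W : GrMod 𝒜} (i : K ⟶ M) (hi : Function.Injective i.toLin)
    (g : M ⟶ P) (hg : LinearMap.ker g.toLin ≤ LinearMap.range i.toLin)
    (f : W ⟶ M) (w : f ≫ g = 0) : liftOfInjective i hi g hg f w ≫ i = f := by
  refine hom_ext (LinearMap.ext fun m => ?_)
  exact congrArg Subtype.val ((LinearEquiv.ofInjective i.toLin hi).apply_symm_apply
    ⟨f.toLin m, hg (toLin_apply_eq_zero w m)⟩)

/-- An injective morphism onto the kernel of `g` is a kernel of `g`. -/
def isLimitOfInjective {K P : GrMod 𝒜} (i : K ⟶ M) (hi : Function.Injective i.toLin)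
    (g : M ⟶ P) (w : i ≫ g = 0) (hg : LinearMap.ker g.toLin ≤ LinearMap.range i.toLin) :
    IsLimit (KernelFork.ofι i w) :=
  KernelFork.IsLimit.ofι i w (fun f hf => liftOfInjective i hi g hg f hf)
    (fun f hf => liftOfInjective_comp i hi g hg f hf)
    (fun f hf m hm => hom_ext (LinearMap.ext fun a => hi (by
      rw [← LinearMap.comp_apply, ← toLin_comp, hm, ← LinearMap.comp_apply, ← toLin_comp,
        liftOfInjective_comp])))

/-- A morphism killing the image of `f` factors through any surjective morphism whose kernel is
contained in the image of `f`. -/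
def descOfSurjective {Q W : GrMod 𝒜} (q : N ⟶ Q) (hq : Function.Surjective q.toLin)
    (f : M ⟶ N) (hf : LinearMap.ker q.toLin ≤ LinearMap.range f.toLin)
    (g : N ⟶ W) (w : f ≫ g = 0) : Q ⟶ W where
  toLin := (LinearMap.ker q.toLin).liftQ g.toLin (hf.trans (by
      rintro _ ⟨m, rfl⟩
      exact toLin_apply_eq_zero w m)) ∘ₗ
    (q.toLin.quotKerEquivOfSurjective hq).symm.toLinearMap
  map_deg n m hm := by
    obtain ⟨y, hy, rfl⟩ := exists_preimage_mem_deg q hm (hq m)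
    convert g.map_deg n y hy
    rw [LinearMap.comp_apply, LinearEquiv.coe_coe,
      show q.toLin y = q.toLin.quotKerEquivOfSurjective hq (Submodule.Quotient.mk y) from rfl,
      LinearEquiv.symm_apply_apply]
    rfl

theorem comp_descOfSurjective {Q W : GrMod 𝒜} (q : N ⟶ Q) (hq : Function.Surjective q.toLin)
    (f : M ⟶ N) (hf : LinearMap.ker q.toLin ≤ LinearMap.range f.toLin)
    (g : N ⟶ W) (w : f ≫ g = 0) :
    q ≫ descOfSurjective q hq f hf g w = g := by
  refine hom_ext (LinearMap.ext fun y => ?_)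
  rw [toLin_comp, LinearMap.comp_apply, descOfSurjective, LinearMap.comp_apply,
    LinearEquiv.coe_coe,
    show q.toLin y = q.toLin.quotKerEquivOfSurjective hq (Submodule.Quotient.mk y) from rfl,
    LinearEquiv.symm_apply_apply]
  rfl

/-- A surjective morphism whose kernel is the image of `f` is a cokernel of `f`. -/
def isColimitOfSurjective {Q : GrMod 𝒜} (q : N ⟶ Q) (hq : Function.Surjective q.toLin)
    (f : M ⟶ N) (w : f ≫ q = 0) (hf : LinearMap.ker q.toLin ≤ LinearMap.range f.toLin) :
    IsColimit (CokernelCofork.ofπ q w) :=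
  CokernelCofork.IsColimit.ofπ q w (fun g hg => descOfSurjective q hq f hf g hg)
    (fun g hg => comp_descOfSurjective q hq f hf g hg)
    (fun g hg m hm => hom_ext (LinearMap.ext fun a => by
      obtain ⟨a, rfl⟩ := hq a
      rw [← LinearMap.comp_apply, ← toLin_comp, hm, ← LinearMap.comp_apply, ← toLin_comp,
        comp_descOfSurjective]))

theorem kerι_injective (f : M ⟶ N) : Function.Injective (kerι f).toLin :=
  Subtype.val_injective

theorem ker_le_range_kerι (f : M ⟶ N) :
    LinearMap.ker f.toLin ≤ LinearMap.range (kerι f).toLin :=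
  fun m hm => ⟨⟨m, hm⟩, rfl⟩

theorem cokerπ_surjective (f : M ⟶ N) : Function.Surjective (cokerπ f).toLin :=
  Submodule.mkQ_surjective _

theorem ker_cokerπ_le_range (f : M ⟶ N) :
    LinearMap.ker (cokerπ f).toLin ≤ LinearMap.range f.toLin :=
  (Submodule.ker_mkQ _).le

instance : HasKernels (GrMod 𝒜) where
  has_limit f := ⟨⟨_, isLimitOfInjective _ (kerι_injective f) f (kerι_comp f)
    (ker_le_range_kerι f)⟩⟩

instance : HasCokernels (GrMod 𝒜) where
  has_colimit f := ⟨⟨_, isColimitOfSurjective _ (cokerπ_surjective f) f (comp_cokerπ f)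
    (ker_cokerπ_le_range f)⟩⟩

theorem injective_of_mono (f : M ⟶ N) [Mono f] : Function.Injective f.toLin := by
  rw [← LinearMap.ker_eq_bot, eq_bot_iff]
  intro m hm
  have h : kerι f = 0 := by rw [← cancel_mono f, kerι_comp, zero_comp]
  exact LinearMap.congr_fun (congrArg Hom.toLin h) ⟨m, hm⟩

theorem surjective_of_epi (f : M ⟶ N) [Epi f] : Function.Surjective f.toLin := by
  rw [← LinearMap.range_eq_top, eq_top_iff]
  intro m _
  have h : cokerπ f = 0 := by rw [← cancel_epi f, comp_cokerπ, comp_zero]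
  exact ker_cokerπ_le_range f (LinearMap.congr_fun (congrArg Hom.toLin h) m)

theorem mono_of_injective (f : M ⟶ N) (h : Function.Injective f.toLin) : Mono f :=
  ⟨fun _ _ hab => hom_ext (LinearMap.ext fun m =>
    h (LinearMap.congr_fun (congrArg Hom.toLin hab) m))⟩

theorem epi_of_surjective (f : M ⟶ N) (h : Function.Surjective f.toLin) : Epi f :=
  ⟨fun _ _ hab => hom_ext (LinearMap.ext fun m => by
    obtain ⟨m, rfl⟩ := h m
    exact LinearMap.congr_fun (congrArg Hom.toLin hab) m)⟩

instance : IsNormalMonoCategory (GrMod 𝒜) where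
  normalMonoOfMono f _ :=
    ⟨{ Z := coker f
       g := cokerπ f
       w := comp_cokerπ f
       isLimit := isLimitOfInjective f (injective_of_mono f) _ (comp_cokerπ f)
        (ker_cokerπ_le_range f) }⟩

instance : IsNormalEpiCategory (GrMod 𝒜) where
  normalEpiOfEpi f _ :=
    ⟨{ W := ker f
       g := kerι f
       w := kerι_comp f
       isColimit := isColimitOfSurjective f (surjective_of_epi f) _ (kerι_comp f)
        (ker_le_range_kerι f) }⟩

/-! ### Finite products and free modules -/

/-- The product of a finite family of graded modules. -/
def pi {ι : Type} [Finite ι] (M : ι → GrMod 𝒜) : GrMod 𝒜 where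
  carrier := ∀ i, (M i).carrier
  deg n := Submodule.pi Set.univ fun i => (M i).deg n
  isInternal := by
    classical
    refine DirectSum.isInternal_of_projections _
      (fun n => LinearMap.pi fun i => (M i).component n ∘ₗ LinearMap.proj i) ?_ ?_ ?_
    · intro n m hm
      exact funext fun i => (M i).component_of_mem (hm i trivial)
    · intro n n' hn m hm
      exact funext fun i => (M i).component_of_mem_ne hn (hm i trivial)
    · rw [eq_top_iff]
      intro m _
      have := Fintype.ofFinite ι
      rw [← Finset.univ_sum_single m]
      refine Submodule.sum_mem _ fun i _ => ?_
      induction m i using (M i).induction_on with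
      | mem n a ha =>
        refine Submodule.mem_iSup_of_mem n fun j _ => ?_
        by_cases hj : j = i
        · subst hj
          rwa [Pi.single_eq_same]
        · rw [Pi.single_eq_of_ne hj]
          exact Submodule.zero_mem _
      | add a b ha hb =>
        rw [Pi.single_add]
        exact Submodule.add_mem _ ha hb
  gradedSMul := ⟨fun {_ _ _ _} ha hm i hi => (M i).smul_mem_deg ha (hm i hi)⟩

/-- The projections of a product. -/
def piProj {ι : Type} [Finite ι] (M : ι → GrMod 𝒜) (i : ι) : pi M ⟶ M i :=
  ⟨LinearMap.proj i, fun _ _ h => h i trivial⟩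

/-- The universal property of the product. -/
def piLift {ι : Type} [Finite ι] (M : ι → GrMod 𝒜) {W : GrMod 𝒜} (f : ∀ i, W ⟶ M i) :
    W ⟶ pi M :=
  ⟨LinearMap.pi fun i => (f i).toLin, fun n m h i _ => (f i).map_deg n m h⟩

/-- `pi M` is a product in the category of graded modules. -/
def piIsLimit {ι : Type} [Finite ι] (M : ι → GrMod 𝒜) :
    IsLimit (Fan.mk (pi M) (piProj M)) :=
  Fan.IsLimit.mk _ (fun s => piLift M s.proj) (fun _ _ => rfl)
    (fun _ _ hm => hom_ext (LinearMap.ext fun a => funext fun i =>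
      LinearMap.congr_fun (congrArg Hom.toLin (hm i)) a))

instance : HasFiniteProducts (GrMod 𝒜) where
  out _ := { has_limit := fun F =>
    have : HasLimit (Discrete.functor (F.obj ∘ Discrete.mk)) :=
      ⟨⟨_, piIsLimit fun i => F.obj ⟨i⟩⟩⟩
    hasLimit_of_iso (Discrete.natIsoFunctor (F := F)).symm }

instance : Abelian (GrMod 𝒜) where

/-- The free graded module on generators of degrees `d i`. -/
abbrev free (𝒜 : ℤ → Submodule k A) [GradedAlgebra 𝒜] {ι : Type} [Finite ι] (d : ι → ℤ) :
    GrMod 𝒜 :=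
  pi fun i => shiftObj (-d i) (self 𝒜)

/-- The morphism out of a free graded module given by the images of the generators. -/
def freeLift {ι : Type} [Fintype ι] {d : ι → ℤ} (u : ι → M.carrier)
    (hu : ∀ i, u i ∈ M.deg (d i)) : free 𝒜 d ⟶ M where
  toLin := Fintype.linearCombination A u
  map_deg n a ha := by
    refine Submodule.sum_mem _ fun i _ => ?_
    have h : a i ∈ 𝒜 (-d i + n) := ha i trivial
    have := M.smul_mem_deg h (hu i)
    rwa [show -d i + n + d i = n by ring] at this

theorem freeLift_apply {ι : Type} [Fintype ι] {d : ι → ℤ} (u : ι → M.carrier)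
    (hu : ∀ i, u i ∈ M.deg (d i)) (a : ι → A) :
    (freeLift u hu).toLin a = ∑ i, a i • u i :=
  Fintype.linearCombination_apply A u a

theorem exists_free_surjective (M : GrMod 𝒜) [Module.Finite A M.carrier] :
    ∃ (m : ℕ) (d : Fin m → ℤ) (f : free 𝒜 d ⟶ M), Function.Surjective f.toLin := by
  have hs : Submodule.span A {m : M.carrier | ∃ n, m ∈ M.deg n} = ⊤ := by
    rw [eq_top_iff]
    intro m _
    induction m using M.induction_on with
    | mem n m h => exact Submodule.subset_span ⟨n, h⟩
    | add a b ha hb => exact Submodule.add_mem _ (ha trivial) (hb trivial)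
  have hfg : (Submodule.span A {m : M.carrier | ∃ n, m ∈ M.deg n}).FG := by
    rw [hs]
    exact Module.Finite.fg_top
  -- A finitely generated span is already spanned by finitely many of the given elements, so the
  -- generators can be taken homogeneous.
  obtain ⟨t, ht, ht'⟩ := (Submodule.fg_span_iff_fg_span_finset_subset _).1 hfg
  choose d hd using fun i : Fin t.card => ht (t.equivFin.symm i).2
  refine ⟨t.card, d, freeLift (fun i => (t.equivFin.symm i : M.carrier)) hd, ?_⟩
  rw [← LinearMap.range_eq_top]
  refine (Fintype.range_linearCombination A _).trans ?_
  rw [← hs, ht']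
  congr 1
  ext m
  constructor
  · rintro ⟨i, rfl⟩
    exact (t.equivFin.symm i).2
  · exact fun h => ⟨t.equivFin ⟨m, h⟩, by simp⟩

end GrMod

/-! ## Graded algebras with unique prefixes -/

/-- A graded algebra in which every element can be written uniquely as
`∑ l, (c l • v l + v l * x * b l)` with scalars `c l` and with `b l` in the right ideal generated by
an idempotent `e` of degree zero, for a finite family of homogeneous elements `v l`.  Those `v l`
that lie in this right ideal have degrees `0, …, r`, and the others are killed by `e`. -/
structure PrefixSystem {k A : Type u} [Field k] [Ring A] [Algebra k A]
    (𝒜 : ℤ → Submodule k A) [GradedAlgebra 𝒜] (r : ℕ) where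
  e : A
  x : A
  J : Type
  [fintype : Fintype J]
  v : J → A
  δ : J → ℕ
  σ : Fin (r + 1) → J
  e_mem : e ∈ 𝒜 0
  e_mul_e : e * e = e
  x_mem : x ∈ 𝒜 1
  v_mem : ∀ l, v l ∈ 𝒜 (δ l)
  σ_injective : Function.Injective σ
  δ_σ : ∀ j, δ (σ j) = j
  e_mul_v_σ : ∀ j, e * v (σ j) = v (σ j)
  e_mul_v : ∀ l, l ∉ Set.range σ → e * v l = 0
  finite_deg : ∀ n, FiniteDimensional k (𝒜 n)
  deg_neg : ∀ n < 0, 𝒜 n = ⊥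
  exists_decomp : ∀ a : A, ∃ (c : J → k) (b : J → A), (∀ l, e * b l = b l) ∧
    a = ∑ l, (c l • v l + v l * x * b l)
  decomp_unique : ∀ (c : J → k) (b : J → A), (∀ l, e * b l = b l) →
    ∑ l, (c l • v l + v l * x * b l) = 0 → c = 0 ∧ b = 0

attribute [instance] PrefixSystem.fintype

namespace PrefixSystem

variable {k A : Type u} [Field k] [Ring A] [Algebra k A]
variable {𝒜 : ℤ → Submodule k A} [GradedAlgebra 𝒜] {r : ℕ} (S : PrefixSystem 𝒜 r)

/-- The elements `v l * x`. -/
def w (l : S.J) : A := S.v l * S.x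

theorem w_mem (l : S.J) : S.w l ∈ 𝒜 (S.δ l + 1) := SetLike.mul_mem_graded (S.v_mem l) S.x_mem

/-- The elements of degree `n` fixed by `e`. -/
def edeg (M : GrMod 𝒜) (n : ℤ) : Submodule k M.carrier where
  carrier := {m | m ∈ M.deg n ∧ S.e • m = m}
  zero_mem' := ⟨Submodule.zero_mem _, smul_zero _⟩
  add_mem' ha hb := ⟨Submodule.add_mem _ ha.1 hb.1, by rw [smul_add, ha.2, hb.2]⟩
  smul_mem' c m hm := ⟨Submodule.smul_mem _ c hm.1, by
    rw [← algebraMap_smul A c m, ← mul_smul, ← Algebra.commutes, mul_smul, hm.2]⟩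

theorem edeg_le (M : GrMod 𝒜) (n : ℤ) : S.edeg M n ≤ M.deg n := fun _ h => h.1

theorem e_smul_mem {M : GrMod 𝒜} {n : ℤ} {m : M.carrier} (hm : m ∈ M.deg n) :
    S.e • m ∈ S.edeg M n :=
  ⟨by simpa using M.smul_mem_deg S.e_mem hm, by rw [← mul_smul, S.e_mul_e]⟩

theorem map_mem_edeg {M N : GrMod 𝒜} (f : M ⟶ N) {n : ℤ} {m : M.carrier}
    (hm : m ∈ S.edeg M n) : f.toLin m ∈ S.edeg N n :=
  ⟨f.map_deg n m hm.1, by rw [← map_smul, hm.2]⟩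

theorem exists_preimage_mem_edeg {M N : GrMod 𝒜} (f : M ⟶ N) {n : ℤ} {y : N.carrier}
    (hy : y ∈ S.edeg N n) (h : y ∈ LinearMap.range f.toLin) :
    ∃ m ∈ S.edeg M n, f.toLin m = y := by
  obtain ⟨m, hm, rfl⟩ := GrMod.exists_preimage_mem_deg f hy.1 h
  exact ⟨S.e • m, S.e_smul_mem hm, by rw [map_smul, hy.2]⟩

theorem w_smul_mem {M : GrMod 𝒜} (l : S.J) {n : ℤ} {m : M.carrier}
    (hm : m ∈ M.deg (n - (S.δ l + 1))) : S.w l • m ∈ M.deg n := by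
  simpa using M.smul_mem_deg (S.w_mem l) hm

/-- In degree `n` the module is the direct sum of the images under the elements `v l * x`
of the parts fixed by `e`. -/
def IsRegularAt (M : GrMod 𝒜) (n : ℤ) : Prop :=
  (∀ m ∈ M.deg n, ∃ b : S.J → M.carrier, (∀ l, b l ∈ S.edeg M (n - (S.δ l + 1))) ∧
    ∑ l, S.w l • b l = m) ∧
  ∀ b : S.J → M.carrier, (∀ l, b l ∈ S.edeg M (n - (S.δ l + 1))) →
    ∑ l, S.w l • b l = 0 → b = 0

/-- Modules with finite dimensional components, bounded below and regular in large degrees. -/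
structure IsTame (M : GrMod 𝒜) : Prop where
  finite : ∀ n, FiniteDimensional k (M.deg n)
  bounded : ∃ b, ∀ n < b, M.deg n = ⊥
  regular : ∃ n₀, ∀ n ≥ n₀, S.IsRegularAt M n

/-! ### Closure properties -/

/-- Regularity passes to kernels: the coefficients in `M` of an element of `K` map to coefficients
of zero in `N`, hence vanish there by uniqueness and come from `K`. -/
theorem isTame_of_injective {K M N : GrMod 𝒜} (i : K ⟶ M) (g : M ⟶ N)
    (hi : Function.Injective i.toLin) (hig : LinearMap.range i.toLin = LinearMap.ker g.toLin)
    (hM : S.IsTame M) (hN : S.IsTame N) : S.IsTame K where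
  finite n := by
    have := hM.finite n
    exact FiniteDimensional.of_injective
      ((i.toLin.restrictScalars k).restrict (p := K.deg n) (q := M.deg n) (i.map_deg n))
      fun a b h => Subtype.ext (hi (congrArg Subtype.val h))
  bounded := by
    obtain ⟨b, hb⟩ := hM.bounded
    refine ⟨b, fun n hn => (Submodule.eq_bot_iff _).2 fun m hm => hi ?_⟩
    have := i.map_deg n m hm
    rw [hb n hn] at this
    rw [map_zero]
    exact this
  regular := by
    obtain ⟨n₀, h⟩ := hM.regular
    obtain ⟨n₁, h'⟩ := hN.regular
    refine ⟨max n₀ n₁, fun n hn => ⟨fun m hm => ?_, fun b hb h0 => ?_⟩⟩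
    · obtain ⟨b, hb, hbm⟩ := (h n ((le_max_left _ _).trans hn)).1 _ (i.map_deg n m hm)
      have hgb : (fun l => g.toLin (b l)) = 0 := by
        refine (h' n ((le_max_right _ _).trans hn)).2 _ (fun l => S.map_mem_edeg g (hb l)) ?_
        simp only [← map_smul, ← map_sum, hbm]
        rw [← LinearMap.mem_ker, ← hig]
        exact ⟨m, rfl⟩
      have hr : ∀ l, ∃ a ∈ S.edeg K (n - (S.δ l + 1)), i.toLin a = b l := fun l =>
        S.exists_preimage_mem_edeg i (hb l) (by
          rw [hig, LinearMap.mem_ker]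
          exact congrFun hgb l)
      choose a ha hab using hr
      refine ⟨a, ha, hi ?_⟩
      simp only [map_sum, map_smul, hab, hbm]
    · have : (fun l => i.toLin (b l)) = 0 := by
        refine (h n ((le_max_left _ _).trans hn)).2 _ (fun l => S.map_mem_edeg i (hb l)) ?_
        simp only [← map_smul, ← map_sum, h0, map_zero]
      exact funext fun l => hi ((congrFun this l).trans (map_zero i.toLin).symm)

/-- Regularity passes to cokernels. For uniqueness, lift the coefficients of a zero sum to `M`. The
lifted sum comes from `K`, where it can be decomposed, and uniqueness in `M` shows that the lifted
coefficients come from `K` as well. -/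
theorem isTame_of_surjective {K M N : GrMod 𝒜} (g : K ⟶ M) (f : M ⟶ N)
    (hf : Function.Surjective f.toLin) (hgf : LinearMap.range g.toLin = LinearMap.ker f.toLin)
    (hK : S.IsTame K) (hM : S.IsTame M) : S.IsTame N where
  finite n := by
    have := hM.finite n
    exact Module.Finite.of_surjective
      ((f.toLin.restrictScalars k).restrict (p := M.deg n) (q := N.deg n) (f.map_deg n))
      fun y => by
        obtain ⟨m, hm, h⟩ := GrMod.exists_preimage_mem_deg f y.2 (hf y)
        exact ⟨⟨m, hm⟩, Subtype.ext h⟩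
  bounded := by
    obtain ⟨b, hb⟩ := hM.bounded
    refine ⟨b, fun n hn => (Submodule.eq_bot_iff _).2 fun y hy => ?_⟩
    obtain ⟨m, hm, rfl⟩ := GrMod.exists_preimage_mem_deg f hy (hf y)
    rw [hb n hn] at hm
    rw [(Submodule.mem_bot k).1 hm, map_zero]
  regular := by
    obtain ⟨n₀, h⟩ := hK.regular
    obtain ⟨n₁, h'⟩ := hM.regular
    refine ⟨max n₀ n₁, fun n hn => ⟨fun y hy => ?_, fun b hb h0 => ?_⟩⟩
    · obtain ⟨m, hm, rfl⟩ := GrMod.exists_preimage_mem_deg f hy (hf y)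
      obtain ⟨b, hb, rfl⟩ := (h' n ((le_max_right _ _).trans hn)).1 _ hm
      exact ⟨fun l => f.toLin (b l), fun l => S.map_mem_edeg f (hb l), by simp [map_sum]⟩
    · choose m hm hmb using fun l => S.exists_preimage_mem_edeg f (hb l) (hf (b l))
      have hs : ∑ l, S.w l • m l ∈ M.deg n :=
        Submodule.sum_mem _ fun l _ => S.w_smul_mem l (hm l).1
      obtain ⟨a, ha, ham⟩ := GrMod.exists_preimage_mem_deg g hs (by
        rw [hgf, LinearMap.mem_ker, map_sum]
        simpa only [map_smul, hmb] using h0)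
      obtain ⟨c, hc, rfl⟩ := (h n ((le_max_left _ _).trans hn)).1 _ ha
      have h1 := (h' n ((le_max_right _ _).trans hn)).2 (fun l => m l - g.toLin (c l))
        (fun l => Submodule.sub_mem _ (hm l) (S.map_mem_edeg g (hc l))) (by
          simp only [smul_sub, Finset.sum_sub_distrib, ← ham, map_sum, map_smul, sub_self])
      funext l
      rw [← hmb l, sub_eq_zero.1 (congrFun h1 l), Pi.zero_apply, ← LinearMap.mem_ker, ← hgf]
      exact ⟨c l, rfl⟩

theorem isTame_shiftObj {M : GrMod 𝒜} (hM : S.IsTame M) (n : ℤ) :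
    S.IsTame (GrMod.shiftObj n M) where
  finite i := hM.finite (n + i)
  bounded := by
    obtain ⟨b, hb⟩ := hM.bounded
    exact ⟨b - n, fun i hi => hb (n + i) (by linarith)⟩
  regular := by
    obtain ⟨n₀, h⟩ := hM.regular
    refine ⟨n₀ - n, fun i hi => ?_⟩
    have := h (n + i) (by linarith)
    simp only [IsRegularAt, add_sub_assoc] at this
    exact this

theorem isTame_pi {ι : Type} [Finite ι] {M : ι → GrMod 𝒜} (hM : ∀ i, S.IsTame (M i)) :
    S.IsTame (GrMod.pi M) where
  finite n := by
    have := fun i => (hM i).finite n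
    exact FiniteDimensional.of_injective
      (LinearMap.pi fun i => ((LinearMap.proj i).restrict (p := (GrMod.pi M).deg n)
        (q := (M i).deg n) (fun m hm => hm i trivial)) :
        (GrMod.pi M).deg n →ₗ[k] ∀ i, (M i).deg n)
      fun a b h => Subtype.ext (funext fun i => congrArg Subtype.val (congrFun h i))
  bounded := by
    choose b hb using fun i => (hM i).bounded
    obtain ⟨b₀, hb₀⟩ := (Set.finite_range b).bddBelow
    refine ⟨b₀, fun n hn => (Submodule.eq_bot_iff _).2 fun m hm => funext fun i => ?_⟩
    have h1 : m i ∈ (M i).deg n := hm i trivial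
    rw [hb i n (hn.trans_le (hb₀ ⟨i, rfl⟩))] at h1
    exact h1
  regular := by
    choose n₀ h using fun i => (hM i).regular
    obtain ⟨b, hb⟩ := (Set.finite_range n₀).bddAbove
    have h' : ∀ n ≥ b, ∀ i, S.IsRegularAt (M i) n := fun n hn i => h i n ((hb ⟨i, rfl⟩).trans hn)
    refine ⟨b, fun n hn => ⟨fun m hm => ?_, fun b hb h0 => ?_⟩⟩
    · choose b hb hbm using fun i => (h' n hn i).1 (m i) (hm i trivial)
      refine ⟨fun l i => b i l, fun l => ⟨fun i _ => (hb i l).1, funext fun i => (hb i l).2⟩, ?_⟩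
      funext i
      rw [← hbm i]
      exact Finset.sum_apply i _ _
    · funext l i
      refine congrFun ((h' n hn i).2 (fun l => b l i)
        (fun l => ⟨(hb l).1 i trivial, congrFun (hb l).2 i⟩) ?_) l
      exact (Finset.sum_apply i _ _).symm.trans (congrFun h0 i)

/-- The homogeneous form of the decomposition of elements. -/
theorem exists_decomp_deg {n : ℤ} {a : A} (ha : a ∈ 𝒜 n) :
    ∃ (c : S.J → k) (b : S.J → A), (∀ l, (S.δ l : ℤ) ≠ n → c l = 0) ∧
      (∀ l, b l ∈ S.edeg (GrMod.self 𝒜) (n - (S.δ l + 1))) ∧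
      a = ∑ l, (c l • S.v l + S.w l * b l) := by
  classical
  obtain ⟨c, b, hb, rfl⟩ := S.exists_decomp a
  -- Only the parts of `c` and `b` that contribute to degree `n` are kept.
  refine ⟨fun l => if (S.δ l : ℤ) = n then c l else 0,
    fun l => (GrMod.self 𝒜).component (n - (S.δ l + 1)) (b l), fun l hl => if_neg hl,
    fun l => ⟨(GrMod.self 𝒜).component_mem _ _, ?_⟩, ?_⟩
  · refine ((GrMod.self 𝒜).component_smul S.e_mem _ _).symm.trans ?_
    rw [zero_add]
    exact congrArg _ (hb l)
  · refine ((GrMod.self 𝒜).component_of_mem ha).symm.trans ?_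
    refine (map_sum _ _ _).trans (Finset.sum_congr rfl fun l _ => ?_)
    refine (map_add _ _ _).trans (congrArg₂ _ ?_ ?_)
    · refine ((GrMod.self 𝒜).component n).map_smul (c l) (S.v l) |>.trans ?_
      beta_reduce
      split_ifs with h
      · subst h
        exact congrArg _ ((GrMod.self 𝒜).component_of_mem (S.v_mem l))
      · rw [zero_smul]
        exact (congrArg _ ((GrMod.self 𝒜).component_of_mem_ne h (S.v_mem l))).trans
          (smul_zero _)
    · have := (GrMod.self 𝒜).component_smul (S.w_mem l) (n - (S.δ l + 1)) (b l)
      rw [add_sub_cancel] at this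
      exact this

/-- Above the largest degree of a `v l` the scalar terms disappear, and the decomposition in `A` is
exactly regularity. -/
theorem isTame_self : S.IsTame (GrMod.self 𝒜) where
  finite := S.finite_deg
  bounded := ⟨0, S.deg_neg⟩
  regular := by
    obtain ⟨d, hd⟩ := (Set.finite_range S.δ).bddAbove
    refine ⟨d + 1, fun n hn => ⟨fun a ha => ?_, fun b hb h0 => ?_⟩⟩
    · obtain ⟨c, b, hc, hb, rfl⟩ := S.exists_decomp_deg ha
      refine ⟨b, hb, Finset.sum_congr rfl fun l _ => ?_⟩
      have h1 : S.δ l ≤ d := hd ⟨l, rfl⟩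
      rw [hc l (by lia), zero_smul, zero_add]
      rfl
    · refine (S.decomp_unique 0 b (fun l => (hb l).2) ?_).2
      refine Eq.trans (Finset.sum_congr rfl fun l _ => ?_) h0
      rw [Pi.zero_apply, zero_smul, zero_add]
      rfl

theorem isTame_free {ι : Type} [Finite ι] (d : ι → ℤ) : S.IsTame (GrMod.free 𝒜 d) :=
  S.isTame_pi fun _ => S.isTame_shiftObj S.isTame_self _

/-! ### Tame modules are the finitely presented ones -/

/-- The components between the lower bound `b` and the degree `n₀` where regularity starts generate
everything: regularity expresses an element of degree at least `n₀` by elements of smaller degree.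
-/
theorem IsTame.module_finite {S : PrefixSystem 𝒜 r} {M : GrMod 𝒜} (hM : S.IsTame M) :
    Module.Finite A M.carrier := by
  obtain ⟨b, hb⟩ := hM.bounded
  obtain ⟨n₀, hn₀⟩ := hM.regular
  have hfg : (⨆ i ∈ Finset.Ico b n₀, Submodule.span A (M.deg i : Set M.carrier)).FG := by
    refine Submodule.fg_biSup _ _ fun i _ => ?_
    have := hM.finite i
    obtain ⟨s, hs⟩ := (Submodule.fg_top _).1 (Module.Finite.fg_top (R := k) (M := M.deg i))
    refine ⟨s, ?_⟩
    rw [← hs]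
    refine le_antisymm (Submodule.span_mono Submodule.subset_span)
      (Submodule.span_le.2 fun m hm => Submodule.span_le_restrictScalars k A _ hm)
  set T := ⨆ i ∈ Finset.Ico b n₀, Submodule.span A (M.deg i : Set M.carrier)
  have key : ∀ K : ℕ, ∀ n < b + K, ∀ m ∈ M.deg n, m ∈ T := by
    intro K
    induction K with
    | zero =>
      intro n hn m hm
      rw [hb n (by simpa using hn)] at hm
      rw [(Submodule.mem_bot k).1 hm]
      exact T.zero_mem
    | succ K ih =>
      intro n hn m hm
      by_cases h1 : n < b
      · rw [hb n h1] at hm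
        rw [(Submodule.mem_bot k).1 hm]
        exact T.zero_mem
      by_cases h2 : n < n₀
      · exact Submodule.mem_iSup_of_mem n (Submodule.mem_iSup_of_mem
          (Finset.mem_Ico.2 ⟨not_lt.1 h1, h2⟩) (Submodule.subset_span hm))
      · obtain ⟨a, ha, rfl⟩ := (hn₀ n (not_lt.1 h2)).1 m hm
        refine T.sum_mem fun l _ => T.smul_mem _ (ih _ ?_ _ (ha l).1)
        push_cast at hn
        lia
  refine ⟨?_⟩
  have : T = ⊤ := by
    rw [eq_top_iff]
    intro m _
    induction m using M.induction_on with
    | mem n m h => exact key (n - b + 1).toNat n (by lia) m h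
    | add a b ha hb => exact T.add_mem (ha trivial) (hb trivial)
  rwa [← this]

/-- A tame module has a finite free cover; its kernel is again tame, hence finitely generated.
Conversely, a finitely presented module is the cokernel of a map of finite free modules, which are
tame. -/
theorem isTame_iff (M : GrMod 𝒜) : S.IsTame M ↔ Module.FinitePresentation A M.carrier := by
  constructor
  · intro hM
    have := hM.module_finite
    obtain ⟨m, d, f, hf⟩ := M.exists_free_surjective
    have hK : S.IsTame (GrMod.ker f) := S.isTame_of_injective (GrMod.kerι f) f
      (GrMod.kerι_injective f) (Submodule.range_subtype _) (S.isTame_free d) hM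
    have hK' : Module.Finite A (LinearMap.ker f.toLin) := hK.module_finite
    have : Module.FinitePresentation A (GrMod.free 𝒜 d).carrier :=
      inferInstanceAs (Module.FinitePresentation A (Fin m → A))
    exact Module.finitePresentation_of_surjective f.toLin hf (Module.Finite.iff_fg.1 hK')
  · intro hM
    obtain ⟨m, d, f, hf⟩ := M.exists_free_surjective
    have : Module.Finite A (GrMod.free 𝒜 d).carrier :=
      inferInstanceAs (Module.Finite A (Fin m → A))
    have hK : Module.Finite A (LinearMap.ker f.toLin) :=
      Module.Finite.iff_fg.2 (Module.FinitePresentation.fg_ker f.toLin hf)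
    have : Module.Finite A (GrMod.ker f).carrier := hK
    obtain ⟨m', d', g, hg⟩ := (GrMod.ker f).exists_free_surjective
    refine S.isTame_of_surjective (g ≫ GrMod.kerι f) f hf ?_ (S.isTame_free d') (S.isTame_free d)
    rw [GrMod.toLin_comp, LinearMap.range_comp_of_range_eq_top _ (LinearMap.range_eq_top.2 hg)]
    exact Submodule.range_subtype _

end PrefixSystem

/-! ## The Grothendieck group of a quotient by a Serre class -/

section SerreClass

variable {C : Type u} [Category.{v} C] [Abelian C] {G : Type*} [AddCommGroup G] {χ : C → G}

/-- A function on the objects is additive if it is so on short exact sequences. -/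
def IsAdditiveFunction (χ : C → G) : Prop :=
  ∀ S : ShortComplex C, S.ShortExact → χ S.X₂ = χ S.X₁ + χ S.X₃

namespace IsAdditiveFunction

theorem eq_add_cokernel (h : IsAdditiveFunction χ) {X Y : C} (f : X ⟶ Y) [Mono f] :
    χ Y = χ X + χ (cokernel f) :=
  h (ShortComplex.mk f (cokernel.π f) (cokernel.condition f))
    { exact := ShortComplex.exact_cokernel f }

theorem eq_kernel_add (h : IsAdditiveFunction χ) {X Y : C} (f : X ⟶ Y) [Epi f] :
    χ X = χ (kernel f) + χ Y :=
  h (ShortComplex.mk (kernel.ι f) f (kernel.condition f))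
    { exact := ShortComplex.exact_kernel f }

theorem isZero (h : IsAdditiveFunction χ) {X : C} (hX : IsZero X) : χ X = 0 := by
  have := h (ShortComplex.mk (𝟙 X) (0 : X ⟶ X) (hX.eq_of_tgt _ _))
    { exact := ShortComplex.exact_of_isZero_X₂ _ hX
      epi_g := ⟨fun _ _ _ => hX.eq_of_src _ _⟩ }
  simpa using this

theorem iso (h : IsAdditiveFunction χ) {X Y : C} (e : X ≅ Y) : χ X = χ Y := by
  rw [h.eq_add_cokernel e.hom, h.isZero (isZero_cokernel_of_epi e.hom), add_zero]

/-- Factoring through the image, `χ` changes only by its values at the kernel and the cokernel,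
which are zero. -/
theorem isoModSerre (h : IsAdditiveFunction χ) (P : ObjectProperty C) [P.IsSerreClass]
    (h0 : ∀ X, P X → χ X = 0) {X Y : C} (f : X ⟶ Y) (hf : P.isoModSerre f) : χ X = χ Y := by
  have h1 := h.eq_add_cokernel (kernel.ι f)
  have h2 := h.eq_kernel_add (cokernel.π f)
  rw [h0 _ hf.1, zero_add] at h1
  rw [h0 _ hf.2, add_zero] at h2
  rw [h1, h2]
  exact h.iso (Abelian.coimageIsoImage f)

variable {D : Type u'} [Category.{v'} D] [Abelian D] (L : C ⥤ D) [L.Additive]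

/-- An isomorphism in the quotient is a fraction with denominator `φ.s`; its numerator also becomes
invertible, so both are isomorphisms modulo the Serre class and preserve `χ`. -/
theorem iso_obj (h : IsAdditiveFunction χ) (P : ObjectProperty C) [P.IsSerreClass]
    [L.IsLocalization P.isoModSerre] (h0 : ∀ X, P X → χ X = 0) {X Y : C}
    (e : L.obj X ≅ L.obj Y) : χ X = χ Y := by
  obtain ⟨φ, hφ⟩ := Localization.exists_leftFraction L P.isoModSerre e.hom
  have hs := φ.hs
  have h1 : e.hom ≫ L.map φ.s = L.map φ.f := by
    rw [hφ, MorphismProperty.LeftFraction.map_comp_map_s]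
  have := Localization.inverts L P.isoModSerre φ.s hs
  have hf : P.isoModSerre φ.f := by
    rw [← ObjectProperty.SerreClassLocalization.isIso_map_iff L P, ← h1]
    infer_instance
  rw [h.isoModSerre P h0 φ.f hf, h.isoModSerre P h0 φ.s hs]

/-- An additive function that vanishes on a Serre class factors through the Grothendieck group
of the quotient category. -/
theorem exists_lift (h : IsAdditiveFunction χ) (P : ObjectProperty C) [P.IsSerreClass]
    [L.IsLocalization P.isoModSerre] (h0 : ∀ X, P X → χ X = 0) :
    ∃ φ : K0 D →+ G, ∀ X, φ (K0.of (L.obj X)) = χ X := by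
  have := Localization.essSurj L P.isoModSerre
  -- The value at an object of the quotient does not depend on the chosen preimage.
  have key : ∀ {X : C} {Y : D}, (L.obj X ≅ Y) → χ (L.objPreimage Y) = χ X := fun {X Y} e =>
    h.iso_obj L P h0 (L.objObjPreimageIso Y ≪≫ e.symm)
  refine ⟨QuotientAddGroup.lift (K0Relations D)
    (FreeAbelianGroup.lift fun Y => χ (L.objPreimage Y)) ?_, fun X => ?_⟩
  · rw [K0Relations, AddSubgroup.closure_le]
    rintro _ (⟨X, Y, ⟨e⟩, rfl⟩ | ⟨X₁, X₂, X₃, f, g, hfg, rfl⟩)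
    · simp [key (L.objObjPreimageIso Y ≪≫ e.symm)]
    · obtain ⟨w, hS⟩ := (isShortExactPair_iff f g).1 hfg
      have := hS.mono_f
      -- A monomorphism of the quotient is, up to isomorphism of arrows, the image of a monomorphism
      -- of `C`. Since `L` preserves its cokernel, the whole short exact sequence lifts to `C` up to
      -- isomorphism.
      obtain ⟨X', Y', f', _, ⟨e⟩⟩ :=
        (ObjectProperty.SerreClassLocalization.mono_iff L P f).1 hS.mono_f
      have := ObjectProperty.SerreClassLocalization.preservesCokernel L P f'
      have e₁ : L.obj X' ≅ X₁ := Arrow.leftFunc.mapIso e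
      have e₂ : L.obj Y' ≅ X₂ := Arrow.rightFunc.mapIso e
      have e₃ : L.obj (cokernel f') ≅ X₃ :=
        PreservesCokernel.iso L f' ≪≫
          cokernel.mapIso (L.map f') f (Arrow.leftFunc.mapIso e) (Arrow.rightFunc.mapIso e)
            e.hom.w.symm ≪≫
          (cokernelIsCokernel f).coconePointUniqueUpToIso hS.gIsCokernel
      simp [key e₁, key e₂, key e₃, h.eq_add_cokernel f']
  · change FreeAbelianGroup.lift _ (FreeAbelianGroup.of (L.obj X)) = _
    simp [key (Iso.refl (L.obj X))]

end IsAdditiveFunction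

end SerreClass

/-! ## Finitely presented graded modules and the quotient category -/

section

variable {k A : Type u} [Field k] [Ring A] [Algebra k A]
variable (𝒜 : ℤ → Submodule k A) [GradedAlgebra 𝒜]

theorem GrMod.linearEquivOfIso_nonempty {𝒜 : ℤ → Submodule k A} [GradedAlgebra 𝒜]
    {M N : GrMod 𝒜} (e : M ≅ N) : Nonempty (M.carrier ≃ₗ[A] N.carrier) :=
  ⟨LinearEquiv.ofLinearMap e.hom.toLin e.inv.toLin (congrArg GrMod.Hom.toLin e.inv_hom_id)
    (congrArg GrMod.Hom.toLin e.hom_inv_id)⟩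

instance : (isFinitelyPresented 𝒜).IsClosedUnderIsomorphisms where
  of_iso e h := by
    obtain ⟨e'⟩ := GrMod.linearEquivOfIso_nonempty e
    exact e'.finitePresentation_iff.1 h

theorem isFinitelyPresented_coker {M N : GrMod 𝒜} (f : M ⟶ N) (hM : isFinitelyPresented 𝒜 M)
    (hN : isFinitelyPresented 𝒜 N) : isFinitelyPresented 𝒜 (GrMod.coker f) := by
  have : Module.FinitePresentation A M.carrier := hM
  have : Module.FinitePresentation A N.carrier := hN
  refine Module.finitePresentation_of_surjective (GrMod.cokerπ f).toLin
    (GrMod.cokerπ_surjective f) ?_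
  have h : LinearMap.ker (GrMod.cokerπ f).toLin = LinearMap.range f.toLin := Submodule.ker_mkQ _
  rw [h, LinearMap.range_eq_map]
  exact Module.Finite.fg_top.map _

instance : (isFinitelyPresented 𝒜).IsClosedUnderCokernels where
  cokernels_le := by
    rintro _ ⟨f, c, hc, hM, hN⟩
    exact (isFinitelyPresented 𝒜).prop_of_iso
      ((GrMod.isColimitOfSurjective _ (GrMod.cokerπ_surjective f) f (GrMod.comp_cokerπ f)
        (GrMod.ker_cokerπ_le_range f)).coconePointUniqueUpToIso hc)
      (isFinitelyPresented_coker 𝒜 f hM hN)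

instance : (isFinitelyPresented 𝒜).IsClosedUnderFiniteProducts where
  isClosedUnderLimitsOfShape ι _ :=
    { limitsOfShape_le := by
        rintro M ⟨h⟩
        refine (isFinitelyPresented 𝒜).prop_of_iso
          ((GrMod.piIsLimit fun i => h.diag.obj ⟨i⟩).conePointUniqueUpToIso
            ((IsLimit.postcomposeHomEquiv Discrete.natIsoFunctor _).symm h.isLimit)) ?_
        have : ∀ i : ι, Module.FinitePresentation A (h.diag.obj ⟨i⟩).carrier :=
          fun i => h.prop_diag_obj ⟨i⟩
        exact inferInstanceAs
          (Module.FinitePresentation A (∀ i : ι, (h.diag.obj ⟨i⟩).carrier)) }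

instance : (isFinitelyPresented 𝒜).ContainsZero where
  exists_zero := ⟨GrMod.pi (fun i : PEmpty.{1} => i.elim),
    (IsZero.iff_id_eq_zero _).2 (GrMod.hom_ext (LinearMap.ext fun _ => funext fun i => i.elim)),
    (inferInstance : Module.FinitePresentation A (∀ i : PEmpty.{1}, (i.elim : GrMod 𝒜).carrier))⟩

/-- This is graded coherence of `A`, and it is what makes `gr A` an abelian category. -/
theorem PrefixSystem.isClosedUnderKernels {𝒜 : ℤ → Submodule k A} [GradedAlgebra 𝒜] {r : ℕ}
    (S : PrefixSystem 𝒜 r) : (isFinitelyPresented 𝒜).IsClosedUnderKernels where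
  kernels_le := by
    rintro _ ⟨f, c, hc, hM, hN⟩
    refine (isFinitelyPresented 𝒜).prop_of_iso
      ((GrMod.isLimitOfInjective _ (GrMod.kerι_injective f) f (GrMod.kerι_comp f)
        (GrMod.ker_le_range_kerι f)).conePointUniqueUpToIso hc) ?_
    exact (S.isTame_iff _).1 (S.isTame_of_injective (GrMod.kerι f) f (GrMod.kerι_injective f)
      (Submodule.range_subtype _) ((S.isTame_iff _).2 hM) ((S.isTame_iff _).2 hN))

/-- The finite dimensional modules in `gr A`. -/
def fdim : ObjectProperty (FpGrMod 𝒜) := fun M => FiniteDimensional k M.obj.carrier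

namespace FpGrMod

variable {𝒜} {M N : FpGrMod 𝒜}

theorem surjective_of_epi (f : M ⟶ N) [Epi f] : Function.Surjective f.hom.toLin := by
  have := (isFinitelyPresented 𝒜).preservesEpimorphisms_ι_of_isNormalMonoCategory
  have : Epi f.hom := inferInstanceAs (Epi ((isFinitelyPresented 𝒜).ι.map f))
  exact GrMod.surjective_of_epi f.hom

/-- The cokernel of a morphism in `gr A`. -/
def coker (f : M ⟶ N) : FpGrMod 𝒜 :=
  ⟨GrMod.coker f.hom, isFinitelyPresented_coker 𝒜 f.hom M.property N.property⟩

/-- The projection to the cokernel. -/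
def cokerπ (f : M ⟶ N) : N ⟶ coker f := ObjectProperty.homMk (GrMod.cokerπ f.hom)

theorem comp_cokerπ (f : M ⟶ N) : f ≫ cokerπ f = 0 :=
  ObjectProperty.hom_ext _ (GrMod.comp_cokerπ f.hom)

end FpGrMod

namespace Qgr

variable {𝒜}

/-- The class in the Grothendieck group of `qgr A` of an object of `gr A`. -/
def cls (M : FpGrMod 𝒜) : K0 (Qgr 𝒜) := K0.of ((quotientFunctor 𝒜).obj M)

theorem cls_eq_of_isoModFdim {M N : FpGrMod 𝒜} (f : M ⟶ N) (hf : FpGrMod.isoModFdim 𝒜 f) :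
    cls M = cls N := by
  have := Localization.inverts (quotientFunctor 𝒜) _ f hf
  exact K0.of_iso (asIso ((quotientFunctor 𝒜).map f))

/-- The quotient functor is essentially surjective, so statements closed under addition and negation
need only be checked on classes of modules. -/
theorem cls_surjOn (s : AddSubgroup (K0 (Qgr 𝒜))) (h : ∀ M : FpGrMod 𝒜, cls M ∈ s)
    (z : K0 (Qgr 𝒜)) : z ∈ s := by
  have := Localization.essSurj (quotientFunctor 𝒜) (FpGrMod.isoModFdim 𝒜)
  obtain ⟨z, rfl⟩ := QuotientAddGroup.mk'_surjective _ z
  induction z using FreeAbelianGroup.induction_on with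
  | zero => rw [map_zero]; exact s.zero_mem
  | of X =>
    have := h ((quotientFunctor 𝒜).objPreimage X)
    rw [cls, K0.of_iso ((quotientFunctor 𝒜).objObjPreimageIso X)] at this
    exact this
  | neg X hX => rw [map_neg]; exact s.neg_mem hX
  | add a b ha hb => rw [map_add]; exact s.add_mem ha hb

end Qgr

variable [(isFinitelyPresented 𝒜).IsClosedUnderKernels]

namespace FpGrMod

variable {𝒜} {M N K : FpGrMod 𝒜}

/-- The kernel of a morphism in `gr A`. -/
def ker (f : M ⟶ N) : FpGrMod 𝒜 :=
  ⟨GrMod.ker f.hom, (isFinitelyPresented 𝒜).prop_of_isLimit_kernelFork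
    (GrMod.isLimitOfInjective _ (GrMod.kerι_injective f.hom) f.hom (GrMod.kerι_comp f.hom)
      (GrMod.ker_le_range_kerι f.hom)) M.property N.property⟩

/-- The inclusion of the kernel. -/
def kerι (f : M ⟶ N) : ker f ⟶ M := ObjectProperty.homMk (GrMod.kerι f.hom)

/-- An injective morphism onto the kernel of `g` is a kernel of `g`. -/
def isLimitOfInjective (i : K ⟶ M) (hi : Function.Injective i.hom.toLin)
    (g : M ⟶ N) (w : i ≫ g = 0)
    (hg : LinearMap.ker g.hom.toLin ≤ LinearMap.range i.hom.toLin) :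
    IsLimit (KernelFork.ofι i w) :=
  isLimitOfReflects (isFinitelyPresented 𝒜).ι ((KernelFork.isLimitMapConeEquiv _ _).symm
    (GrMod.isLimitOfInjective i.hom hi g.hom
      (congrArg (fun h => InducedCategory.Hom.hom h) w) hg :))

/-- A surjective morphism whose kernel is the image of `f` is a cokernel of `f`. -/
def isColimitOfSurjective (q : N ⟶ K) (hq : Function.Surjective q.hom.toLin)
    (f : M ⟶ N) (w : f ≫ q = 0)
    (hf : LinearMap.ker q.hom.toLin ≤ LinearMap.range f.hom.toLin) :
    IsColimit (CokernelCofork.ofπ q w) :=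
  isColimitOfReflects (isFinitelyPresented 𝒜).ι ((CokernelCofork.isColimitMapCoconeEquiv _ _).symm
    (GrMod.isColimitOfSurjective q.hom hq f.hom
      (congrArg (fun h => InducedCategory.Hom.hom h) w) hf :))

theorem kerι_comp (f : M ⟶ N) : kerι f ≫ f = 0 :=
  ObjectProperty.hom_ext _ (GrMod.kerι_comp f.hom)

/-- The abstract kernel is the concrete one. -/
def kernelIso (f : M ⟶ N) : kernel f ≅ ker f :=
  (kernelIsKernel f).conePointUniqueUpToIso
    (isLimitOfInjective (kerι f) (GrMod.kerι_injective f.hom) f (kerι_comp f)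
      (GrMod.ker_le_range_kerι f.hom))

/-- The abstract cokernel is the concrete one. -/
def cokernelIso (f : M ⟶ N) : cokernel f ≅ coker f :=
  (cokernelIsCokernel f).coconePointUniqueUpToIso
    (isColimitOfSurjective (cokerπ f) (GrMod.cokerπ_surjective f.hom) f (comp_cokerπ f)
      (GrMod.ker_cokerπ_le_range f.hom))

theorem injective_of_mono (f : M ⟶ N) [Mono f] : Function.Injective f.hom.toLin := by
  have := (isFinitelyPresented 𝒜).preservesMonomorphisms_ι_of_isNormalEpiCategory
  have : Mono f.hom := inferInstanceAs (Mono ((isFinitelyPresented 𝒜).ι.map f))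
  exact GrMod.injective_of_mono f.hom

/-- Short exactness in `gr A` is short exactness of the underlying linear maps. -/
theorem shortExact_iff (S : ShortComplex (FpGrMod 𝒜)) :
    S.ShortExact ↔ Function.Injective S.f.hom.toLin ∧ Function.Surjective S.g.hom.toLin ∧
      LinearMap.range S.f.hom.toLin = LinearMap.ker S.g.hom.toLin := by
  have hle : LinearMap.range S.f.hom.toLin ≤ LinearMap.ker S.g.hom.toLin := by
    rintro _ ⟨m, rfl⟩
    exact GrMod.toLin_apply_eq_zero (congrArg (fun h => InducedCategory.Hom.hom h) S.zero) m
  constructor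
  · intro h
    have := h.mono_f
    have := h.epi_g
    refine ⟨injective_of_mono S.f, surjective_of_epi S.g, le_antisymm hle fun m hm => ?_⟩
    obtain ⟨l, hl⟩ := KernelFork.IsLimit.lift' h.fIsKernel (kerι S.g) (kerι_comp S.g)
    let m' : (ker S.g).obj.carrier := (⟨m, hm⟩ : LinearMap.ker S.g.hom.toLin)
    exact ⟨l.hom.toLin m', LinearMap.congr_fun
      (congrArg (fun h => GrMod.Hom.toLin (InducedCategory.Hom.hom h)) hl) m'⟩
  · rintro ⟨h1, h2, h3⟩
    have : Mono S.f :=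
      (isFinitelyPresented 𝒜).ι.mono_of_mono_map (GrMod.mono_of_injective S.f.hom h1)
    have : Epi S.g :=
      (isFinitelyPresented 𝒜).ι.epi_of_epi_map (GrMod.epi_of_surjective S.g.hom h2)
    exact { exact := ShortComplex.exact_of_f_is_kernel _
              (isLimitOfInjective S.f h1 S.g S.zero h3.ge) }

end FpGrMod

instance : (fdim 𝒜).IsSerreClass where
  exists_zero := by
    obtain ⟨Z, hZ, hZ'⟩ := (isFinitelyPresented 𝒜).exists_prop_of_containsZero
    refine ⟨⟨Z, hZ'⟩, ?_, ?_⟩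
    · rw [IsZero.iff_id_eq_zero]
      exact ObjectProperty.hom_ext _ (hZ.eq_of_src _ _)
    · have h : ∀ m : Z.carrier, m = 0 := fun m =>
        LinearMap.congr_fun (congrArg GrMod.Hom.toLin (hZ.eq_of_src (𝟙 Z) 0)) m
      have : Subsingleton Z.carrier := ⟨fun a b => (h a).trans (h b).symm⟩
      exact (inferInstance : Module.Finite k Z.carrier)
  prop_of_mono f _ h := by
    have : FiniteDimensional k _ := h
    exact FiniteDimensional.of_injective (f.hom.toLin.restrictScalars k)
      (FpGrMod.injective_of_mono f)
  prop_of_epi f _ h := by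
    have : FiniteDimensional k _ := h
    exact Module.Finite.of_surjective (f.hom.toLin.restrictScalars k)
      (FpGrMod.surjective_of_epi f)
  prop_X₂_of_shortExact {S} hS h1 h3 := by
    obtain ⟨_, _, h⟩ := (FpGrMod.shortExact_iff S).1 hS
    have : FiniteDimensional k S.X₁.obj.carrier := h1
    have : FiniteDimensional k S.X₃.obj.carrier := h3
    have := isNoetherian_of_range_eq_ker (S.f.hom.toLin.restrictScalars k)
      (S.g.hom.toLin.restrictScalars k) (by
        ext m
        exact SetLike.ext_iff.1 h m)
    exact Module.IsNoetherian.finite k _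

/-- This identifies the concrete localizing class with the one attached to a Serre class, so that
the general theory of Serre quotients applies to `qgr A`. -/
theorem isoModFdim_eq : FpGrMod.isoModFdim 𝒜 = (fdim 𝒜).isoModSerre := by
  ext M N f
  refine and_congr ?_ ?_
  · exact ((fdim 𝒜).prop_iff_of_iso (FpGrMod.kernelIso f)).symm
  · exact ((fdim 𝒜).prop_iff_of_iso (FpGrMod.cokernelIso f)).symm

namespace Qgr

instance : (quotientFunctor 𝒜).IsLocalization (fdim 𝒜).isoModSerre := by
  rw [← isoModFdim_eq]
  infer_instance

instance : Preadditive (Qgr 𝒜) :=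
  Localization.preadditive (quotientFunctor 𝒜) (fdim 𝒜).isoModSerre

instance : (quotientFunctor 𝒜).Additive :=
  Localization.functor_additive (quotientFunctor 𝒜) (fdim 𝒜).isoModSerre

instance : Abelian (Qgr 𝒜) :=
  ObjectProperty.SerreClassLocalization.abelian (quotientFunctor 𝒜) (fdim 𝒜)

variable {𝒜}

theorem cls_shortExact {S : ShortComplex (FpGrMod 𝒜)} (hS : S.ShortExact) :
    cls S.X₂ = cls S.X₁ + cls S.X₃ := by
  have := ObjectProperty.SerreClassLocalization.preservesFiniteLimits (quotientFunctor 𝒜) (fdim 𝒜)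
  have := ObjectProperty.SerreClassLocalization.preservesFiniteColimits
    (quotientFunctor 𝒜) (fdim 𝒜)
  have h := hS.map_of_exact (quotientFunctor 𝒜)
  exact K0.of_shortExact ((isShortExactPair_iff _ _).2 ⟨_, h⟩)

end Qgr

end

namespace PrefixSystem

variable {k A : Type u} [Field k] [Ring A] [Algebra k A]
variable {𝒜 : ℤ → Submodule k A} [GradedAlgebra 𝒜] {r : ℕ} (S : PrefixSystem 𝒜 r)

/-! ## Decomposition of the part fixed by the idempotent -/

/-- The elements `v (σ j) * x`, which are fixed by `e`. -/
def z (j : Fin (r + 1)) : A := S.w (S.σ j)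

theorem z_mem (j : Fin (r + 1)) : S.z j ∈ 𝒜 (j + 1) := by
  have := S.w_mem (S.σ j)
  rwa [S.δ_σ] at this

theorem e_mul_z (j : Fin (r + 1)) : S.e * S.z j = S.z j := by
  rw [z, w, ← mul_assoc, S.e_mul_v_σ]

theorem e_mul_w (l : S.J) (hl : l ∉ Set.range S.σ) : S.e * S.w l = 0 := by
  rw [w, ← mul_assoc, S.e_mul_v l hl, zero_mul]

theorem z_smul_mem {M : GrMod 𝒜} (j : Fin (r + 1)) {n : ℤ} {m : M.carrier}
    (hm : m ∈ M.deg (n - (j + 1))) : S.z j • m ∈ S.edeg M n :=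
  ⟨by simpa using M.smul_mem_deg (S.z_mem j) hm, by rw [← mul_smul, S.e_mul_z]⟩

/-- The elements of `E n` are uniquely sums of a linear combination of those `u s` that have
degree `n` and of elements `z j • b j` with `b j` in the appropriate part of the family `E`. -/
def HasDecompAt {M : GrMod 𝒜} (E : ℤ → Submodule k M.carrier) {ι : Type} [Fintype ι]
    (d : ι → ℤ) (u : ι → M.carrier) (n : ℤ) : Prop :=
  (∀ m ∈ E n, ∃ (c : ι → k) (b : Fin (r + 1) → M.carrier), (∀ s, d s ≠ n → c s = 0) ∧
    (∀ j : Fin (r + 1), b j ∈ E (n - (j + 1))) ∧ m = ∑ s, c s • u s + ∑ j, S.z j • b j) ∧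
  ∀ (c : ι → k) (b : Fin (r + 1) → M.carrier), (∀ s, d s ≠ n → c s = 0) →
    (∀ j : Fin (r + 1), b j ∈ E (n - (j + 1))) → ∑ s, c s • u s + ∑ j, S.z j • b j = 0 → c = 0 ∧ b = 0

/-- Multiplication by `e` fixes the terms indexed by `σ` and kills all others. -/
theorem sum_e_smul {M : GrMod 𝒜} (b : S.J → M.carrier) :
    S.e • ∑ l, S.w l • b l = ∑ j, S.z j • b (S.σ j) := by
  rw [Finset.smul_sum]
  refine (Fintype.sum_of_injective S.σ S.σ_injective _ _ ?_ ?_).symm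
  · intro l hl
    rw [← mul_smul, S.e_mul_w l hl, zero_smul]
  · intro j
    rw [← mul_smul]
    exact congrArg (· • _) (S.e_mul_z j).symm

theorem exists_eq_sum_of_isRegularAt {M : GrMod 𝒜} {n : ℤ} (h : S.IsRegularAt M n)
    {m : M.carrier} (hm : m ∈ S.edeg M n) :
    ∃ b : Fin (r + 1) → M.carrier, (∀ j : Fin (r + 1), b j ∈ S.edeg M (n - (j + 1))) ∧
      m = ∑ j, S.z j • b j := by
  obtain ⟨b, hb, hbm⟩ := h.1 m hm.1
  refine ⟨fun j => b (S.σ j), fun j => ?_, ?_⟩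
  · have := hb (S.σ j)
    rwa [S.δ_σ] at this
  · rw [← S.sum_e_smul, hbm, hm.2]

/-- Extending the family by zero outside the range of `σ` reduces this to uniqueness over all of
`S.J`. -/
theorem eq_zero_of_isRegularAt {M : GrMod 𝒜} {n : ℤ} (h : S.IsRegularAt M n)
    (b : Fin (r + 1) → M.carrier) (hb : ∀ j : Fin (r + 1), b j ∈ S.edeg M (n - (j + 1)))
    (h0 : ∑ j, S.z j • b j = 0) : b = 0 := by
  have hext : ∀ j, Function.extend S.σ b 0 (S.σ j) = b j := S.σ_injective.extend_apply b 0
  have := h.2 (Function.extend S.σ b 0) (fun l => ?_) ?_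
  · funext j
    rw [← hext j, this]
    rfl
  · by_cases hl : l ∈ Set.range S.σ
    · obtain ⟨j, rfl⟩ := hl
      rw [hext, S.δ_σ]
      exact hb j
    · rw [Function.extend_apply' _ _ _ (by simpa using hl)]
      exact Submodule.zero_mem _
  · rw [← h0]
    refine (Fintype.sum_of_injective S.σ S.σ_injective _ _ ?_ ?_).symm
    · intro l hl
      rw [Function.extend_apply' _ _ _ (by simpa using hl), Pi.zero_apply, smul_zero]
    · intro j
      rw [hext]
      rfl

theorem v_σ_mem (j : Fin (r + 1)) : S.v (S.σ j) ∈ 𝒜 j := by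
  simpa only [S.δ_σ] using S.v_mem (S.σ j)

theorem exists_decomp_self {n : ℤ} {a : A} (ha : a ∈ 𝒜 n) (ha' : S.e * a = a) :
    ∃ (c : Fin (r + 1) → k) (b : Fin (r + 1) → A), (∀ j : Fin (r + 1), (j : ℤ) ≠ n → c j = 0) ∧
      (∀ j : Fin (r + 1), b j ∈ 𝒜 (n - (j + 1)) ∧ S.e * b j = b j) ∧
      a = ∑ j, (c j • S.v (S.σ j) + S.z j * b j) := by
  obtain ⟨c, b, hc, hb, rfl⟩ := S.exists_decomp_deg ha
  refine ⟨fun j => c (S.σ j), fun j => b (S.σ j),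
    fun j hj => hc _ (by rwa [S.δ_σ]), fun j => ?_, ?_⟩
  · have := hb (S.σ j)
    rwa [S.δ_σ] at this
  · rw [← ha', Finset.mul_sum]
    refine (Fintype.sum_of_injective S.σ S.σ_injective _ _ ?_ ?_).symm
    · intro l hl
      rw [mul_add, mul_smul_comm, S.e_mul_v l hl, ← mul_assoc, S.e_mul_w l hl, zero_mul,
        smul_zero, add_zero]
    · intro j
      rw [mul_add, mul_smul_comm, S.e_mul_v_σ, ← mul_assoc]
      exact congrArg (fun t => c (S.σ j) • S.v (S.σ j) + t * b (S.σ j)) (S.e_mul_z j).symm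

theorem decomp_self_unique (c : Fin (r + 1) → k) (b : Fin (r + 1) → A)
    (hb : ∀ j, S.e * b j = b j) (h0 : ∑ j, (c j • S.v (S.σ j) + S.z j * b j) = 0) :
    c = 0 ∧ b = 0 := by
  have hextb : ∀ j, Function.extend S.σ b 0 (S.σ j) = b j := S.σ_injective.extend_apply _ _
  have hextc : ∀ j, Function.extend S.σ c 0 (S.σ j) = c j := S.σ_injective.extend_apply _ _
  have hb0 : ∀ l, l ∉ Set.range S.σ → Function.extend S.σ b 0 l = 0 :=
    fun l hl => Function.extend_apply' _ _ _ (by simpa using hl)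
  have hc0 : ∀ l, l ∉ Set.range S.σ → Function.extend S.σ c 0 l = 0 :=
    fun l hl => Function.extend_apply' _ _ _ (by simpa using hl)
  have hfix : ∀ l, S.e * Function.extend S.σ b 0 l = Function.extend S.σ b 0 l := by
    intro l
    by_cases hl : l ∈ Set.range S.σ
    · obtain ⟨j, rfl⟩ := hl
      rw [hextb, hb j]
    · rw [hb0 l hl, mul_zero]
  obtain ⟨h1, h2⟩ := S.decomp_unique (Function.extend S.σ c 0) (Function.extend S.σ b 0) hfix <| by
    refine Eq.trans (Fintype.sum_of_injective S.σ S.σ_injective _ _ ?_ ?_).symm h0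
    · intro l hl
      rw [hb0 l hl, hc0 l hl, zero_smul, mul_zero, add_zero]
    · intro j
      rw [hextb, hextc]
      rfl
  exact ⟨funext fun j => (hextc j).symm.trans (congrFun h1 _),
    funext fun j => (hextb j).symm.trans (congrFun h2 _)⟩

/-- The part of `A` fixed by `e` has the generators `v (σ j)`, one in each degree `0, …, r`. The
decomposition holds in every degree, so `A` needs no truncation. -/
theorem hasDecompAt_self (n : ℤ) :
    S.HasDecompAt (S.edeg (GrMod.self 𝒜)) (fun j : Fin (r + 1) => (j : ℤ))
      (fun j => S.v (S.σ j)) n := by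
  constructor
  · rintro (a : A) ⟨ha, ha'⟩
    obtain ⟨c, b, hc, hb, h⟩ := S.exists_decomp_self ha ha'
    exact ⟨c, b, hc, hb, h.trans Finset.sum_add_distrib⟩
  · intro c b _ hb h0
    exact S.decomp_self_unique c b (fun j => (hb j).2) (Finset.sum_add_distrib.trans h0)

/-! ### Isomorphisms modulo finite dimensional modules -/

theorem IsTame.finiteDimensional {S : PrefixSystem 𝒜 r} {M : GrMod 𝒜} (hM : S.IsTame M) {n₁ : ℤ}
    (h : ∀ n ≥ n₁, M.deg n = ⊥) : FiniteDimensional k M.carrier := by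
  obtain ⟨b, hb⟩ := hM.bounded
  have : (⨆ i ∈ Finset.Ico b n₁, M.deg i).FG :=
    Submodule.fg_biSup _ _ fun i _ => Module.Finite.iff_fg.1 (hM.finite i)
  refine ⟨?_⟩
  convert this
  refine le_antisymm ?_ le_top
  rw [← M.iSup_deg]
  refine iSup_le fun i => ?_
  by_cases h1 : i < b
  · rw [hb i h1]
    exact bot_le
  by_cases h2 : n₁ ≤ i
  · rw [h i h2]
    exact bot_le
  · exact le_iSup₂_of_le i (Finset.mem_Ico.2 ⟨not_lt.1 h1, not_le.1 h2⟩) le_rfl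

/-- A morphism of tame modules that is bijective in all large degrees on the parts fixed by `e` has
finite dimensional kernel and cokernel. -/
theorem isoModFdim_of_bijOn {M N : FpGrMod 𝒜} (f : M ⟶ N) (n₁ : ℤ)
    (hinj : ∀ n ≥ n₁, ∀ m ∈ S.edeg M.obj n, f.hom.toLin m = 0 → m = 0)
    (hsurj : ∀ n ≥ n₁, ∀ y ∈ S.edeg N.obj n, ∃ m ∈ S.edeg M.obj n, f.hom.toLin m = y) :
    FpGrMod.isoModFdim 𝒜 f := by
  have hM := (S.isTame_iff M.obj).2 M.property
  have hN := (S.isTame_iff N.obj).2 N.property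
  have hK : S.IsTame (GrMod.ker f.hom) := S.isTame_of_injective (GrMod.kerι f.hom) f.hom
    (GrMod.kerι_injective f.hom) (Submodule.range_subtype _) hM hN
  have hC : S.IsTame (GrMod.coker f.hom) := S.isTame_of_surjective f.hom (GrMod.cokerπ f.hom)
    (GrMod.cokerπ_surjective f.hom) (Submodule.ker_mkQ _).symm hM hN
  obtain ⟨n₂, h₂⟩ := hM.regular
  obtain ⟨n₃, h₃⟩ := hN.regular
  obtain ⟨D, hD⟩ := (Set.finite_range S.δ).bddAbove
  have hD' : ∀ l, S.δ l ≤ D := fun l => hD ⟨l, rfl⟩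
  constructor
  -- The coefficients of an element of degree `n` have degree `n - δ l - 1` with `δ l ≤ D`; the
  -- margin `D + 1` keeps them in the range where `f` is bijective on the parts fixed by `e`.
  · refine hK.finiteDimensional (n₁ := max n₁ (max n₂ n₃) + D + 1) fun n hn => ?_
    rw [Submodule.eq_bot_iff]
    rintro ⟨m, hm⟩ hmn
    refine Subtype.ext ?_
    obtain ⟨b, hb, rfl⟩ := (h₂ n (by lia)).1 m hmn
    have h1 : (fun l => f.hom.toLin (b l)) = 0 := by
      refine (h₃ n (by lia)).2 _ (fun l => S.map_mem_edeg f.hom (hb l)) ?_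
      simpa only [LinearMap.mem_ker, map_sum, map_smul] using hm
    refine Finset.sum_eq_zero fun l _ => ?_
    have := hD' l
    rw [hinj _ (by lia) _ (hb l) (congrFun h1 l), smul_zero]
  · refine hC.finiteDimensional (n₁ := max n₁ (max n₂ n₃) + D + 1) fun n hn => ?_
    rw [Submodule.eq_bot_iff]
    rintro _ ⟨y, hy, rfl⟩
    refine (Submodule.Quotient.mk_eq_zero _).2 ?_
    obtain ⟨b, hb, rfl⟩ := (h₃ n (by lia)).1 y hy
    refine Submodule.sum_mem _ fun l _ => Submodule.smul_mem _ _ ?_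
    have := hD' l
    obtain ⟨m, -, hm⟩ := hsurj _ (by lia) _ (hb l)
    exact ⟨m, hm⟩

/-- The free graded module as an object of `gr A`. -/
def _root_.FpGrMod.free (𝒜 : ℤ → Submodule k A) [GradedAlgebra 𝒜] {ι : Type} [Finite ι]
    (d : ι → ℤ) : FpGrMod 𝒜 :=
  ⟨GrMod.free 𝒜 d, inferInstanceAs (Module.FinitePresentation A (ι → A))⟩

/-! ### Comparison with free modules -/

section Free

variable {M : GrMod 𝒜} {ι : Type} [Fintype ι] {d : ι → ℤ} {u : ι → M.carrier}

/-- The morphism from a free module with `a ↦ ∑ s, a s • x • u s`. -/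
def freeHom (hu : ∀ s, u s ∈ M.deg (d s)) : GrMod.free 𝒜 (fun s => d s + 1) ⟶ M :=
  GrMod.freeLift (fun s => S.x • u s) fun s => by
    simpa [add_comm] using M.smul_mem_deg S.x_mem (hu s)

theorem freeHom_apply (hu : ∀ s, u s ∈ M.deg (d s)) (a : ι → A) :
    (S.freeHom hu).toLin a = ∑ s, a s • S.x • u s :=
  GrMod.freeLift_apply _ _ a

theorem mem_edeg_free {n : ℤ} {a : ι → A} :
    a ∈ S.edeg (GrMod.free 𝒜 (fun s => d s + 1)) n ↔
      ∀ s, a s ∈ 𝒜 (n - (d s + 1)) ∧ S.e * a s = a s := by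
  constructor
  · intro h s
    have h1 : a s ∈ 𝒜 (-(d s + 1) + n) := h.1 s trivial
    exact ⟨by rwa [neg_add_eq_sub] at h1, congrFun h.2 s⟩
  · intro h
    refine ⟨fun s _ => ?_, funext fun s => (h s).2⟩
    change a s ∈ 𝒜 (-(d s + 1) + n)
    rw [neg_add_eq_sub]
    exact (h s).1

variable {E : ℤ → Submodule k M.carrier} {n₀ : ℤ}

/-- The decomposition is iterated: each `b j` has smaller degree, so inductively `b j = ∑ s, (c' s •
u s + a s • x • u s)`. Since `z j = v (σ j) * x`, it follows that `z j • b j = ∑ s, (c' s • v (σ j)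
+ z j * a s) • x • u s`. -/
theorem exists_eq_add_freeHom (hu : ∀ s, u s ∈ M.deg (d s)) (hbot : ∀ n < n₀, E n = ⊥)
    (h : ∀ n ≥ n₀, S.HasDecompAt E d u n) (n : ℤ) (m : M.carrier) (hm : m ∈ E n) :
    ∃ (c : ι → k) (a : ι → A), (∀ s, d s ≠ n → c s = 0) ∧
      a ∈ S.edeg (GrMod.free 𝒜 (fun s => d s + 1)) n ∧
      m = ∑ s, c s • u s + (S.freeHom hu).toLin a := by
  have hlow : ∀ n < n₀, ∀ m ∈ E n, ∃ (c : ι → k) (a : ι → A), (∀ s, d s ≠ n → c s = 0) ∧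
      a ∈ S.edeg (GrMod.free 𝒜 (fun s => d s + 1)) n ∧
      m = ∑ s, c s • u s + (S.freeHom hu).toLin a := by
    intro n hn m hm
    rw [hbot n hn] at hm
    refine ⟨0, 0, fun _ _ => rfl, Submodule.zero_mem _, ?_⟩
    rw [(Submodule.mem_bot k).1 hm, show (S.freeHom hu).toLin (0 : ι → A) = 0 from map_zero _]
    simp
  -- Induction on an upper bound for the degree, since the step refers to all the degrees `n - 1, …,
  -- n - (r + 1)`; below `n₀` only zero occurs.
  suffices key : ∀ K : ℕ, ∀ n < n₀ + K, ∀ m ∈ E n, ∃ (c : ι → k) (a : ι → A),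
      (∀ s, d s ≠ n → c s = 0) ∧ a ∈ S.edeg (GrMod.free 𝒜 (fun s => d s + 1)) n ∧
      m = ∑ s, c s • u s + (S.freeHom hu).toLin a from
    key (n - n₀ + 1).toNat n (by lia) m hm
  clear hm m n
  intro K
  induction K with
  | zero => exact fun n hn => hlow n (by simpa using hn)
  | succ K ih =>
    intro n hn m hm
    by_cases h1 : n < n₀
    · exact hlow n h1 m hm
    obtain ⟨c, b, hc, hb, rfl⟩ := (h n (not_lt.1 h1)).1 m hm
    choose c' a hc' ha hba using fun j : Fin (r + 1) => ih (n - (j + 1)) (by push_cast at hn; lia) (b j) (hb j)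
    refine ⟨c, fun s => ∑ j, (c' j s • S.v (S.σ j) + S.z j * a j s), hc, ?_, ?_⟩
    · rw [mem_edeg_free]
      intro s
      refine ⟨Submodule.sum_mem _ fun j _ => Submodule.add_mem _ ?_ ?_, ?_⟩
      · by_cases hs : d s = n - (j + 1)
        · refine Submodule.smul_mem _ _ ?_
          convert S.v_σ_mem j using 2
          rw [hs]
          ring
        · rw [hc' j s hs, zero_smul]
          exact Submodule.zero_mem _
      · convert SetLike.mul_mem_graded (S.z_mem j) (S.mem_edeg_free.1 (ha j) s).1 using 2
        ring
      · rw [Finset.mul_sum]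
        refine Finset.sum_congr rfl fun j _ => ?_
        rw [mul_add, mul_smul_comm, S.e_mul_v_σ, ← mul_assoc, S.e_mul_z]
    · congr 1
      rw [freeHom_apply]
      simp only [Finset.sum_smul]
      rw [Finset.sum_comm]
      refine Finset.sum_congr rfl fun j _ => ?_
      rw [hba j, freeHom_apply, smul_add, Finset.smul_sum, Finset.smul_sum,
        ← Finset.sum_add_distrib]
      refine Finset.sum_congr rfl fun s _ => ?_
      rw [add_smul, mul_smul (S.z j), z, w, smul_assoc, mul_smul, smul_comm (c' j s),
        smul_comm (c' j s), mul_smul]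

/-- Decomposing every `a s` in `A` groups the relation into terms `z j • g j`, where `g j` has the
same form in smaller degree. Uniqueness in degree `n` gives `c = 0` and `g j = 0`, and induction
applies to the `g j`. -/
theorem eq_zero_of_add_freeHom (hu : ∀ s, u s ∈ E (d s)) (hd : ∀ s, n₀ ≤ d s)
    (hu' : ∀ s, u s ∈ M.deg (d s))
    (hE : ∀ n ≥ n₀, E n = S.edeg M n)
    (h : ∀ n ≥ n₀, S.HasDecompAt E d u n) (n : ℤ) (c : ι → k) (a : ι → A)
    (hc : ∀ s, d s ≠ n → c s = 0)
    (ha : a ∈ S.edeg (GrMod.free 𝒜 (fun s => d s + 1)) n)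
    (h0 : ∑ s, c s • u s + (S.freeHom hu').toLin a = 0) : c = 0 ∧ a = 0 := by
  -- The free generators have degree `d s + 1 > n₀`, so the free module is zero up to and including
  -- degree `n₀`.
  have hneg : ∀ n ≤ n₀, ∀ a ∈ S.edeg (GrMod.free 𝒜 (fun s => d s + 1)) n, a = 0 := by
    intro n hn a ha
    funext s
    have h1 := (S.mem_edeg_free.1 ha s).1
    have := hd s
    rw [S.deg_neg _ (by lia)] at h1
    exact h1
  have hlow : ∀ n < n₀, ∀ (c : ι → k) (a : ι → A), (∀ s, d s ≠ n → c s = 0) →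
      a ∈ S.edeg (GrMod.free 𝒜 (fun s => d s + 1)) n →
      ∑ s, c s • u s + (S.freeHom hu').toLin a = 0 → c = 0 ∧ a = 0 := by
    intro n hn c a hc ha _
    refine ⟨funext fun s => hc s ?_, hneg n hn.le a ha⟩
    have := hd s
    lia
  suffices key : ∀ K : ℕ, ∀ n < n₀ + K, ∀ (c : ι → k) (a : ι → A), (∀ s, d s ≠ n → c s = 0) →
      a ∈ S.edeg (GrMod.free 𝒜 (fun s => d s + 1)) n →
      ∑ s, c s • u s + (S.freeHom hu').toLin a = 0 → c = 0 ∧ a = 0 from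
    key (n - n₀ + 1).toNat n (by lia) c a hc ha h0
  clear h0 ha hc a c n
  intro K
  induction K with
  | zero => exact fun n hn => hlow n (by simpa using hn)
  | succ K ih =>
    intro n hn c a hc ha h0
    by_cases h1 : n < n₀
    · exact hlow n h1 c a hc ha h0
    choose c' b hc' hb hba using fun s => S.exists_decomp_self
      (S.mem_edeg_free.1 ha s).1 (S.mem_edeg_free.1 ha s).2
    have hb' : ∀ j : Fin (r + 1), (fun s => b s j) ∈
        S.edeg (GrMod.free 𝒜 (fun s => d s + 1)) (n - (j + 1)) := fun j => by
      rw [mem_edeg_free]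
      intro s
      refine ⟨?_, (hb s j).2⟩
      convert (hb s j).1 using 2
      ring
    have hc'' : ∀ (j : Fin (r + 1)) s, d s ≠ n - (j + 1) → c' s j = 0 :=
      fun j s hs => hc' s j (by lia)
    have hmem : ∀ j : Fin (r + 1), ∑ s, c' s j • u s +
        (S.freeHom hu').toLin (fun s => b s j) ∈ E (n - (j + 1)) := by
      intro j
      refine Submodule.add_mem _ (Submodule.sum_mem _ fun s _ => ?_) ?_
      · by_cases hs : d s = n - (j + 1)
        · rw [← hs]
          exact Submodule.smul_mem _ _ (hu s)
        · rw [hc'' j s hs, zero_smul]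
          exact Submodule.zero_mem _
      -- Below `n₀`, `E` is not assumed to be the whole part fixed by `e`, but the free summand
      -- vanishes there.
      · by_cases hj : n - (j + 1) < n₀
        · have h2 := (congrArg (S.freeHom hu').toLin (hneg _ hj.le _ (hb' j))).trans (map_zero _)
          rw [h2]
          exact Submodule.zero_mem _
        · rw [hE _ (not_lt.1 hj)]
          exact S.map_mem_edeg _ (hb' j)
    have hsum : ∑ s, c s • u s + ∑ j, S.z j • (∑ s, c' s j • u s +
        (S.freeHom hu').toLin (fun s => b s j)) = 0 := by
      rw [← h0]
      congr 1
      rw [freeHom_apply]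
      simp only [hba, Finset.sum_smul]
      rw [Finset.sum_comm]
      refine Finset.sum_congr rfl fun j _ => ?_
      rw [freeHom_apply, smul_add, Finset.smul_sum, Finset.smul_sum, ← Finset.sum_add_distrib]
      refine Finset.sum_congr rfl fun s _ => ?_
      rw [add_smul, mul_smul (S.z j), z, w, smul_assoc, mul_smul, smul_comm (c' s j),
        smul_comm (c' s j), mul_smul]
    obtain ⟨hc0, hg⟩ := (h n (not_lt.1 h1)).2 c _ hc hmem hsum
    refine ⟨hc0, funext fun s => ?_⟩
    have hz : ∀ j : Fin (r + 1), (fun s => c' s j) = 0 ∧ (fun s => b s j) = 0 := fun j =>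
      ih (n - (j + 1)) (by push_cast at hn; lia) _ _ (hc'' j) (hb' j) (congrFun hg j)
    rw [hba s]
    refine Finset.sum_eq_zero fun j _ => ?_
    rw [show c' s j = 0 from congrFun (hz j).1 s, show b s j = 0 from congrFun (hz j).2 s,
      zero_smul, mul_zero, add_zero]

end Free

/-- A module whose part fixed by `e` has generators `u s` in the sense of the decomposition is
isomorphic to a free module up to finite dimensional modules. -/
theorem isoModFdim_freeHom {M : FpGrMod 𝒜} {ι : Type} [Fintype ι] {d : ι → ℤ}
    {u : ι → M.obj.carrier} {E : ℤ → Submodule k M.obj.carrier} {n₀ : ℤ}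
    (hu : ∀ s, u s ∈ E (d s)) (hd : ∀ s, n₀ ≤ d s) (hu' : ∀ s, u s ∈ M.obj.deg (d s))
    (hbot : ∀ n < n₀, E n = ⊥) (hE : ∀ n ≥ n₀, E n = S.edeg M.obj n)
    (h : ∀ n ≥ n₀, S.HasDecompAt E d u n) :
    FpGrMod.isoModFdim 𝒜
      (ObjectProperty.homMk (S.freeHom hu') : FpGrMod.free 𝒜 (fun s => d s + 1) ⟶ M) := by
  obtain ⟨D, hD⟩ := (Set.finite_range d).bddAbove
  have hD' : ∀ s, d s ≤ D := fun s => hD ⟨s, rfl⟩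
  -- Beyond the degrees of all the `u s` the scalar coefficients vanish, so every element of `E`
  -- comes from the free module. Injectivity is the case `c = 0` of uniqueness.
  refine S.isoModFdim_of_bijOn _ (max n₀ (D + 1)) (fun n _ a ha h0 => ?_) (fun n hn y hy => ?_)
  · refine (S.eq_zero_of_add_freeHom hu hd hu' hE h n 0 a (fun _ _ => rfl) ha ?_).2
    simp only [Pi.zero_apply, zero_smul, Finset.sum_const_zero, zero_add]
    exact h0
  · rw [← hE n (by lia)] at hy
    obtain ⟨c, a, hc, ha, rfl⟩ := S.exists_eq_add_freeHom hu' hbot h n y hy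
    refine ⟨a, ha, ?_⟩
    rw [Finset.sum_eq_zero, zero_add]
    · rfl
    · intro s _
      have := hD' s
      rw [hc s (by lia), zero_smul]

end PrefixSystem

/-- A basis of a complement of the image of an injective linear map. -/
theorem LinearMap.exists_basis_of_complement {k V W : Type*} [Field k] [AddCommGroup V]
    [Module k V] [AddCommGroup W] [Module k W] [FiniteDimensional k W] (Φ : V →ₗ[k] W)
    (hΦ : Function.Injective Φ) :
    ∃ (q : ℕ) (u : Fin q → W), (∀ w, ∃ (c : Fin q → k) (b : V), w = ∑ i, c i • u i + Φ b) ∧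
      ∀ (c : Fin q → k) (b : V), ∑ i, c i • u i + Φ b = 0 → c = 0 ∧ b = 0 := by
  obtain ⟨U, hU⟩ := Submodule.exists_isCompl (LinearMap.range Φ)
  let B := Module.finBasis k U
  refine ⟨_, fun i => (B i : W), fun w => ?_, fun c b h => ?_⟩
  · have hw : w ∈ LinearMap.range Φ ⊔ U := by
      rw [hU.sup_eq_top]
      trivial
    obtain ⟨_, ⟨b, rfl⟩, y, hy, rfl⟩ := Submodule.mem_sup.1 hw
    refine ⟨B.repr ⟨y, hy⟩, b, ?_⟩
    have := congrArg Subtype.val (B.sum_repr ⟨y, hy⟩)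
    rw [AddSubmonoidClass.coe_finsetSum] at this
    rw [add_comm]
    exact congrArg (· + Φ b) this.symm
  · have h1 : Φ b ∈ U := by
      rw [← neg_eq_of_add_eq_zero_right h]
      exact U.neg_mem (Submodule.sum_mem _ fun i _ => U.smul_mem _ (B i).2)
    have h2 : Φ b = 0 := (Submodule.disjoint_def.1 hU.disjoint) _ ⟨b, rfl⟩ h1
    rw [h2, add_zero] at h
    refine ⟨?_, hΦ (h2.trans (map_zero Φ).symm)⟩
    have h3 : ∑ i, c i • B i = 0 := Subtype.ext (by
      rw [AddSubmonoidClass.coe_finsetSum]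
      exact h)
    exact funext (Fintype.linearIndependent_iff.1 B.linearIndependent c h3)

/-! ### Every module is free modulo finite dimensional modules -/

namespace PrefixSystem

variable {k A : Type u} [Field k] [Ring A] [Algebra k A]
variable {𝒜 : ℤ → Submodule k A} [GradedAlgebra 𝒜] {r : ℕ} (S : PrefixSystem 𝒜 r)

/-- The map `b ↦ ∑ j, z j • b j`. -/
def zSum {M : GrMod 𝒜} (E : ℤ → Submodule k M.carrier) (n : ℤ) :
    (∀ j : Fin (r + 1), E (n - (j + 1))) →ₗ[k] M.carrier where
  toFun b := ∑ j, S.z j • (b j : M.carrier)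
  map_add' a b := by simp [Finset.sum_add_distrib]
  map_smul' c b := by simp [Finset.smul_sum, smul_comm c]

theorem hasDecompAt_of_isRegularAt {M : GrMod 𝒜} {n : ℤ} (h : S.IsRegularAt M n) :
    S.HasDecompAt (S.edeg M) (fun s : Fin 0 => s.elim0) (fun s : Fin 0 => s.elim0) n := by
  constructor
  · intro m hm
    obtain ⟨b, hb, rfl⟩ := S.exists_eq_sum_of_isRegularAt h hm
    exact ⟨0, b, fun _ _ => rfl, hb, by simp⟩
  · intro c b _ hb h0
    exact ⟨funext fun s => s.elim0, S.eq_zero_of_isRegularAt h b hb (by simpa using h0)⟩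

/-- Every finitely presented graded module is isomorphic to a free one up to finite dimensional
modules. -/
theorem exists_free_isoModFdim {k A : Type u} [Field k] [Ring A] [Algebra k A]
    {𝒜 : ℤ → Submodule k A} [GradedAlgebra 𝒜] {r : ℕ} (S : PrefixSystem 𝒜 r) (M : FpGrMod 𝒜) :
    ∃ (ι : Type) (_ : Fintype ι) (d : ι → ℤ) (f : FpGrMod.free 𝒜 d ⟶ M),
      FpGrMod.isoModFdim 𝒜 f := by
  classical
  have hM := (S.isTame_iff M.obj).2 M.property
  obtain ⟨n₀, hn₀⟩ := hM.regular
  -- The part fixed by `e`, truncated at a degree from which `M` is regular. Truncation creates new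
  -- generators only in the degrees `n₀, …, n₀ + r`.
  let E : ℤ → Submodule k M.obj.carrier := fun n => if n < n₀ then ⊥ else S.edeg M.obj n
  have hbot : ∀ n < n₀, E n = ⊥ := fun n hn => if_pos hn
  have hE : ∀ n ≥ n₀, E n = S.edeg M.obj n := fun n hn => if_neg (not_lt.2 hn)
  have hle : ∀ n, E n ≤ S.edeg M.obj n := fun n => by
    by_cases hn : n < n₀
    · rw [hbot n hn]
      exact bot_le
    · rw [hE n (not_lt.1 hn)]
  -- In degree `n₀ + i`, regularity makes `zSum` injective on the truncated family; a basis of a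
  -- complement of its image supplies the generators of that degree.
  have hfib : ∀ i : Fin (r + 1), ∃ (q : ℕ) (u : Fin q → E (n₀ + i)),
      (∀ w : E (n₀ + i), ∃ (c : Fin q → k) (b : ∀ j : Fin (r + 1), E (n₀ + i - (j + 1))),
        (w : M.obj.carrier) = ∑ t, c t • (u t : M.obj.carrier) + S.zSum E _ b) ∧
      ∀ (c : Fin q → k) (b : ∀ j : Fin (r + 1), E (n₀ + i - (j + 1))),
        ∑ t, c t • (u t : M.obj.carrier) + S.zSum E _ b = 0 → c = 0 ∧ b = 0 := by
    intro i
    have hn : n₀ + (i : ℤ) ≥ n₀ := by lia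
    have hfin : FiniteDimensional k (E (n₀ + i)) := by
      have := hM.finite (n₀ + i)
      exact Submodule.finiteDimensional_of_le ((hle _).trans (S.edeg_le M.obj _))
    have hmem : ∀ b, S.zSum E (n₀ + i) b ∈ E (n₀ + i) := fun b => by
      rw [hE _ hn]
      change ∑ j, S.z j • (b j : M.obj.carrier) ∈ _
      exact Submodule.sum_mem _ fun j _ => S.z_smul_mem j (hle _ (b j).2).1
    obtain ⟨q, u, h1, h2⟩ := ((S.zSum E (n₀ + i)).codRestrict _ hmem).exists_basis_of_complement (by
      rw [← LinearMap.ker_eq_bot, LinearMap.ker_eq_bot']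
      intro b hb
      have := S.eq_zero_of_isRegularAt (hn₀ _ hn) (fun j => (b j : M.obj.carrier))
        (fun j => hle _ (b j).2) (congrArg Subtype.val hb)
      exact funext fun j => Subtype.ext (congrFun this j))
    refine ⟨q, u, fun w => ?_, fun c b h => h2 c b (Subtype.ext ?_)⟩
    · obtain ⟨c, b, h⟩ := h1 w
      refine ⟨c, b, ?_⟩
      rw [h, Submodule.coe_add, AddSubmonoidClass.coe_finsetSum]
      rfl
    · rw [Submodule.coe_add, AddSubmonoidClass.coe_finsetSum]
      exact h
  choose q u hu1 hu2 using hfib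
  let d : (Σ i, Fin (q i)) → ℤ := fun s => n₀ + (s.1 : ℕ)
  let u' : (Σ i, Fin (q i)) → M.obj.carrier := fun s => u s.1 s.2
  have hsum : ∀ (i : Fin (r + 1)) (c : (Σ i, Fin (q i)) → k),
      (∀ s, d s ≠ n₀ + (i : ℕ) → c s = 0) →
      ∑ s, c s • u' s = ∑ t, c ⟨i, t⟩ • (u i t : M.obj.carrier) := by
    intro i c hc
    rw [Fintype.sum_sigma, Finset.sum_eq_single i]
    · intro i' _ hi'
      refine Finset.sum_eq_zero fun t _ => ?_
      rw [hc ⟨i', t⟩ (fun h => hi' (Fin.ext (by simpa [d] using h))), zero_smul]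
    · simp
  refine ⟨_, inferInstance, _, _, S.isoModFdim_freeHom (M := M) (d := d) (u := u') (E := E)
    (n₀ := n₀) (fun s => (u s.1 s.2).2) (fun s => by simp [d])
    (fun s => (hle _ (u s.1 s.2).2).1) hbot hE fun n hn => ?_⟩
  -- From degree `n₀ + r + 1` on, all degrees `n - (j + 1)` are at least `n₀`, so the truncation has
  -- no effect and regularity alone suffices.
  by_cases hnr : n < n₀ + (r + 1)
  · obtain ⟨i, rfl⟩ : ∃ i : Fin (r + 1), n = n₀ + (i : ℕ) :=
      ⟨⟨(n - n₀).toNat, by lia⟩, by simp only; lia⟩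
    constructor
    · intro m hm
      obtain ⟨c, b, h⟩ := hu1 i ⟨m, hm⟩
      let c' : (Σ i, Fin (q i)) → k := fun s => if h : s.1 = i then c (h ▸ s.2) else 0
      have hc' : ∀ s, d s ≠ n₀ + (i : ℕ) → c' s = 0 := fun s hs =>
        dif_neg fun h => hs (by simp [d, h])
      refine ⟨c', fun j => b j, hc', fun j => (b j).2, ?_⟩
      rw [hsum i c' hc']
      simp only [c', dite_true]
      exact h
    · intro c b hc hb h0
      rw [hsum i c hc] at h0
      obtain ⟨h1, h2⟩ := hu2 i (fun t => c ⟨i, t⟩) (fun j => ⟨b j, hb j⟩) h0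
      refine ⟨funext fun ⟨i', t⟩ => ?_, funext fun j => congrArg Subtype.val (congrFun h2 j)⟩
      by_cases hi : i' = i
      · subst hi
        exact congrFun h1 t
      · exact hc _ fun h => hi (Fin.ext (by simpa [d] using h))
  · have hd : ∀ s, d s ≠ n := fun s => by
      have := s.1.2
      simp only [d]
      lia
    constructor
    · intro m hm
      obtain ⟨b, hb, rfl⟩ := S.exists_eq_sum_of_isRegularAt (hn₀ n hn) (hle n hm)
      refine ⟨0, b, fun _ _ => rfl, fun j => ?_, by simp⟩
      have := j.2
      rw [hE _ (by lia)]
      exact hb j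
    · intro c b hc hb h0
      have hc0 : c = 0 := funext fun s => hc s (hd s)
      refine ⟨hc0, S.eq_zero_of_isRegularAt (hn₀ n hn) b (fun j => hle _ (hb j)) ?_⟩
      simpa [hc0] using h0

/-! ## Dimensions -/

/-- The decomposition is a linear isomorphism onto `E n` from the coefficients of the generators of
degree `n` together with the families `b`. -/
theorem finrank_eq_of_hasDecompAt {M : GrMod 𝒜} {E : ℤ → Submodule k M.carrier} {ι : Type}
    [Fintype ι] {d : ι → ℤ} {u : ι → M.carrier} {n : ℤ} (h : S.HasDecompAt E d u n)
    (hfin : ∀ n, FiniteDimensional k (E n))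
    (hu : ∀ s, d s = n → u s ∈ E n) (hz : ∀ b, S.zSum E n b ∈ E n) :
    (Module.finrank k (E n) : ℤ) = (Nat.card {s // d s = n} : ℤ) +
      ∑ j : Fin (r + 1), (Module.finrank k (E (n - (j + 1))) : ℤ) := by
  classical
  let F : ({s // d s = n} → k) × (∀ j : Fin (r + 1), E (n - (j + 1))) →ₗ[k] M.carrier :=
    (Fintype.linearCombination k fun s : {s // d s = n} => u s).coprod (S.zSum E n)
  have hF : ∀ c b, F (c, b) = ∑ s : {s // d s = n}, c s • u s + S.zSum E n b := fun c b => by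
    simp [F, Fintype.linearCombination_apply]
  have hext : ∀ c : {s // d s = n} → k,
      ∑ s : {s // d s = n}, c s • u s = ∑ s, (if h : d s = n then c ⟨s, h⟩ else 0) • u s := by
    intro c
    refine Fintype.sum_of_injective Subtype.val Subtype.val_injective _ _ ?_ ?_
    · intro s hs
      rw [dif_neg (by simpa using hs), zero_smul]
    · intro s
      rw [dif_pos s.2]
  have hinj : Function.Injective F := by
    rw [← LinearMap.ker_eq_bot, LinearMap.ker_eq_bot']
    rintro ⟨c, b⟩ h0
    rw [hF, hext] at h0
    obtain ⟨h1, h2⟩ := h.2 _ (fun j => (b j : M.carrier)) (fun s hs => dif_neg hs)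
      (fun j => (b j).2) h0
    refine Prod.ext (funext fun s => ?_) (funext fun j => Subtype.ext (congrFun h2 j))
    have := congrFun h1 s
    rwa [dif_pos s.2] at this
  have hrange : LinearMap.range F = E n := by
    refine le_antisymm ?_ fun m hm => ?_
    · rintro _ ⟨⟨c, b⟩, rfl⟩
      rw [hF]
      exact Submodule.add_mem _
        (Submodule.sum_mem _ fun s _ => Submodule.smul_mem _ _ (hu s s.2)) (hz b)
    · obtain ⟨c, b, hc, hb, rfl⟩ := h.1 m hm
      refine ⟨(fun s => c s, fun j => ⟨b j, hb j⟩), ?_⟩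
      rw [hF, hext]
      refine congrArg₂ _ (Finset.sum_congr rfl fun s _ => ?_) rfl
      split_ifs with hs
      · rfl
      · rw [hc s hs]
  rw [← hrange, LinearMap.finrank_range_of_inj hinj, Module.finrank_prod, Module.finrank_pi,
    Module.finrank_pi_fintype, Nat.card_eq_fintype_card]
  push_cast
  rfl

/-- The dimension of the part of degree `n` fixed by `e`. -/
def hilb (M : GrMod 𝒜) (n : ℤ) : ℤ := Module.finrank k (S.edeg M n)

/-- The coefficients of the product of `1 - t - ⋯ - t ^ (r + 1)` with the Hilbert series. -/
def eulerCoeff (M : GrMod 𝒜) (n : ℤ) : ℤ :=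
  S.hilb M n - ∑ j : Fin (r + 1), S.hilb M (n - (j + 1))

variable {S} in
theorem IsTame.finite_edeg {M : GrMod 𝒜} (hM : S.IsTame M) (n : ℤ) :
    FiniteDimensional k (S.edeg M n) := by
  have := hM.finite n
  exact Submodule.finiteDimensional_of_le (S.edeg_le M n)

theorem zSum_mem (M : GrMod 𝒜) (n : ℤ) (b : ∀ j : Fin (r + 1), S.edeg M (n - (j + 1))) :
    S.zSum (S.edeg M) n b ∈ S.edeg M n := by
  change ∑ j, S.z j • (b j : M.carrier) ∈ _
  exact Submodule.sum_mem _ fun j _ => S.z_smul_mem j (b j).2.1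

variable {S} in
-- The coefficients vanish below the lower bound trivially, and in regular degrees by the dimension
-- recursion without generators.
theorem IsTame.eulerCoeff_finite {M : GrMod 𝒜} (hM : S.IsTame M) :
    (Function.support (S.eulerCoeff M)).Finite := by
  obtain ⟨b, hb⟩ := hM.bounded
  obtain ⟨n₀, hn₀⟩ := hM.regular
  refine (Set.finite_Ico b n₀).subset fun n hn => ?_
  by_contra hcon
  refine hn ?_
  by_cases h1 : n < b
  · have h0 : ∀ i < b, S.hilb M i = 0 := fun i hi => by
      have h2 : S.edeg M i = ⊥ := eq_bot_iff.2 ((S.edeg_le M i).trans (hb i hi).le)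
      rw [hilb, h2]
      simp
    rw [eulerCoeff, h0 n h1, Finset.sum_eq_zero fun j _ => h0 _ (by lia), sub_zero]
  · have h2 : n₀ ≤ n := by
      by_contra h3
      exact hcon ⟨not_lt.1 h1, not_le.1 h3⟩
    have := S.finrank_eq_of_hasDecompAt (S.hasDecompAt_of_isRegularAt (hn₀ n h2)) hM.finite_edeg
      (fun s => s.elim0) (S.zSum_mem M n)
    rw [eulerCoeff, hilb, this]
    simp [hilb]

theorem eulerCoeff_self (n : ℤ) :
    S.eulerCoeff (GrMod.self 𝒜) n = Nat.card {j : Fin (r + 1) // (j : ℤ) = n} := by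
  have := S.finrank_eq_of_hasDecompAt (S.hasDecompAt_self n) S.isTame_self.finite_edeg
    (fun j hj => ⟨hj ▸ S.v_σ_mem j, S.e_mul_v_σ j⟩) (S.zSum_mem _ n)
  rw [eulerCoeff, hilb, this]
  simp [hilb]

/-- Taking the part of degree `n` fixed by `e` is exact, because preimages can be projected to
degree `n` and multiplied by `e`. -/
theorem hilb_shortExact {K M N : GrMod 𝒜} (i : K ⟶ M) (g : M ⟶ N)
    (hi : Function.Injective i.toLin) (hg : Function.Surjective g.toLin)
    (hig : LinearMap.range i.toLin = LinearMap.ker g.toLin) (hM : S.IsTame M) (n : ℤ) :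
    S.hilb M n = S.hilb K n + S.hilb N n := by
  have := hM.finite_edeg n
  let i' : S.edeg K n →ₗ[k] S.edeg M n :=
    (i.toLin.restrictScalars k).restrict fun m hm => S.map_mem_edeg i hm
  let g' : S.edeg M n →ₗ[k] S.edeg N n :=
    (g.toLin.restrictScalars k).restrict fun m hm => S.map_mem_edeg g hm
  have hi' : Function.Injective i' := fun a b h => Subtype.ext (hi (congrArg Subtype.val h))
  have hg' : LinearMap.range g' = ⊤ := LinearMap.range_eq_top.2 fun y => by
    obtain ⟨m, hm, h⟩ := S.exists_preimage_mem_edeg g y.2 (hg y)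
    exact ⟨⟨m, hm⟩, Subtype.ext h⟩
  have hker : LinearMap.ker g' = LinearMap.range i' := by
    ext m
    constructor
    · intro hm
      have h1 : (m : M.carrier) ∈ LinearMap.range i.toLin := by
        rw [hig]
        exact congrArg Subtype.val hm
      obtain ⟨a, ha, h⟩ := S.exists_preimage_mem_edeg i m.2 h1
      exact ⟨⟨a, ha⟩, Subtype.ext h⟩
    · rintro ⟨a, rfl⟩
      have h1 : i.toLin a ∈ LinearMap.ker g.toLin := hig ▸ ⟨a, rfl⟩
      exact Subtype.ext h1
  have h := g'.finrank_range_add_finrank_ker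
  rw [hg', finrank_top, hker, LinearMap.finrank_range_of_inj hi'] at h
  rw [hilb, hilb, hilb, ← h]
  push_cast
  ring

theorem eulerCoeff_shortExact {K M N : GrMod 𝒜} (i : K ⟶ M) (g : M ⟶ N)
    (hi : Function.Injective i.toLin) (hg : Function.Surjective g.toLin)
    (hig : LinearMap.range i.toLin = LinearMap.ker g.toLin) (hM : S.IsTame M) (n : ℤ) :
    S.eulerCoeff M n = S.eulerCoeff K n + S.eulerCoeff N n := by
  simp only [eulerCoeff, S.hilb_shortExact i g hi hg hig hM, Finset.sum_add_distrib]
  ring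

/-! ### The Euler characteristic as a Laurent polynomial -/

theorem hilb_finite {M : GrMod 𝒜} (hM : FiniteDimensional k M.carrier) :
    (Function.support (S.hilb M)).Finite := by
  have h1 := WellFoundedGT.finite_ne_bot_of_iSupIndep M.isInternal.submodule_iSupIndep
  refine h1.subset fun n hn h0 => hn ?_
  have h2 : S.edeg M n = ⊥ := eq_bot_iff.2 ((S.edeg_le M n).trans h0.le)
  rw [hilb, h2]
  simp

/-- `1 - t - ⋯ - t ^ (r + 1)`. -/
def _root_.charPoly (r : ℕ) : ℤ[T;T⁻¹] :=
  1 - ∑ i ∈ Finset.range (r + 1), LaurentPolynomial.T ((i : ℤ) + 1)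

theorem _root_.LaurentPolynomial.coeff_T_mul (m n : ℤ) (f : ℤ[T;T⁻¹]) :
    (LaurentPolynomial.T m * f).coeff n = f.coeff (n - m) := by
  have := AddMonoidAlgebra.coeff_single_mul_add f (1 : ℤ) m (n - m)
  rw [add_sub_cancel, one_mul] at this
  exact this

theorem _root_.coeff_charPoly_mul (f : ℤ[T;T⁻¹]) (n : ℤ) :
    (charPoly r * f).coeff n = f.coeff n - ∑ j : Fin (r + 1), f.coeff (n - (j + 1)) := by
  rw [charPoly, sub_mul, one_mul, Finset.sum_mul, Finset.sum_range, AddMonoidAlgebra.coeff_sub,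
    AddMonoidAlgebra.coeff_sum, Finsupp.sub_apply, Finsupp.finsetSum_apply]
  simp only [LaurentPolynomial.coeff_T_mul]

/-- The Laurent polynomial with prescribed coefficients. -/
def _root_.LaurentPolynomial.ofFinite (c : ℤ → ℤ) (hc : (Function.support c).Finite) :
    ℤ[T;T⁻¹] :=
  .ofCoeff (Finsupp.ofSupportFinite c hc)

/-- The Euler characteristic of a finitely presented graded module: the product of its Hilbert
series with `1 - t - ⋯ - t ^ (r + 1)`. -/
def euler (M : FpGrMod 𝒜) : ℤ[T;T⁻¹] :=
  LaurentPolynomial.ofFinite (S.eulerCoeff M.obj)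
    ((S.isTame_iff M.obj).2 M.property).eulerCoeff_finite

theorem coeff_euler (M : FpGrMod 𝒜) (n : ℤ) : (S.euler M).coeff n = S.eulerCoeff M.obj n := rfl

/-- For a finite dimensional module the Hilbert series is itself a Laurent polynomial, and it is the
cofactor of `charPoly r`. -/
theorem euler_mem_of_fdim {M : FpGrMod 𝒜} (hM : fdim 𝒜 M) :
    S.euler M ∈ Ideal.span {charPoly r} := by
  rw [Ideal.mem_span_singleton]
  refine ⟨LaurentPolynomial.ofFinite (S.hilb M.obj) (S.hilb_finite hM), ?_⟩
  ext n
  rw [coeff_charPoly_mul]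
  rfl

theorem euler_shift (M : FpGrMod 𝒜) :
    S.euler ((FpGrMod.shift 𝒜 (-1)).obj M) = LaurentPolynomial.T 1 * S.euler M := by
  ext n
  rw [LaurentPolynomial.coeff_T_mul, coeff_euler, coeff_euler]
  have h : ∀ n, S.hilb ((FpGrMod.shift 𝒜 (-1)).obj M).obj n = S.hilb M.obj (n - 1) := fun n => by
    rw [← neg_add_eq_sub]
    rfl
  simp only [eulerCoeff, h]
  congr 1
  refine Finset.sum_congr rfl fun j _ => ?_
  congr 1
  ring

theorem euler_self : S.euler (FpGrMod.self 𝒜) =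
    ∑ i ∈ Finset.range (r + 1), LaurentPolynomial.T (i : ℤ) := by
  classical
  ext n
  rw [coeff_euler, Finset.sum_range, AddMonoidAlgebra.coeff_sum, Finsupp.finsetSum_apply]
  refine (S.eulerCoeff_self n).trans ?_
  simp only [LaurentPolynomial.T_apply, Finset.sum_boole, Nat.card_eq_fintype_card,
    Fintype.card_subtype]

end PrefixSystem

/-! ## The Grothendieck group of `qgr A` -/

namespace Qgr

open LaurentPolynomial (T)

section

variable {k A : Type u} [Field k] [Ring A] [Algebra k A]
variable {𝒜 : ℤ → Submodule k A} [GradedAlgebra 𝒜]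

theorem T_one_smul (F : Qgr 𝒜) :
    (T 1 : ℤ[T;T⁻¹]) • K0.of F = K0.of ((twist 𝒜 (-1)).obj F) := by
  have h : K0.laurentHom (twist 𝒜 (-1)) (T 1) = K0.map (twist 𝒜 (-1)) := by
    refine (AddMonoidAlgebra.lift_single _ _ _).trans ?_
    rw [one_smul]
    simp
    rfl
  change K0.laurentHom (twist 𝒜 (-1)) (T 1) (K0.of F) = _
  rw [h]
  exact K0.map_of _ _

theorem T_one_smul_cls (M : FpGrMod 𝒜) :
    (T 1 : ℤ[T;T⁻¹]) • cls M = cls ((FpGrMod.shift 𝒜 (-1)).obj M) := by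
  rw [cls, T_one_smul]
  exact congrArg K0.of (Functor.congr_obj (quotientFunctor_comp_twist 𝒜 (-1)) M)

theorem cls_eq_of_bijective {M N : FpGrMod 𝒜} (f : M ⟶ N)
    (hf : Function.Bijective f.hom.toLin) : cls M = cls N := by
  refine cls_eq_of_isoModFdim f ⟨?_, ?_⟩
  · rw [(LinearMap.ker_eq_bot (f := f.hom.toLin.restrictScalars k)).2 hf.1]
    infer_instance
  · rw [(LinearMap.range_eq_top (f := f.hom.toLin.restrictScalars k)).2 hf.2]
    infer_instance

theorem cls_shift_zero (M : FpGrMod 𝒜) : cls ((FpGrMod.shift 𝒜 0).obj M) = cls M :=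
  cls_eq_of_bijective (ObjectProperty.homMk ⟨LinearMap.id, fun i m (hm : m ∈ M.obj.deg (0 + i)) => by
    rwa [zero_add] at hm⟩) Function.bijective_id

theorem cls_shift_shift (M : FpGrMod 𝒜) {a b c : ℤ} (h : a + b = c) :
    cls ((FpGrMod.shift 𝒜 b).obj ((FpGrMod.shift 𝒜 a).obj M)) =
      cls ((FpGrMod.shift 𝒜 c).obj M) :=
  cls_eq_of_bijective (ObjectProperty.homMk ⟨LinearMap.id,
    fun i m (hm : m ∈ M.obj.deg (a + (b + i))) => by
      rw [← add_assoc, h] at hm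
      exact hm⟩) Function.bijective_id

theorem cls_shift_neg (M : FpGrMod 𝒜) (n : ℤ) :
    cls ((FpGrMod.shift 𝒜 (-n)).obj M) = (T n : ℤ[T;T⁻¹]) • cls M := by
  induction n using Int.induction_on with
  | zero => rw [LaurentPolynomial.T_zero, one_smul, neg_zero, cls_shift_zero]
  | succ n ih =>
    rw [add_comm, LaurentPolynomial.T_add, mul_smul, ← ih, T_one_smul_cls,
      cls_shift_shift M (c := -(1 + n)) (by ring)]
  | pred n ih =>
    have h : (T (-n : ℤ) : ℤ[T;T⁻¹]) = T 1 * T (-n - 1 : ℤ) := by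
      rw [← LaurentPolynomial.T_add]
      congr 1
      ring
    rw [← cls_shift_shift M (a := -(-n - 1 : ℤ)) (b := -1) (by ring), ← T_one_smul_cls, h,
      mul_smul] at ih
    -- Both sides of the claim agree after multiplication by the unit `T 1`.
    have h1 : IsUnit (T 1 : ℤ[T;T⁻¹]) := LaurentPolynomial.isUnit_T 1
    exact h1.smul_left_cancel.1 ih

variable [(isFinitelyPresented 𝒜).IsClosedUnderKernels]

/-- Induction on the index set: one generator is split off by a short exact sequence. -/
theorem cls_free {ι : Type} [Fintype ι] (d : ι → ℤ) :
    cls (FpGrMod.free 𝒜 d) = (∑ s, T (d s) : ℤ[T;T⁻¹]) • K0.of (structureSheaf 𝒜) := by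
  classical
  refine Fintype.induction_empty_option (P := fun ι _ => ∀ d : ι → ℤ, cls (FpGrMod.free 𝒜 d) =
    (∑ s, T (d s) : ℤ[T;T⁻¹]) • K0.of (structureSheaf 𝒜)) ?_ ?_ ?_ ι d
  · intro α β _ e ih d
    let := Fintype.ofEquiv β e.symm
    have h : cls (FpGrMod.free 𝒜 d) = cls (FpGrMod.free 𝒜 (d ∘ e)) :=
      cls_eq_of_bijective (ObjectProperty.homMk ⟨LinearMap.funLeft A A e,
        fun i m hm s _ => hm (e s) trivial⟩)
        ⟨LinearMap.funLeft_injective_of_surjective _ _ _ e.surjective,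
          LinearMap.funLeft_surjective_of_injective _ _ _ e.injective⟩
    rw [h, ih, ← e.sum_comp]
    rfl
  · intro d
    rw [Finset.univ_eq_empty, Finset.sum_empty, zero_smul]
    let F := FpGrMod.free 𝒜 d
    have : Subsingleton F.obj.carrier := inferInstanceAs (Subsingleton (PEmpty → A))
    -- For the zero module, the sequence `F ⟶ F ⟶ F` gives `[F] = [F] + [F]`.
    have h := cls_shortExact (S := ShortComplex.mk (𝟙 F) (𝟙 F)
      (by ext : 1; exact GrMod.hom_ext (LinearMap.ext fun _ => Subsingleton.elim _ _)))
      ((FpGrMod.shortExact_iff _).2 ⟨Function.injective_id, Function.surjective_id,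
        Subsingleton.elim _ _⟩)
    exact left_eq_add.1 h
  · intro α _ ih d
    let i : (FpGrMod.shift 𝒜 (-d none)).obj (FpGrMod.self 𝒜) ⟶ FpGrMod.free 𝒜 d :=
      ObjectProperty.homMk ⟨LinearMap.single A (fun _ : Option α => A) none, fun n m hm s _ => by
        cases s with
        | none => exact hm
        | some s => exact Submodule.zero_mem _⟩
    let g : FpGrMod.free 𝒜 d ⟶ FpGrMod.free 𝒜 (d ∘ some) :=
      ObjectProperty.homMk ⟨LinearMap.funLeft A A some, fun n m hm s _ => hm (some s) trivial⟩
    have hig : ∀ a : A, (LinearMap.funLeft A A some)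
        (LinearMap.single A (fun _ : Option α => A) none a) = 0 := fun a => by
      ext s
      simp [LinearMap.funLeft_apply]
    have h := cls_shortExact (S := ShortComplex.mk i g
      (by ext : 1; exact GrMod.hom_ext (LinearMap.ext hig)))
      ((FpGrMod.shortExact_iff _).2 ⟨fun a b hab =>
          Pi.single_injective (M := fun _ : Option α => A) none hab,
        LinearMap.funLeft_surjective_of_injective _ _ _ (Option.some_injective _), ?_⟩)
    · rw [Fintype.sum_option, add_smul]
      refine h.trans (congrArg₂ _ (cls_shift_neg _ _) (ih _))
    · refine le_antisymm ?_ fun m hm => ?_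
      · rintro _ ⟨a, rfl⟩
        exact hig a
      · refine ⟨m none, funext fun s => ?_⟩
        cases s with
        | none => exact Pi.single_eq_same (M := fun _ : Option α => A) none (m none)
        | some s => exact (congrFun hm s).symm

end

end Qgr

/-- The integers act through the additive structure and `T 1` is invertible, so compatibility with
`T 1` gives compatibility with all `T n`. -/
theorem LaurentPolynomial.map_smul_of_T_one {V W : Type*} [AddCommGroup V] [AddCommGroup W]
    [Module ℤ[T;T⁻¹] V] [Module ℤ[T;T⁻¹] W] (φ : V →+ W)
    (h : ∀ a, φ ((T 1 : ℤ[T;T⁻¹]) • a) = (T 1 : ℤ[T;T⁻¹]) • φ a) (p : ℤ[T;T⁻¹]) (a : V) :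
    φ (p • a) = p • φ a := by
  have hT : ∀ (n : ℤ) (a : V), φ ((T n : ℤ[T;T⁻¹]) • a) = (T n : ℤ[T;T⁻¹]) • φ a := by
    intro n
    induction n using Int.induction_on with
    | zero => simp
    | succ n ih =>
      intro a
      rw [T_add, mul_smul, ih, h, ← mul_smul]
    | pred n ih =>
      intro a
      have h1 : IsUnit (T 1 : ℤ[T;T⁻¹]) := isUnit_T 1
      rw [← h1.smul_left_cancel, ← h, ← mul_smul, ← mul_smul, ← T_add,
        show (1 + (-n - 1) : ℤ) = -n by ring, ih]
  induction p using LaurentPolynomial.induction_on' with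
  | add p q hp hq => rw [add_smul, add_smul, map_add, hp, hq]
  | C_mul_T n c =>
    have hc : (C c : ℤ[T;T⁻¹]) = (c : ℤ[T;T⁻¹]) := by simp
    rw [hc, mul_smul, mul_smul, Int.cast_smul_eq_zsmul, Int.cast_smul_eq_zsmul, map_zsmul, hT]

/-! ### Generator and relation of the Grothendieck group -/

namespace PrefixSystem

open LaurentPolynomial (T)

variable {k A : Type u} [Field k] [Ring A] [Algebra k A]
variable {𝒜 : ℤ → Submodule k A} [GradedAlgebra 𝒜] {r : ℕ}

/-- The comparison with free modules, applied to `A` and the generators `v (σ j)` of degree `j`,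
gives `𝒪 ≅ ⨁ j, 𝒪(-j-1)` in `qgr A`. -/
theorem charPoly_smul_structureSheaf (S : PrefixSystem 𝒜 r) :
    charPoly r • K0.of (Qgr.structureSheaf 𝒜) = 0 := by
  have := S.isClosedUnderKernels
  have h := Qgr.cls_eq_of_isoModFdim _ (S.isoModFdim_freeHom (M := FpGrMod.self 𝒜)
    (d := fun j : Fin (r + 1) => (j : ℤ)) (u := fun j => S.v (S.σ j))
    (E := S.edeg (GrMod.self 𝒜)) (n₀ := 0) (fun j => ⟨S.v_σ_mem j, S.e_mul_v_σ j⟩)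
    (fun j => by simp) (fun j => S.v_σ_mem j)
    (fun n hn => eq_bot_iff.2 ((S.edeg_le _ n).trans (S.deg_neg n hn).le))
    (fun n _ => rfl) fun n _ => S.hasDecompAt_self n)
  rw [Qgr.cls_free] at h
  rw [charPoly, sub_smul, one_smul, Finset.sum_range, sub_eq_zero]
  exact h.symm

theorem exists_eq_smul_structureSheaf (S : PrefixSystem 𝒜 r) (z : K0 (Qgr 𝒜)) :
    ∃ p : ℤ[T;T⁻¹], p • K0.of (Qgr.structureSheaf 𝒜) = z := by
  have := S.isClosedUnderKernels
  refine Submodule.mem_span_singleton.1 (Qgr.cls_surjOn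
    (Submodule.span ℤ[T;T⁻¹] {K0.of (Qgr.structureSheaf 𝒜)}).toAddSubgroup (fun M => ?_) z)
  obtain ⟨ι, _, d, f, hf⟩ := S.exists_free_isoModFdim M
  rw [← Qgr.cls_eq_of_isoModFdim f hf, Qgr.cls_free]
  exact Submodule.smul_mem _ _ (Submodule.mem_span_singleton_self _)

/-- The Euler characteristic modulo `charPoly r` is additive and vanishes on finite dimensional
modules. Linearity reduces to the action of `T 1` on classes of modules, that is, to `euler_shift`.
-/
theorem exists_k0_hom (S : PrefixSystem 𝒜 r) :
    ∃ φ : K0 (Qgr 𝒜) →ₗ[ℤ[T;T⁻¹]] ℤ[T;T⁻¹] ⧸ Ideal.span {charPoly r},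
      ∀ M, φ (Qgr.cls M) = Ideal.Quotient.mk _ (S.euler M) := by
  have := S.isClosedUnderKernels
  have hχ : IsAdditiveFunction fun M : FpGrMod 𝒜 =>
      Ideal.Quotient.mk (Ideal.span {charPoly r}) (S.euler M) := by
    intro X hX
    obtain ⟨h1, h2, h3⟩ := (FpGrMod.shortExact_iff X).1 hX
    refine Eq.trans (congrArg _ ?_) (map_add _ _ _)
    ext n
    exact S.eulerCoeff_shortExact _ _ h1 h2 h3 ((S.isTame_iff _).2 X.X₂.property) n
  obtain ⟨φ, hφ⟩ := hχ.exists_lift (Qgr.quotientFunctor 𝒜) (fdim 𝒜)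
    fun M hM => Ideal.Quotient.eq_zero_iff_mem.2 (S.euler_mem_of_fdim hM)
  have hT : ∀ z, φ ((T 1 : ℤ[T;T⁻¹]) • z) = (T 1 : ℤ[T;T⁻¹]) • φ z := by
    let s : AddSubgroup (K0 (Qgr 𝒜)) :=
      { carrier := {z | φ ((T 1 : ℤ[T;T⁻¹]) • z) = (T 1 : ℤ[T;T⁻¹]) • φ z}
        zero_mem' := by simp
        add_mem' := fun {a b} (ha hb) => by
          simp only [Set.mem_ofPred_eq] at *
          rw [smul_add, map_add, map_add, ha, hb, smul_add]
        neg_mem' := fun {a} ha => by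
          simp only [Set.mem_ofPred_eq] at *
          rw [smul_neg, map_neg, map_neg, ha, smul_neg] }
    refine Qgr.cls_surjOn s fun M => ?_
    change φ _ = _ • φ _
    rw [Qgr.T_one_smul_cls]
    refine (hφ _).trans ?_
    rw [S.euler_shift, Qgr.cls, hφ]
    rfl
  exact ⟨{ φ with map_smul' := LaurentPolynomial.map_smul_of_T_one φ hT }, hφ⟩

/-- The Grothendieck group of `qgr A` is generated by the class of the structure sheaf, subject to
the relation given by `1 - t - ⋯ - t ^ (r + 1)`. -/
theorem exists_k0_equiv (S : PrefixSystem 𝒜 r) :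
    ∃ ψ : K0 (Qgr 𝒜) ≃ₗ[ℤ[T;T⁻¹]] ℤ[T;T⁻¹] ⧸ Ideal.span {charPoly r},
      ψ (K0.of (Qgr.structureSheaf 𝒜)) = 1 := by
  obtain ⟨φ, hφ⟩ := S.exists_k0_hom
  -- `φ` sends `[𝒪]` to `1 + t + ⋯ + t^r`, which becomes `1` modulo `charPoly r` after
  -- multiplication by `t`.
  let ψ := (T 1 : ℤ[T;T⁻¹]) • φ
  have h1 : ψ (K0.of (Qgr.structureSheaf 𝒜)) = 1 := by
    change (T 1 : ℤ[T;T⁻¹]) • φ (Qgr.cls (FpGrMod.self 𝒜)) = 1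
    rw [hφ, S.euler_self]
    change Ideal.Quotient.mk _ (T 1 * _) = Ideal.Quotient.mk _ 1
    rw [Ideal.Quotient.eq, ← neg_mem_iff, neg_sub, Finset.mul_sum]
    refine Ideal.mem_span_singleton.2 ⟨1, ?_⟩
    rw [mul_one, charPoly]
    congr 1
    exact Finset.sum_congr rfl fun i _ => by rw [← LaurentPolynomial.T_add, add_comm]
  have h2 : ∀ p : ℤ[T;T⁻¹], ψ (p • K0.of (Qgr.structureSheaf 𝒜)) = Ideal.Quotient.mk _ p :=
    fun p => by
      rw [map_smul, h1]
      change Ideal.Quotient.mk _ (p * 1) = _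
      rw [mul_one]
  refine ⟨LinearEquiv.ofBijective ψ ⟨?_, ?_⟩, h1⟩
  · rw [← LinearMap.ker_eq_bot, LinearMap.ker_eq_bot']
    intro z hz
    obtain ⟨p, rfl⟩ := S.exists_eq_smul_structureSheaf z
    rw [h2, Ideal.Quotient.eq_zero_iff_mem] at hz
    obtain ⟨q, rfl⟩ := Ideal.mem_span_singleton.1 hz
    rw [mul_comm, mul_smul, S.charPoly_smul_structureSheaf, smul_zero]
  · intro y
    obtain ⟨p, rfl⟩ := Ideal.Quotient.mk_surjective y
    exact ⟨_, h2 p⟩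

end PrefixSystem

/-! ## The algebra `B` -/

namespace BAlgebra

variable (k : Type u) [Field k] {r : ℕ}

/-- The shift of the entries of a vector to the right. -/
def rightShift (r : ℕ) (N : Type*) [AddCommGroup N] [Module k N] :
    Module.End k (Fin (r + 1) → N) where
  toFun c := Fin.cons 0 fun i : Fin r => c i.castSucc
  map_add' a b := by
    ext i
    cases i using Fin.cases <;> simp
  map_smul' t a := by
    ext i
    cases i using Fin.cases <;> simp

section

variable {N : Type*} [AddCommGroup N] [Module k N]

@[simp]
theorem rightShift_zero (c : Fin (r + 1) → N) : rightShift k r N c 0 = 0 := rfl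

@[simp]
theorem rightShift_succ (c : Fin (r + 1) → N) (i : Fin r) :
    rightShift k r N c i.succ = c i.castSucc := rfl

theorem rightShift_pow_apply (n : ℕ) (c : Fin (r + 1) → N) (i : Fin (r + 1)) (h : i < n) :
    (rightShift k r N ^ n) c i = 0 := by
  induction n generalizing i with
  | zero => exact absurd h (Nat.not_lt_zero _)
  | succ n ih =>
    rw [pow_succ', Module.End.mul_apply]
    cases i using Fin.cases with
    | zero => rfl
    | succ i =>
      rw [rightShift_succ]
      exact ih _ (by simpa using h)

theorem rightShift_pow_succ : rightShift k r N ^ (r + 1) = 0 :=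
  LinearMap.ext fun c => funext fun i => rightShift_pow_apply k (r + 1) c i i.2

theorem rightShift_pow_single (n : ℕ) (h : n < r + 1) (a : N) :
    (rightShift k r N ^ n) (Pi.single 0 a) = Pi.single ⟨n, h⟩ a := by
  induction n with
  | zero => rfl
  | succ n ih =>
    rw [pow_succ', Module.End.mul_apply, ih (by lia)]
    ext i
    cases i using Fin.cases with
    | zero => simp [Fin.ext_iff]
    | succ i => simp [Pi.single_apply, Fin.ext_iff]

end

/-! ### Unique decomposition in `B` by an action on coefficients -/

variable (r)

/-- The element `∑ j, (c j • y ^ j + y ^ j * x * b j)`. -/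
def recombine : ((Fin (r + 1) → k) × (Fin (r + 1) → BAlgebra k r)) →ₗ[k] BAlgebra k r where
  toFun p := ∑ j : Fin (r + 1), (p.1 j • gen k r 1 ^ (j : ℕ) +
    gen k r 1 ^ (j : ℕ) * gen k r 0 * p.2 j)
  map_add' a b := by
    rw [← Finset.sum_add_distrib]
    refine Finset.sum_congr rfl fun j _ => ?_
    simp only [Prod.fst_add, Prod.snd_add, Pi.add_apply, add_smul, mul_add]
    abel
  map_smul' t a := by
    simp only [Prod.smul_fst, Prod.smul_snd, Pi.smul_apply, Finset.smul_sum, smul_add, mul_smul_comm,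
      smul_assoc, RingHom.id_apply]

variable {k r} in
theorem recombine_apply (c : Fin (r + 1) → k) (b : Fin (r + 1) → BAlgebra k r) :
    recombine k r (c, b) = ∑ j : Fin (r + 1), (c j • gen k r 1 ^ (j : ℕ) +
      gen k r 1 ^ (j : ℕ) * gen k r 0 * b j) := rfl

/-- The action of `x` in terms of the decomposition of elements. -/
def actX : Module.End k ((Fin (r + 1) → k) × (Fin (r + 1) → BAlgebra k r)) :=
  LinearMap.inr k _ _ ∘ₗ LinearMap.single k (fun _ : Fin (r + 1) => BAlgebra k r) 0 ∘ₗ recombine k r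

/-- The action of `y` in terms of the decomposition of elements. -/
def actY : Module.End k ((Fin (r + 1) → k) × (Fin (r + 1) → BAlgebra k r)) :=
  (rightShift k r k).prodMap (rightShift k r (BAlgebra k r))

theorem actY_pow (n : ℕ) :
    actY k r ^ n = (rightShift k r k ^ n).prodMap (rightShift k r (BAlgebra k r) ^ n) := by
  induction n with
  | zero => rfl
  | succ n ih =>
    rw [pow_succ, ih, pow_succ, pow_succ]
    rfl

/-- The action of `B` on the decompositions of its elements. -/
def act : BAlgebra k r →ₐ[k] Module.End k ((Fin (r + 1) → k) × (Fin (r + 1) → BAlgebra k r)) :=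
  RingQuot.liftAlgHom k ⟨FreeAlgebra.lift k ![actX k r, actY k r], by
    rintro _ _ ⟨⟩
    rw [map_pow, FreeAlgebra.lift_ι_apply, map_zero]
    change actY k r ^ (r + 1) = 0
    rw [actY_pow, rightShift_pow_succ, rightShift_pow_succ]
    rfl⟩

theorem act_gen_zero : act k r (gen k r 0) = actX k r := by simp [act, gen]

theorem act_gen_one : act k r (gen k r 1) = actY k r := by simp [act, gen]

theorem recombine_actX (p : (Fin (r + 1) → k) × (Fin (r + 1) → BAlgebra k r)) :
    recombine k r (actX k r p) = gen k r 0 * recombine k r p := by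
  change recombine k r (0, Pi.single 0 (recombine k r p)) = _
  rw [recombine_apply, Finset.sum_eq_single 0]
  · simp
  · intro j _ hj
    simp [hj]
  · simp

/-- Left multiplication by `y` moves the `j`-th term to place `j + 1`, and the last term dies
because `y ^ (r + 1) = 0`. -/
theorem recombine_actY (p : (Fin (r + 1) → k) × (Fin (r + 1) → BAlgebra k r)) :
    recombine k r (actY k r p) = gen k r 1 * recombine k r p := by
  obtain ⟨c, b⟩ := p
  change recombine k r (rightShift k r k c, rightShift k r _ b) = _
  rw [recombine_apply, recombine_apply, Fin.sum_univ_succ, Fin.sum_univ_castSucc, mul_add,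
    Finset.mul_sum]
  have hlast : gen k r 1 * (c (Fin.last r) • gen k r 1 ^ r +
      gen k r 1 ^ r * gen k r 0 * b (Fin.last r)) = 0 := by
    rw [mul_add, mul_smul_comm, ← mul_assoc, ← mul_assoc, ← pow_succ', gen_pow]
    simp
  simp only [Fin.val_last, hlast, rightShift_zero, rightShift_succ, zero_smul, mul_zero, add_zero,
    zero_add, Fin.val_succ, Fin.val_castSucc]
  refine Finset.sum_congr rfl fun j _ => ?_
  rw [mul_add, mul_smul_comm, ← mul_assoc, ← mul_assoc, ← pow_succ']

theorem recombine_act (a : BAlgebra k r) (p : (Fin (r + 1) → k) × (Fin (r + 1) → BAlgebra k r)) :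
    recombine k r (act k r a p) = a * recombine k r p := by
  obtain ⟨f, rfl⟩ := RingQuot.mkAlgHom_surjective k (BAlgebraRel k r) a
  induction f using FreeAlgebra.induction generalizing p with
  | grade0 t => rw [AlgHom.commutes, AlgHom.commutes, Module.algebraMap_end_apply, map_smul,
      Algebra.smul_def]
  | grade1 i =>
    change recombine k r (act k r (gen k r i) p) = gen k r i * _
    match i with
    | 0 => rw [act_gen_zero, recombine_actX]
    | 1 => rw [act_gen_one, recombine_actY]
  | mul a b ha hb => rw [map_mul, map_mul, Module.End.mul_apply, ha, hb, mul_assoc]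
  | add a b ha hb => rw [map_add, map_add, LinearMap.add_apply, map_add, ha, hb, add_mul]

theorem recombine_act_one (a : BAlgebra k r) :
    recombine k r (act k r a (Pi.single 0 1, 0)) = a := by
  rw [recombine_act, recombine_apply, Finset.sum_eq_single 0]
  · simp
  · intro j _ hj
    simp [hj]
  · simp

/-- Acting on the coefficients of `1` recovers all coefficients: `x * b j` produces `b j` in place
`0`, and `y ^ j` shifts it to place `j`. This gives uniqueness; `recombine_act_one` gives existence.
-/
theorem act_recombine (p : (Fin (r + 1) → k) × (Fin (r + 1) → BAlgebra k r)) :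
    act k r (recombine k r p) (Pi.single 0 1, 0) = p := by
  obtain ⟨c, b⟩ := p
  have h : ∀ j : Fin (r + 1), act k r (c j • gen k r 1 ^ (j : ℕ) +
      gen k r 1 ^ (j : ℕ) * gen k r 0 * b j) (Pi.single 0 1, 0) =
      (Pi.single j (c j), Pi.single j (b j)) := by
    intro j
    have hx : actX k r (act k r (b j) (Pi.single 0 1, 0)) = (0, Pi.single 0 (b j)) := by
      conv_rhs => rw [← recombine_act_one k r (b j)]
      rfl
    rw [map_add, map_smul, map_mul, map_mul, map_pow, act_gen_zero, act_gen_one, actY_pow,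
      LinearMap.add_apply, LinearMap.smul_apply, Module.End.mul_apply, Module.End.mul_apply, hx,
      LinearMap.prodMap_apply, LinearMap.prodMap_apply, map_zero, map_zero,
      rightShift_pow_single k _ j.2, rightShift_pow_single k _ j.2, Prod.smul_mk, Prod.mk_add_mk,
      smul_zero, add_zero, zero_add, ← Pi.single_smul, smul_eq_mul, mul_one]
  rw [recombine_apply, map_sum, LinearMap.sum_apply, Finset.sum_congr rfl fun j _ => h j]
  refine Prod.ext ?_ ?_
  · rw [Prod.fst_sum]
    exact Finset.univ_sum_single c
  · rw [Prod.snd_sum]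
    exact Finset.univ_sum_single b

/-- Every element of `B` is uniquely of the form `∑ j, (c j • y ^ j + y ^ j * x * b j)`. -/
def prefixSystem : PrefixSystem (grading k r) r where
  e := 1
  x := gen k r 0
  J := Fin (r + 1)
  v j := gen k r 1 ^ (j : ℕ)
  δ j := j
  σ := id
  e_mem := SetLike.one_mem_graded _
  e_mul_e := one_mul 1
  x_mem := gen_mem_grading k r 0
  v_mem j := by simpa using SetLike.pow_mem_graded (j : ℕ) (gen_mem_grading k r 1)
  σ_injective := Function.injective_id
  δ_σ _ := rfl
  e_mul_v_σ _ := one_mul _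
  e_mul_v l hl := absurd ⟨l, rfl⟩ hl
  finite_deg n := by
    refine FiniteDimensional.span_of_finite k (((List.finite_length_eq (Fin 2) n.toNat).image
      fun w => (w.map (gen k r)).prod).subset ?_)
    rintro _ ⟨w, rfl, rfl⟩
    exact ⟨w, rfl, rfl⟩
  deg_neg n hn := by
    rw [grading, Submodule.span_eq_bot]
    rintro _ ⟨w, rfl, rfl⟩
    lia
  exists_decomp a := ⟨_, _, fun _ => one_mul _, (recombine_act_one k r a).symm⟩
  decomp_unique c b _ h := by
    have h1 := act_recombine k r (c, b)
    rw [recombine_apply, h, map_zero] at h1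
    exact ⟨(congrArg Prod.fst h1).symm, (congrArg Prod.snd h1).symm⟩

end BAlgebra

/-! ## The path algebra of `Q` -/

namespace QVertex

variable {r : ℕ}

/-- The vertex with number `n`, counted from zero. -/
def vtx (n : ℕ) (h : n < r + 1) : QVertex r := (⟨n, h⟩ : Fin (r + 1))

/-- The first vertex. -/
def first (r : ℕ) : QVertex r := vtx 0 r.succ_pos

/-- The arrow to the first vertex. -/
def xArrow (i : QVertex r) : i ⟶ first r := Arrow.x i

/-- The arrow to the next vertex. -/
def yArrow (n : ℕ) (h : n + 1 < r + 1) : vtx n (Nat.lt_of_succ_lt h) ⟶ vtx (n + 1) h :=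
  Arrow.y ⟨n, Nat.lt_of_succ_lt_succ h⟩

theorem arrow_cases {motive : ∀ b c : QVertex r, (b ⟶ c) → Prop}
    (x : ∀ i, motive _ _ (xArrow i)) (y : ∀ n h, motive _ _ (yArrow n h)) {b c : QVertex r}
    (a : b ⟶ c) : motive b c a := by
  obtain _ | ⟨⟨n, h⟩⟩ := a
  · exact x _
  · exact y n (Nat.succ_lt_succ h)

theorem vtx_inj {m n : ℕ} {hm : m < r + 1} {hn : n < r + 1} : vtx m hm = vtx n hn ↔ m = n :=
  Fin.mk.injEq _ _ _ _ |>.to_iff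

/-- The path with `n` arrows `y` that starts in the vertex with number `i`. -/
def yPath (i : ℕ) (hi : i < r + 1) :
    ∀ (n : ℕ) (h : i + n < r + 1), Quiver.Path (vtx i hi) (vtx (i + n) h)
  | 0, _ => Quiver.Path.nil
  | n + 1, h => (yPath i hi n (Nat.lt_of_succ_lt h)).cons (yArrow (i + n) h)

theorem length_yPath (i : ℕ) (hi : i < r + 1) (n : ℕ) (h : i + n < r + 1) :
    (yPath i hi n h).length = n := by
  induction n with
  | zero => rfl
  | succ n ih => rw [yPath, Quiver.Path.length_cons, ih]

/-- The effect of an arrow at the end of a path on the first arrow `x` of this path. -/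
def splitStep {b c : QVertex r} (a : b ⟶ c) :
    Option (QVertex r × Quiver.Path (first r) b) → Option (QVertex r × Quiver.Path (first r) c)
  | some (m, q) => some (m, q.cons a)
  | none => match b, c, a with
    | _, _, Arrow.x i => some (i, Quiver.Path.nil)
    | _, _, Arrow.y _ => none

/-- The source of the first arrow `x` in a path and the part of the path after this arrow. -/
def split {i : QVertex r} : ∀ {m : QVertex r}, Quiver.Path i m →
    Option (QVertex r × Quiver.Path (first r) m)
  | _, Quiver.Path.nil => none
  | _, Quiver.Path.cons p a => splitStep a (split p)

theorem split_yPath (i : ℕ) (hi : i < r + 1) (n : ℕ) (h : i + n < r + 1) :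
    split (yPath i hi n h) = none := by
  induction n with
  | zero => rfl
  | succ n ih =>
    rw [yPath, split, ih]
    rfl

/-- Paths grow at their end, so the induction is on `q`: once an arrow `x` has been found, further
arrows only lengthen the remainder. -/
theorem split_comp {i m m' : QVertex r} {p : Quiver.Path i m} (hp : split p = none)
    (q : Quiver.Path (first r) m') : split ((p.cons (xArrow m)).comp q) = some (m, q) := by
  induction q with
  | nil =>
    rw [Quiver.Path.comp_nil, split, hp]
    rfl
  | cons q a ih =>
    rw [Quiver.Path.comp_cons, split, ih]
    rfl

/-- The pairs of a vertex and of the length of a path of arrows `y` that starts there. -/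
abbrev YIndex (r : ℕ) : Type := {l : Fin (r + 1) × Fin (r + 1) // (l.1 + l.2 : ℕ) < r + 1}

namespace YIndex

/-- The source of the path of arrows `y`. -/
def source (l : YIndex r) : QVertex r := vtx l.1.1 l.1.1.2

/-- The target of the path of arrows `y`. -/
def target (l : YIndex r) : QVertex r := vtx (l.1.1 + l.1.2) l.2

/-- The path of arrows `y`. -/
def path (l : YIndex r) : Quiver.Path l.source l.target := yPath _ _ _ _

theorem split_path (l : YIndex r) : split l.path = none := split_yPath _ _ _ _

/-- An arrow `y` raises the vertex number by one, so the endpoints determine the length. -/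
theorem ext_source_target {l l' : YIndex r} (h : l.source = l'.source)
    (h' : l.target = l'.target) : l = l' := by
  have h1 := vtx_inj.1 h
  have h2 := vtx_inj.1 h'
  refine Subtype.ext (Prod.ext (Fin.ext h1) (Fin.ext ?_))
  lia

end YIndex

end QVertex

/-! ### Unique decomposition in the path algebra -/

namespace PathAlgebra

open QVertex

variable (k : Type u) [Field k] (r : ℕ)

/-- The idempotent of the first vertex. -/
def firstIdem : PathAlgebra k (QVertex r) := path k ⟨first r, first r, Quiver.Path.nil⟩

/-- The sum of the arrows `x`. -/
def xSum : PathAlgebra k (QVertex r) := ∑ i : QVertex r, path k ⟨i, first r, (xArrow i).toPath⟩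

variable {r}

/-- The path of arrows `y` with a given index. -/
def yElem (l : YIndex r) : PathAlgebra k (QVertex r) := path k ⟨l.source, l.target, l.path⟩

theorem path_mul_xSum {i m : QVertex r} (p : Quiver.Path i m) :
    path k ⟨i, m, p⟩ * xSum k r = path k ⟨i, first r, p.cons (xArrow m)⟩ := by
  rw [xSum, Finset.mul_sum, Finset.sum_eq_single m]
  · exact path_mul_path_comp k _ _
  · intro j _ hj
    exact path_mul_path_of_ne k _ _ hj.symm
  · simp

theorem xSum_mul_firstIdem : xSum k r * firstIdem k r = xSum k r := by
  rw [xSum, Finset.sum_mul]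
  exact Finset.sum_congr rfl fun i _ => path_mul_path_comp k _ _

theorem firstIdem_mul_path {m : QVertex r} (p : Quiver.Path (first r) m) :
    firstIdem k r * path k ⟨first r, m, p⟩ = path k ⟨first r, m, p⟩ := by
  rw [firstIdem, path_mul_path_comp, Quiver.Path.nil_comp]

theorem path_cons {i b c : QVertex r} (p : Quiver.Path i b) (a : b ⟶ c) :
    path k ⟨i, c, p.cons a⟩ = path k ⟨i, b, p⟩ * path k ⟨b, c, a.toPath⟩ :=
  (path_mul_path_comp k p a.toPath).symm

variable (r) in
/-- The elements that have a decomposition with respect to the paths of arrows `y`. -/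
def decomposable : Submodule k (PathAlgebra k (QVertex r)) where
  carrier := {a | ∃ (c : YIndex r → k) (b : YIndex r → PathAlgebra k (QVertex r)),
    (∀ l, firstIdem k r * b l = b l) ∧ a = ∑ l, (c l • yElem k l + yElem k l * xSum k r * b l)}
  zero_mem' := ⟨0, 0, by simp, by simp⟩
  add_mem' := by
    rintro _ _ ⟨c, b, hb, rfl⟩ ⟨c', b', hb', rfl⟩
    refine ⟨c + c', b + b', fun l => by simp [mul_add, hb, hb'], ?_⟩
    rw [← Finset.sum_add_distrib]
    refine Finset.sum_congr rfl fun l _ => ?_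
    simp only [Pi.add_apply, add_smul, mul_add]
    abel
  smul_mem' := by
    rintro t _ ⟨c, b, hb, rfl⟩
    refine ⟨t • c, t • b, fun l => by simp [hb], ?_⟩
    rw [Finset.smul_sum]
    refine Finset.sum_congr rfl fun l _ => ?_
    simp only [Pi.smul_apply, smul_add, mul_smul_comm, smul_assoc]

theorem yElem_mem_decomposable (l : YIndex r) : yElem k l ∈ decomposable k r := by
  classical
  refine ⟨Pi.single l 1, 0, by simp, ?_⟩
  rw [Finset.sum_eq_single l]
  · simp
  · intro l' _ h
    simp [h]
  · simp

theorem yElem_mul_mem_decomposable (l : YIndex r) {b : PathAlgebra k (QVertex r)}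
    (hb : firstIdem k r * b = b) : yElem k l * xSum k r * b ∈ decomposable k r := by
  classical
  refine ⟨0, Pi.single l b, fun l' => ?_, ?_⟩
  · by_cases h : l' = l
    · subst h
      simpa using hb
    · simp [h]
  · rw [Finset.sum_eq_single l]
    · simp
    · intro l' _ h
      simp [h]
    · simp

/-- If the arrow is composable, an arrow `x` gives a term with `b = e`, since `x * e = x`, and an
arrow `y` gives a longer path of arrows `y`. -/
theorem yElem_mul_arrow_mem_decomposable (l : YIndex r) {b c : QVertex r} (a : b ⟶ c) :
    yElem k l * path k ⟨b, c, a.toPath⟩ ∈ decomposable k r := by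
  by_cases h : l.target = b
  · induction a using arrow_cases with
    | x i =>
      subst h
      have : yElem k l * path k ⟨l.target, first r, (xArrow l.target).toPath⟩ =
          yElem k l * xSum k r * firstIdem k r := by
        rw [mul_assoc, xSum_mul_firstIdem, yElem, path_mul_xSum, path_cons]
      rw [this]
      exact yElem_mul_mem_decomposable k l (firstIdem_mul_path k _)
    | y n hn =>
      obtain rfl := vtx_inj.1 h
      have : yElem k l * path k ⟨_, _, (yArrow (l.1.1 + l.1.2) hn).toPath⟩ =
          yElem k ⟨(l.1.1, ⟨l.1.2 + 1, by lia⟩), hn⟩ :=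
        (path_cons k _ _).symm
      exact this ▸ yElem_mem_decomposable k _
  · rw [yElem, path_mul_path_of_ne k _ _ h]
    exact Submodule.zero_mem _

theorem mul_arrow_mem_decomposable {s : PathAlgebra k (QVertex r)} (hs : s ∈ decomposable k r)
    {b c : QVertex r} (a : b ⟶ c) : s * path k ⟨b, c, a.toPath⟩ ∈ decomposable k r := by
  obtain ⟨t, d, hd, rfl⟩ := hs
  rw [Finset.sum_mul]
  refine Submodule.sum_mem _ fun l _ => ?_
  rw [add_mul, smul_mul_assoc, mul_assoc _ (d l)]
  refine Submodule.add_mem _ (Submodule.smul_mem _ _ (yElem_mul_arrow_mem_decomposable k l a))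
    (yElem_mul_mem_decomposable k l ?_)
  rw [← mul_assoc, hd]

theorem path_mem_decomposable {i m : QVertex r} (p : Quiver.Path i m) :
    path k ⟨i, m, p⟩ ∈ decomposable k r := by
  induction p with
  | nil => exact yElem_mem_decomposable k ⟨(i, 0), i.2⟩
  | cons p a ih =>
    rw [path_cons]
    exact mul_arrow_mem_decomposable k ih a

theorem mem_decomposable (a : PathAlgebra k (QVertex r)) : a ∈ decomposable k r := by
  have h : (decomposable k r).mkQ = 0 := lhom_ext fun ⟨_, _, p⟩ => by
    simpa using path_mem_decomposable k p
  simpa using LinearMap.congr_fun h a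

/-- The coefficients of a path in its decomposition. -/
def decompPath : QuiverPath (QVertex r) →
    (YIndex r → k) × (YIndex r → PathAlgebra k (QVertex r)) := fun ⟨i, m, p⟩ =>
  match split p with
  | none => (fun l => if l.source = i ∧ l.target = m then 1 else 0, 0)
  | some (m', q) => (0, fun l => if l.source = i ∧ l.target = m' then path k ⟨first r, m, q⟩ else 0)

theorem extend_decompPath_yElem (l : YIndex r) :
    extend (decompPath k) (yElem k l) = (Pi.single l 1, 0) := by
  rw [yElem, extend_path, decompPath, l.split_path]
  refine Prod.ext (funext fun l' => ?_) rfl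
  change (if _ then (1 : k) else 0) = Pi.single (M := fun _ : YIndex r => k) l 1 l'
  rw [Pi.single_apply]
  refine if_congr ⟨fun h => YIndex.ext_source_target h.1 h.2, ?_⟩ rfl rfl
  rintro rfl
  exact ⟨rfl, rfl⟩

/-- With `extend_decompPath_yElem`, this makes `decompPath` a left inverse of recombination, hence
decompositions are unique. The factor `firstIdem` appears because only paths starting at the first
vertex can follow an arrow `x`. -/
theorem extend_decompPath_mul (l : YIndex r) (b : PathAlgebra k (QVertex r)) :
    extend (decompPath k) (yElem k l * xSum k r * b) = (0, Pi.single l (firstIdem k r * b)) := by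
  have h : extend (decompPath k) ∘ₗ mulHom k (yElem k l * xSum k r) =
      LinearMap.inr k _ _ ∘ₗ LinearMap.single k (fun _ => PathAlgebra k (QVertex r)) l ∘ₗ
        mulHom k (firstIdem k r) := by
    refine lhom_ext fun ⟨i, m, q⟩ => ?_
    change extend (decompPath k) (yElem k l * xSum k r * path k _) =
      (0, Pi.single l (firstIdem k r * path k _))
    rw [yElem, path_mul_xSum]
    by_cases hi : first r = i
    · subst hi
      rw [path_mul_path_comp, firstIdem_mul_path, extend_path, decompPath, split_comp l.split_path]
      refine Prod.ext rfl (funext fun l' => ?_)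
      change (if _ then path k _ else 0) = Pi.single (M := fun _ : YIndex r => _) l _ l'
      rw [Pi.single_apply]
      refine if_congr ⟨fun h => YIndex.ext_source_target h.1 h.2, ?_⟩ rfl rfl
      rintro rfl
      exact ⟨rfl, rfl⟩
    · rw [firstIdem, path_mul_path_of_ne k _ _ hi, path_mul_path_of_ne k _ _ hi, map_zero,
        Pi.single_zero]
      rfl
  exact LinearMap.congr_fun h b

/-- Removing the last arrow places degree `n + 1` inside the product of degree `n` with the finite
dimensional span of the arrows. -/
theorem finiteDimensional_grading (n : ℕ) :
    FiniteDimensional k (grading k (QVertex r) n) := by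
  induction n with
  | zero =>
    refine FiniteDimensional.span_of_finite k ((Set.finite_range
      fun i : QVertex r => path k ⟨i, i, Quiver.Path.nil⟩).subset ?_)
    rintro _ ⟨⟨i, m, p⟩, hp, rfl⟩
    cases p with
    | nil => exact ⟨i, rfl⟩
    | cons p a =>
      simp only [Quiver.Path.length_cons] at hp
      lia
  | succ n ih =>
    have h1 : FiniteDimensional k (Submodule.span k
        (Set.range fun i : QVertex r => path k ⟨i, first r, (xArrow i).toPath⟩) ⊔ Submodule.span k
        (Set.range fun i : Fin r => path k ⟨_, _, (yArrow i (Nat.succ_lt_succ i.2)).toPath⟩) :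
        Submodule k (PathAlgebra k (QVertex r))) := by
      have := FiniteDimensional.span_of_finite k
        (Set.finite_range fun i : QVertex r => path k ⟨i, first r, (xArrow i).toPath⟩)
      have := FiniteDimensional.span_of_finite k (Set.finite_range fun i : Fin r =>
        path k ⟨_, _, (yArrow i (Nat.succ_lt_succ i.2)).toPath⟩)
      infer_instance
    have h2 := Submodule.FG.mul (Module.Finite.iff_fg.1 ih) (Module.Finite.iff_fg.1 h1)
    have h3 := Module.Finite.iff_fg.2 h2
    refine @Submodule.finiteDimensional_of_le _ _ _ _ _ _ _ h3 (Submodule.span_le.2 ?_)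
    rintro _ ⟨⟨i, m, p⟩, hp, rfl⟩
    cases p with
    | nil =>
      simp only [Quiver.Path.length_nil] at hp
      lia
    | cons p a =>
      rw [path_cons]
      refine Submodule.mul_mem_mul (Submodule.subset_span ⟨_, ?_, rfl⟩) ?_
      · simp only [Quiver.Path.length_cons] at hp
        lia
      · induction a using arrow_cases with
        | x i => exact Submodule.mem_sup_left (Submodule.subset_span ⟨i, rfl⟩)
        | y n hn =>
          exact Submodule.mem_sup_right (Submodule.subset_span ⟨⟨n, Nat.lt_of_succ_lt_succ hn⟩, rfl⟩)

theorem grading_of_neg {n : ℤ} (hn : n < 0) : grading k (QVertex r) n = ⊥ := by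
  rw [grading, Submodule.span_eq_bot]
  rintro _ ⟨p, rfl, rfl⟩
  lia

theorem yElem_mem_grading (l : YIndex r) : yElem k l ∈ grading k (QVertex r) l.1.2 :=
  Submodule.subset_span ⟨⟨l.source, l.target, l.path⟩,
    congrArg Nat.cast (length_yPath _ _ _ _), rfl⟩

theorem firstIdem_mem_grading : firstIdem k r ∈ grading k (QVertex r) 0 :=
  Submodule.subset_span ⟨_, rfl, rfl⟩

theorem xSum_mem_grading : xSum k r ∈ grading k (QVertex r) 1 :=
  Submodule.sum_mem _ fun _ _ => Submodule.subset_span ⟨_, rfl, rfl⟩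

variable (r) in
/-- Every path in `Q` either consists of arrows `y` only or has a first arrow `x`. -/
def prefixSystem : PrefixSystem (grading k (QVertex r)) r where
  e := firstIdem k r
  x := xSum k r
  J := YIndex r
  v := yElem k
  δ l := l.1.2
  σ j := ⟨(0, j), by rw [Fin.val_zero, zero_add]; exact j.2⟩
  e_mem := firstIdem_mem_grading k
  e_mul_e := firstIdem_mul_path k _
  x_mem := xSum_mem_grading k
  v_mem := yElem_mem_grading k
  σ_injective a b h := (Prod.ext_iff.1 (Subtype.ext_iff.1 h)).2
  δ_σ _ := rfl
  e_mul_v_σ _ := firstIdem_mul_path k _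
  e_mul_v l hl := by
    refine path_mul_path_of_ne k _ _ fun h => hl ⟨l.1.2, ?_⟩
    exact Subtype.ext (Prod.ext (Fin.ext (vtx_inj.1 h)) rfl)
  finite_deg n := by
    by_cases hn : 0 ≤ n
    · lift n to ℕ using hn
      exact finiteDimensional_grading k n
    · rw [grading_of_neg k (not_le.1 hn)]
      infer_instance
  deg_neg n hn := grading_of_neg k hn
  exists_decomp a := mem_decomposable k a
  decomp_unique c b hb h := by
    have h1 := congrArg (extend (decompPath k)) h
    simp only [map_sum, map_add, map_smul, extend_decompPath_yElem, extend_decompPath_mul, hb,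
      map_zero, Prod.smul_mk, Prod.mk_add_mk, smul_zero, add_zero, zero_add, ← Pi.single_smul,
      smul_eq_mul, mul_one] at h1
    have h2 := congrArg Prod.fst h1
    have h3 := congrArg Prod.snd h1
    rw [Prod.fst_sum] at h2
    rw [Prod.snd_sum] at h3
    exact ⟨(Finset.univ_sum_single c).symm.trans h2, (Finset.univ_sum_single b).symm.trans h3⟩

end PathAlgebra

end

theorem theorem6 {k : Type u} [Field k] (r : ℕ) (hr : 1 ≤ r) :
    ∃ (φ : K0 (Qgr (BAlgebra.grading k r)) ≃ₗ[ℤ[T;T⁻¹]]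
          K0 (Qgr (PathAlgebra.grading k (QVertex r))))
      (ψ : K0 (Qgr (PathAlgebra.grading k (QVertex r))) ≃ₗ[ℤ[T;T⁻¹]]
          ℤ[T;T⁻¹] ⧸ Ideal.span
            {(1 - ∑ i ∈ Finset.range (r + 1), LaurentPolynomial.T ((i : ℤ) + 1) : ℤ[T;T⁻¹])}),
      φ (K0.of (Qgr.structureSheaf (BAlgebra.grading k r))) =
          K0.of (Qgr.structureSheaf (PathAlgebra.grading k (QVertex r))) ∧
        ψ (K0.of (Qgr.structureSheaf (PathAlgebra.grading k (QVertex r)))) = 1 ∧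
        (∀ F : Qgr (BAlgebra.grading k r),
          K0.of ((Qgr.twist (BAlgebra.grading k r) (-1)).obj F) =
            (LaurentPolynomial.T 1 : ℤ[T;T⁻¹]) • K0.of F) ∧
        (∀ F : Qgr (PathAlgebra.grading k (QVertex r)),
          K0.of ((Qgr.twist (PathAlgebra.grading k (QVertex r)) (-1)).obj F) =
            (LaurentPolynomial.T 1 : ℤ[T;T⁻¹]) • K0.of F) := by
  obtain ⟨ψ₁, h₁⟩ := (BAlgebra.prefixSystem k r).exists_k0_equiv
  obtain ⟨ψ₂, h₂⟩ := (PathAlgebra.prefixSystem k r).exists_k0_equiv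
  refine ⟨ψ₁ ≪≫ₗ ψ₂.symm, ψ₂, ?_, h₂, fun F => (Qgr.T_one_smul F).symm,
    fun F => (Qgr.T_one_smul F).symm⟩
  rw [LinearEquiv.trans_apply, h₁, LinearEquiv.symm_apply_eq, h₂]
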